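/- **Setting.** Let $e(z)=e^{2\pi i z}$, let $\mathcal H_2$ be the Siegel upper half space of degree two, and let $N\ge 1$ be an integer. The paramodular group is $$K(N)=\mathrm{Sp}_2(\mathbb Q)\cap\begin{pmatrix} *&*&*/N&*\\ N*&*&*&*\\ N*&N*&*&N*\\ N*&*&*&*\end{pmatrix},\qquad *\in\mathbb Z .$$ For $\gamma=\begin{pmatrix}A&B\\C&D\end{pmatrix}\in\mathrm{GSp}_2^+(\mathbb Q)$ with similitude $\mu(\gamma)=\det(\gamma)^{1/2}$ put $(f|_k\gamma)(\Omega)=\mu(\gamma)^{2k-3}\det(C\Omega+D)^{-k}f((A\Omega+B)(C\Omega+D)^{-1})$. Let $S_2^k(K(N))$ be the space of Siegel cusp forms of weight $k$ for $K(N)$. Let ${}^N\mathcal X_2$ be the set of positive definite matrices $T=\begin{pmatrix} mN&r/2\\ r/2&n\end{pmatrix}$ with $m,r,n\in\mathbb Z$, and let $S_2^k(K(N))(\mathbb Z)$ be the set of $f\in S_2^k(K(N))$ whose Fourier expansion $f(\Omega)=\sum_{T\in{}^N\mathcal X_2}a(T;f)\,e(\mathrm{tr}(T\Omega))$ has all $a(T;f)\in\mathbb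 Z$. For functions $f,h$ with such integral Fourier expansions (possibly of different weights), $f\equiv h \bmod q$ means $a(T;f)\equiv a(T;h)\bmod q$ for all $T\in{}^N\mathcal X_2$; asserting a congruence includes asserting that both sides have integral Fourier expansions. For a prime $q\nmid N$, the Hecke operator $T_q$ in weight $k$ is $T_q(f)=\sum_i f|_k g_i$, where $K(N)\,\mathrm{diag}(1,1,q,q)\,K(N)=\bigsqcup_i K(N)g_i$. The first Fourier–Jacobi coefficient of $f$ is $\phi_1$ in $f\begin{pmatrix}\omega&z\\z&\tau\end{pmatrix}=\sum_{m\ge1}\phi_m(\tau,z)\,e(mN\omega)$. Let $J_{k,N}^{\rm cusp}$ be the space of level one Jacobi cusp forms of weight $k$ and index $N$, and $J_{k,N}^{\rm cusp}(\mathbb Z)$ the subset of those with integral Fourier coefficients. For $\phi(\tau,z)=\sum_{n,r}c(n,r;\phi)\,e(n\tau+rz)\in J_{k,N}^{\rm cusp}$, the Gritsenko lift is $$\mathrm{Grit}(\phi)(\Omega)=\sum_{T}\Bigl(\sum_{\delta\mid(n,r,m)}\delta^{k-1}c\bigl(\tfrac{mn}{\delta^2},\tfrac r\delta;\phi\bigr)\Bigr)e(\mathrm{tr}(T\Omega)),\qquad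 T=\begin{pmatrix} mN&r/2\\ r/2&n\end{pmatrix}\in{}^N\mathcal X_2 .$$ **Theorem.** Let $N\ge1$, $k\ge2$, let $q$ be a prime with $q\nmid N$, and let $g\in S_2^k(K(N))(\mathbb Z)$. Let $T_q$ be the Hecke operator in weight $qk$. Then $$T_q(g^q)\equiv g \bmod q .$$ Furthermore, let $\phi$ be the first Fourier–Jacobi coefficient of $T_q(g^q)$ and $\psi$ that of $g$. Then $\phi\in J_{qk,N}^{\rm cusp}$, $\psi\in J_{k,N}^{\rm cusp}(\mathbb Z)$, and $$\mathrm{Grit}(\psi)\equiv\mathrm{Grit}(\phi)\bmod q .$$ -/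

import Mathlib

open scoped UpperHalfPlane

noncomputable section

namespace Paramodular

/-- `e(z) = exp(2πiz)`. -/
def e (z : ℂ) : ℂ := Complex.exp (2 * Real.pi * Complex.I * z)

/-- The Siegel upper half space of degree two: symmetric complex matrices with positive definite
imaginary part. -/
def siegelSet : Set (Matrix (Fin 2) (Fin 2) ℂ) :=
  {Ω | Ω.IsSymm ∧ (Ω.map Complex.im).PosDef}

/-- The matrix with rows `(τ, z)` and `(z, ω)`. -/
def symMat (τ z ω : ℂ) : Matrix (Fin 2) (Fin 2) ℂ := !![τ, z; z, ω]

open Classical in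
/-- Extension by zero of a function on the Siegel upper half space to all matrices. -/
def extend (f : siegelSet → ℂ) (M : Matrix (Fin 2) (Fin 2) ℂ) : ℂ :=
  if h : M ∈ siegelSet then f ⟨M, h⟩ else 0

/-- Holomorphy in the three coordinates `τ, z, ω`. -/
def IsHolomorphic (f : siegelSet → ℂ) : Prop :=
  DifferentiableOn ℂ (fun p : ℂ × ℂ × ℂ => extend f (symMat p.1 p.2.1 p.2.2))
    {p | symMat p.1 p.2.1 p.2.2 ∈ siegelSet}

/-- Rational `4 × 4` matrices, written in `2 × 2` blocks `(A, B; C, D)`. -/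
abbrev Mat4 : Type := Matrix (Fin 2 ⊕ Fin 2) (Fin 2 ⊕ Fin 2) ℚ

/-- `CΩ + D`. -/
def denom (γ : Mat4) (Ω : Matrix (Fin 2) (Fin 2) ℂ) : Matrix (Fin 2) (Fin 2) ℂ :=
  γ.toBlocks₂₁.map (fun x : ℚ => (x : ℂ)) * Ω + γ.toBlocks₂₂.map (fun x : ℚ => (x : ℂ))

/-- `γ⟨Ω⟩ = (AΩ + B)(CΩ + D)⁻¹`. -/
def act (γ : Mat4) (Ω : Matrix (Fin 2) (Fin 2) ℂ) : Matrix (Fin 2) (Fin 2) ℂ :=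
  (γ.toBlocks₁₁.map (fun x : ℚ => (x : ℂ)) * Ω + γ.toBlocks₁₂.map (fun x : ℚ => (x : ℂ))) *
    (denom γ Ω)⁻¹

/-- The similitude `μ(γ) = det(γ)^{1/2}` of an element of `GSp₂⁺(ℚ)`. -/
def similitude (γ : Mat4) : ℝ := Real.sqrt (γ.det : ℝ)

/-- The slash operator
`(f|ₖγ)(Ω) = μ(γ)^{2k-3} det(CΩ+D)^{-k} f(γ⟨Ω⟩)` for `γ ∈ GSp₂⁺(ℚ)`
(for such `γ` the point `γ⟨Ω⟩` is again in the Siegel upper half space). -/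
def slash (k : ℕ) (γ : Mat4) (f : siegelSet → ℂ) : siegelSet → ℂ := fun Ω =>
  (similitude γ : ℂ) ^ (2 * (k : ℤ) - 3) * (denom γ Ω).det ^ (-(k : ℤ)) * extend f (act γ Ω)

/-- The rational matrix underlying an integral one. -/
def toRat (γ : Matrix (Fin 2 ⊕ Fin 2) (Fin 2 ⊕ Fin 2) ℤ) : Mat4 := γ.map (fun x : ℤ => (x : ℚ))

/-- The denominators/divisibilities of the entries in the paramodular group. -/
def paramodularPattern (N : ℕ) : Mat4 :=
  Matrix.fromBlocks
    !![1, 1; (N : ℚ), 1]                 !![1 / (N : ℚ), 1; 1, 1]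
    !![(N : ℚ), (N : ℚ); (N : ℚ), 1]     !![1, (N : ℚ); 1, 1]

/-- The paramodular group `K(N)`: rational symplectic matrices of the shape
`(*, *, */N, *; N*, *, *, *; N*, N*, *, N*; N*, *, *, *)` with `* ∈ ℤ`. -/
def paramodularGroup (N : ℕ) : Set Mat4 :=
  {γ | γ ∈ Matrix.symplecticGroup (Fin 2) ℚ ∧
    ∀ i j, ∃ m : ℤ, γ i j = paramodularPattern N i j * m}

/-- The space `S₂ᵏ(K(N))` of paramodular cusp forms: holomorphic, invariant, with all `f|γ`,
`γ ∈ Sp₂(ℤ)`, bounded on the domains `Im Ω > Y₀` and annihilated by the Siegel `Φ`-map. -/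
structure IsParamodularCuspForm (k N : ℕ) (f : siegelSet → ℂ) : Prop where
  holomorphic : IsHolomorphic f
  invariant : ∀ γ ∈ paramodularGroup N, slash k γ f = f
  bounded : ∀ γ ∈ Matrix.symplecticGroup (Fin 2) ℤ, ∀ Y₀ : Matrix (Fin 2) (Fin 2) ℝ, Y₀.PosDef →
    ∃ C : ℝ, ∀ Ω : siegelSet, (Ω.1.map Complex.im - Y₀).PosDef → ‖slash k (toRat γ) f Ω‖ ≤ C
  cuspidal : ∀ γ ∈ Matrix.symplecticGroup (Fin 2) ℤ, ∀ τ : ℍ,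
    Filter.Tendsto
      (fun t : ℝ => extend (slash k (toRat γ) f) (symMat (Complex.I * t) 0 τ))
      Filter.atTop (nhds 0)

/-- The half-integral matrix with rows `(mN, r/2)` and `(r/2, n)`, where `p = (m, r, n)`. -/
def indexMatrix (N : ℕ) (p : ℤ × ℤ × ℤ) : Matrix (Fin 2) (Fin 2) ℝ :=
  !![(p.1 : ℝ) * N, (p.2.1 : ℝ) / 2; (p.2.1 : ℝ) / 2, (p.2.2 : ℝ)]

/-- The set `ᴺX₂` of positive definite half-integral matrices `(a, b; b, c)` with `N ∣ a`,
parametrized by triples `(m, r, n)`. -/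
abbrev FourierIndex (N : ℕ) : Type := {p : ℤ × ℤ × ℤ // (indexMatrix N p).PosDef}

/-- `e(⟨T, Ω⟩)`, where `⟨T, Ω⟩ = tr(TΩ)`. -/
def fourierTerm (N : ℕ) (T : FourierIndex N) (Ω : siegelSet) : ℂ :=
  e (((indexMatrix N T.1).map (fun x : ℝ => (x : ℂ)) * Ω.1).trace)

/-- `f(Ω) = ∑ a(T) e(⟨T, Ω⟩)`, the sum running over `T ∈ ᴺX₂`, with integers `a(T)`. -/
def HasIntegralFourierExpansion (N : ℕ) (f : siegelSet → ℂ) (a : FourierIndex N → ℤ) : Prop :=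
  ∀ Ω : siegelSet, HasSum (fun T => (a T : ℂ) * fourierTerm N T Ω) (f Ω)

/-- `S₂ᵏ(K(N))(ℤ)`: the cusp forms whose Fourier coefficients are integers. -/
def IsIntegralParamodularCuspForm (k N : ℕ) (f : siegelSet → ℂ) : Prop :=
  IsParamodularCuspForm k N f ∧ ∃ a, HasIntegralFourierExpansion N f a

/-- `f ≡ h mod q`: both functions have Fourier expansions over `ᴺX₂` with integral coefficients,
and these are congruent modulo `q`, coefficient by coefficient. -/
def FourierCongr (N q : ℕ) (f h : siegelSet → ℂ) : Prop :=
  ∃ a b : FourierIndex N → ℤ, HasIntegralFourierExpansion N f a ∧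
    HasIntegralFourierExpansion N h b ∧ ∀ T, a T ≡ b T [ZMOD q]

/-- The double coset `K(N) diag(1, 1, q, q) K(N)`. -/
def heckeDoubleCoset (N q : ℕ) : Set Mat4 :=
  {g | ∃ γ₁ ∈ paramodularGroup N, ∃ γ₂ ∈ paramodularGroup N,
    g = γ₁ * Matrix.fromBlocks 1 0 0 ((q : ℚ) • (1 : Matrix (Fin 2) (Fin 2) ℚ)) * γ₂}

/-- The cosets `K(N) g` contained in the double coset. -/
def HeckeCosets (N q : ℕ) : Type :=
  Quot (fun g h : heckeDoubleCoset N q => ∃ γ ∈ paramodularGroup N, γ * g.1 = h.1)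

/-- The Hecke operator `T_q` in weight `k`: `f ↦ ∑ᵢ f|ₖgᵢ`, where
`K(N) diag(1, 1, q, q) K(N)` is the disjoint union of the (finitely many) cosets `K(N) gᵢ`. -/
def heckeT (k N q : ℕ) (f : siegelSet → ℂ) : siegelSet → ℂ := fun Ω =>
  ∑ᶠ c : HeckeCosets N q, slash k (Quot.out c).1 f Ω

/-- `Γ_∞(ℤ)`: integral symplectic matrices of the shape
`(*, 0, *, *; *, *, *, *; *, 0, *, *; 0, 0, 0, *)`. -/
def jacobiGroup : Set (Matrix (Fin 2 ⊕ Fin 2) (Fin 2 ⊕ Fin 2) ℤ) :=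
  {γ | γ ∈ Matrix.symplecticGroup (Fin 2) ℤ ∧
    γ (.inl 0) (.inl 1) = 0 ∧ γ (.inr 0) (.inl 1) = 0 ∧
    γ (.inr 1) (.inl 0) = 0 ∧ γ (.inr 1) (.inl 1) = 0 ∧ γ (.inr 1) (.inr 0) = 0}

/-- The function `φ(τ, z) e(mω)` on the Siegel upper half space. -/
def jacobiToSiegel (m : ℕ) (φ : ℍ → ℂ → ℂ) : siegelSet → ℂ := fun Ω =>
  φ (UpperHalfPlane.ofComplex (Ω.1 0 0)) (Ω.1 0 1) * e (m * Ω.1 1 1)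

/-- `φ(τ, z) = ∑ c(n, r) e(nτ + rz)`. -/
def HasJacobiExpansion (φ : ℍ → ℂ → ℂ) (c : ℤ → ℤ → ℂ) : Prop :=
  ∀ (τ : ℍ) (z : ℂ), HasSum (fun p : ℤ × ℤ => c p.1 p.2 * e (p.1 * τ + p.2 * z)) (φ τ z)

/-- Jacobi cusp forms of level one, weight `k` and index `m`. -/
structure IsJacobiCuspForm (k m : ℕ) (φ : ℍ → ℂ → ℂ) : Prop where
  holomorphic : DifferentiableOn ℂ
    (fun p : ℂ × ℂ => φ (UpperHalfPlane.ofComplex p.1) p.2) {p | 0 < p.1.im}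
  invariant : ∀ γ ∈ jacobiGroup, slash k (toRat γ) (jacobiToSiegel m φ) = jacobiToSiegel m φ
  expansion : ∃ c : ℤ → ℤ → ℂ, HasJacobiExpansion φ c ∧
    ∀ n r, c n r ≠ 0 → 0 ≤ n ∧ 0 < 4 * (m : ℤ) * n - r ^ 2

/-- Jacobi cusp forms with integral Fourier coefficients. -/
def IsIntegralJacobiCuspForm (k m : ℕ) (φ : ℍ → ℂ → ℂ) : Prop :=
  IsJacobiCuspForm k m φ ∧ ∃ c : ℤ → ℤ → ℤ, HasJacobiExpansion φ (fun n r => (c n r : ℂ))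

/-- The Fourier coefficient `c(n, r; φ)` of a Jacobi form, as an integral over the periods
`τ = u + i`, `z = x` with `0 ≤ u, x ≤ 1`. -/
def jacobiCoeff (φ : ℍ → ℂ → ℂ) (n r : ℤ) : ℂ :=
  ∫ u in (0 : ℝ)..1, ∫ x in (0 : ℝ)..1,
    φ (UpperHalfPlane.ofComplex ((u : ℂ) + Complex.I)) x *
      e (-(n * ((u : ℂ) + Complex.I) + r * x))

/-- The `m`-th Fourier-Jacobi coefficient `φ_m` of a form on `K(N)`, that is, the coefficient in
the expansion `f(ω, z; z, τ) = ∑ₘ φ_m(τ, z) e(mNω)`, as an integral over `ω = u + iv`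
with `0 ≤ u ≤ 1` and any fixed `v` large enough (`v > (Im z)² / Im τ`). -/
def fourierJacobiCoeff (N m : ℕ) (f : siegelSet → ℂ) : ℍ → ℂ → ℂ := fun τ z =>
  let v : ℝ := z.im ^ 2 / τ.im + 1
  ∫ u in (0 : ℝ)..1,
    extend f (symMat ((u : ℂ) + Complex.I * v) z τ) *
      e (-((m : ℂ) * N * ((u : ℂ) + Complex.I * v)))

/-- The Fourier coefficient of the Gritsenko lift at the index with rows `(mN, r/2)`, `(r/2, n)`:
the sum of `δ^{k-1} c(mn/δ², r/δ; φ)` over the positive common divisors `δ` of `n`, `r`, `m`. -/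
def gritsenkoCoeff (k : ℕ) (φ : ℍ → ℂ → ℂ) (m r n : ℤ) : ℂ :=
  ∑ δ ∈ (Nat.gcd (Int.gcd n r) m.natAbs).divisors,
    (δ : ℂ) ^ (k - 1) * jacobiCoeff φ (m * n / (δ : ℤ) ^ 2) (r / (δ : ℤ))

/-- The Gritsenko lift of a Jacobi cusp form of weight `k` and index `N`. -/
def gritsenkoLift (k N : ℕ) (φ : ℍ → ℂ → ℂ) : siegelSet → ℂ := fun Ω =>
  ∑' T : FourierIndex N, gritsenkoCoeff k φ T.1.1 T.1.2.1 T.1.2.2 * fourierTerm N T Ω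

end Paramodular

end

open scoped UpperHalfPlane

noncomputable section

namespace Paramodular

section

open Matrix

/-! ### Positive definite matrices of size two and the Siegel upper half space -/

/-! Two congruences carry the theorem. Let `a` be the coefficients of `g` and `A` those of `g ^ q`.
Then `A S` sums `∏ a (t i)` over the `q`-tuples `t` of indices with sum `S`. For `S = qT` the cyclic
group of order `q` rotates these tuples, and its only fixed point is the constant tuple `T`. Hence
`A (qT) ≡ a T ^ q ≡ a T` modulo `q` (`finsum_fiber_modEq`, `exists_pow_expansion`).

In weight `K = qk ≥ 3` the double coset of `diag(1, 1, q, q)` splits into four families of upper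
triangular cosets, indexed by the Lagrangian subspaces of a four-dimensional symplectic space over
the field with `q` elements (`heckeRep_bijective`). The family `(1, B; 0, q)` contributes exactly
the coefficient at `qT`. The other families carry factors `q ^ (K - 2)` and `q ^ (2K - 3)`. So `T_q
f` has coefficient congruent to that of `f` at `qT` (`exists_heckeT_expansion`), and `T_q(g ^ q) ≡
g` follows.

For the lifts, the first Fourier-Jacobi coefficient has coefficients `a (1, r, n)`. Its holomorphy
comes from its expansion, and its Jacobi invariance from paramodular invariance after exchanging the
two coordinates (`jacobi_invariant`). The lifts are compared coefficient by coefficient, using `δ ^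
(k - 1) ≡ δ ^ (qk - 1)` (Fermat). Since the lift is defined by an infinite sum, its convergence must
be shown. This rests on the Hecke bound for Jacobi cusp forms (`IsJacobiCuspForm.exists_coeff_le`),
obtained from boundedness of the Petersson norm. -/

theorem posDef_fin_two_iff {Y : Matrix (Fin 2) (Fin 2) ℝ} :
    Y.PosDef ↔ Y 0 1 = Y 1 0 ∧ 0 < Y 0 0 ∧ Y 0 1 ^ 2 < Y 0 0 * Y 1 1 := by
  constructor
  · intro h
    have h01 : Y 0 1 = Y 1 0 := by simpa using h.1.apply 1 0
    refine ⟨h01, ?_, ?_⟩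
    · have := h.dotProduct_mulVec_pos (x := ![1, 0]) (by simp)
      simpa [Matrix.mulVec, dotProduct, Fin.sum_univ_two] using this
    · have := h.det_pos
      rw [Matrix.det_fin_two] at this
      rw [← h01] at this
      nlinarith
  · rintro ⟨h01, h0, hdet⟩
    refine Matrix.PosDef.of_dotProduct_mulVec_pos ?_ ?_
    · ext i j
      fin_cases i <;> fin_cases j <;> simp [h01]
    · intro x hx
      simp only [dotProduct, Matrix.mulVec, Fin.sum_univ_two, star_trivial]
      have key : Y 0 0 * (x 0 * (Y 0 0 * x 0 + Y 0 1 * x 1) + x 1 * (Y 1 0 * x 0 + Y 1 1 * x 1))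
          = (Y 0 0 * x 0 + Y 0 1 * x 1) ^ 2 + (Y 0 0 * Y 1 1 - Y 0 1 ^ 2) * x 1 ^ 2 := by
        rw [← h01]; ring
      have hpos : 0 < (Y 0 0 * x 0 + Y 0 1 * x 1) ^ 2
          + (Y 0 0 * Y 1 1 - Y 0 1 ^ 2) * x 1 ^ 2 := by
        by_cases h1 : x 1 = 0
        · have h2 : x 0 ≠ 0 := by
            intro h2
            apply hx
            ext i
            fin_cases i <;> simp [h1, h2]
          rw [h1]
          have := mul_ne_zero h0.ne' h2
          have := sq_pos_of_ne_zero this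
          simpa using this
        · have := mul_pos (sub_pos.2 hdet) (sq_pos_of_ne_zero h1)
          positivity
      rw [← key] at hpos
      exact (mul_pos_iff_of_pos_left h0).1 hpos

theorem mem_siegelSet_iff {Ω : Matrix (Fin 2) (Fin 2) ℂ} :
    Ω ∈ siegelSet ↔ Ω 0 1 = Ω 1 0 ∧ 0 < (Ω 0 0).im ∧
      (Ω 0 1).im ^ 2 < (Ω 0 0).im * (Ω 1 1).im := by
  simp only [siegelSet, Set.mem_ofPred_eq, posDef_fin_two_iff, Matrix.map_apply]
  constructor
  · rintro ⟨h, -, h1, h2⟩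
    exact ⟨h.apply 1 0, h1, h2⟩
  · rintro ⟨h, h1, h2⟩
    refine ⟨?_, by rw [h], h1, h2⟩
    ext i j
    fin_cases i <;> fin_cases j <;> simp [h]

theorem symMat_mem_siegelSet_iff {τ z ω : ℂ} :
    symMat τ z ω ∈ siegelSet ↔ 0 < τ.im ∧ z.im ^ 2 < τ.im * ω.im := by
  simp [mem_siegelSet_iff, symMat]

theorem extend_of_mem (f : siegelSet → ℂ) {M : Matrix (Fin 2) (Fin 2) ℂ} (h : M ∈ siegelSet) :
    extend f M = f ⟨M, h⟩ := by
  rw [extend, dif_pos h]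

theorem extend_coe (f : siegelSet → ℂ) (Ω : siegelSet) : extend f Ω.1 = f Ω :=
  extend_of_mem f Ω.2

/-! ### Symplectic similitudes -/

/-- Symplectic similitudes with multiplier `μ > 0`. -/
structure IsSimilitude (μ : ℚ) (γ : Mat4) : Prop where
  pos : 0 < μ
  form : γᵀ * J (Fin 2) ℚ * γ = μ • J (Fin 2) ℚ
  -- Taking determinants in `form` only gives `det² = μ⁴`, so the sign is recorded separately.
  det : γ.det = μ ^ 2

theorem IsSimilitude.of_mem {γ : Mat4} (h : γ ∈ symplecticGroup (Fin 2) ℚ) :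
    IsSimilitude 1 γ :=
  ⟨one_pos, by rw [SymplecticGroup.mem_iff'.1 h, one_smul], by
    rw [SymplecticGroup.det_eq_one h, one_pow]⟩

theorem IsSimilitude.mul {μ ν : ℚ} {γ δ : Mat4} (h : IsSimilitude μ γ) (h' : IsSimilitude ν δ) :
    IsSimilitude (μ * ν) (γ * δ) := by
  refine ⟨mul_pos h.pos h'.pos, ?_, by rw [Matrix.det_mul, h.det, h'.det]; ring⟩
  calc (γ * δ)ᵀ * J (Fin 2) ℚ * (γ * δ) = δᵀ * (γᵀ * J (Fin 2) ℚ * γ) * δ := by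
        simp only [Matrix.transpose_mul, Matrix.mul_assoc]
    _ = (μ * ν) • J (Fin 2) ℚ := by
        rw [h.form, Matrix.mul_smul, Matrix.smul_mul, h'.form, smul_smul]

theorem IsSimilitude.similitude_eq {μ : ℚ} {γ : Mat4} (h : IsSimilitude μ γ) :
    similitude γ = μ := by
  rw [similitude, h.det]
  push_cast
  exact Real.sqrt_sq (by exact_mod_cast h.pos.le)

theorem form_fromBlocks_iff {A B C D : Matrix (Fin 2) (Fin 2) ℚ} {μ : ℚ} :
    (fromBlocks A B C D)ᵀ * J (Fin 2) ℚ * fromBlocks A B C D = μ • J (Fin 2) ℚ ↔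
      Aᵀ * C = Cᵀ * A ∧ Bᵀ * D = Dᵀ * B ∧ Aᵀ * D - Cᵀ * B = μ • 1 := by
  simp only [fromBlocks_transpose, J, fromBlocks_multiply, fromBlocks_smul, mul_zero, mul_one,
    zero_add, mul_neg, add_zero, neg_mul, fromBlocks_inj, smul_zero, smul_neg]
  constructor
  · rintro ⟨h1, h2, h3, h4⟩
    refine ⟨?_, ?_, ?_⟩
    · rw [← sub_eq_zero, ← neg_eq_zero, ← h1]; abel
    · rw [← sub_eq_zero, ← neg_eq_zero, ← h4]; abel
    · rw [← neg_neg (μ • (1 : Matrix (Fin 2) (Fin 2) ℚ)), ← h2]; abel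
  · rintro ⟨h1, h2, h3⟩
    refine ⟨by rw [h1]; abel, by rw [← h3]; abel, ?_, by rw [h2]; abel⟩
    have := congrArg transpose h3
    simp only [transpose_sub, transpose_mul, transpose_transpose, transpose_smul,
      transpose_one] at this
    rw [← this]; abel

theorem det_fromBlocks_zero {A B D : Matrix (Fin 2) (Fin 2) ℚ} {μ : ℚ} (h : Aᵀ * D = μ • 1) :
    (fromBlocks A B 0 D).det = μ ^ 2 := by
  rw [det_fromBlocks_zero₂₁, ← det_transpose A, ← det_mul, h, det_smul]
  simp

/-- The numerator `AΩ + B`. -/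
def numer (γ : Mat4) (Ω : Matrix (Fin 2) (Fin 2) ℂ) : Matrix (Fin 2) (Fin 2) ℂ :=
  γ.toBlocks₁₁.map (fun x : ℚ => (x : ℂ)) * Ω + γ.toBlocks₁₂.map (fun x : ℚ => (x : ℂ))

theorem act_eq (γ : Mat4) (Ω : Matrix (Fin 2) (Fin 2) ℂ) :
    act γ Ω = numer γ Ω * (denom γ Ω)⁻¹ := rfl

theorem map_ratCast_mul (M M' : Matrix (Fin 2) (Fin 2) ℚ) :
    (M * M').map (fun x : ℚ => (x : ℂ)) =
      M.map (fun x : ℚ => (x : ℂ)) * M'.map (fun x : ℚ => (x : ℂ)) :=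
  Matrix.map_mul (f := Rat.castHom ℂ)

theorem map_ratCast_add (M M' : Matrix (Fin 2) (Fin 2) ℚ) :
    (M + M').map (fun x : ℚ => (x : ℂ)) =
      M.map (fun x : ℚ => (x : ℂ)) + M'.map (fun x : ℚ => (x : ℂ)) := by
  ext i j; simp

theorem map_ratCast_sub (M M' : Matrix (Fin 2) (Fin 2) ℚ) :
    (M - M').map (fun x : ℚ => (x : ℂ)) =
      M.map (fun x : ℚ => (x : ℂ)) - M'.map (fun x : ℚ => (x : ℂ)) := by
  ext i j; simp

theorem numer_mul (γ δ : Mat4) (Ω : Matrix (Fin 2) (Fin 2) ℂ) :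
    numer (γ * δ) Ω = γ.toBlocks₁₁.map (fun x : ℚ => (x : ℂ)) * numer δ Ω +
      γ.toBlocks₁₂.map (fun x : ℚ => (x : ℂ)) * denom δ Ω := by
  have h1 : (γ * δ).toBlocks₁₁ = γ.toBlocks₁₁ * δ.toBlocks₁₁ + γ.toBlocks₁₂ * δ.toBlocks₂₁ := by
    conv_lhs => rw [← fromBlocks_toBlocks γ, ← fromBlocks_toBlocks δ, fromBlocks_multiply]
    simp
  have h2 : (γ * δ).toBlocks₁₂ = γ.toBlocks₁₁ * δ.toBlocks₁₂ + γ.toBlocks₁₂ * δ.toBlocks₂₂ := by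
    conv_lhs => rw [← fromBlocks_toBlocks γ, ← fromBlocks_toBlocks δ, fromBlocks_multiply]
    simp
  simp only [numer, denom, h1, h2, map_ratCast_add, map_ratCast_mul]
  noncomm_ring

theorem denom_mul_aux (γ δ : Mat4) (Ω : Matrix (Fin 2) (Fin 2) ℂ) :
    denom (γ * δ) Ω = γ.toBlocks₂₁.map (fun x : ℚ => (x : ℂ)) * numer δ Ω +
      γ.toBlocks₂₂.map (fun x : ℚ => (x : ℂ)) * denom δ Ω := by
  have h1 : (γ * δ).toBlocks₂₁ = γ.toBlocks₂₁ * δ.toBlocks₁₁ + γ.toBlocks₂₂ * δ.toBlocks₂₁ := by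
    conv_lhs => rw [← fromBlocks_toBlocks γ, ← fromBlocks_toBlocks δ, fromBlocks_multiply]
    simp
  have h2 : (γ * δ).toBlocks₂₂ = γ.toBlocks₂₁ * δ.toBlocks₁₂ + γ.toBlocks₂₂ * δ.toBlocks₂₂ := by
    conv_lhs => rw [← fromBlocks_toBlocks γ, ← fromBlocks_toBlocks δ, fromBlocks_multiply]
    simp
  simp only [numer, denom, h1, h2, map_ratCast_add, map_ratCast_mul]
  noncomm_ring

theorem denom_mul (γ δ : Mat4) {Ω : Matrix (Fin 2) (Fin 2) ℂ} (h : IsUnit (denom δ Ω).det) :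
    denom (γ * δ) Ω = denom γ (act δ Ω) * denom δ Ω := by
  rw [denom_mul_aux, denom.eq_1 γ, act_eq, Matrix.add_mul, ← Matrix.mul_assoc,
    Matrix.nonsing_inv_mul_cancel_right _ _ h]

theorem numer_mul' (γ δ : Mat4) {Ω : Matrix (Fin 2) (Fin 2) ℂ} (h : IsUnit (denom δ Ω).det) :
    numer (γ * δ) Ω = numer γ (act δ Ω) * denom δ Ω := by
  rw [numer_mul, numer.eq_1 γ, act_eq, Matrix.add_mul, ← Matrix.mul_assoc,
    Matrix.nonsing_inv_mul_cancel_right _ _ h]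

theorem act_mul (γ δ : Mat4) {Ω : Matrix (Fin 2) (Fin 2) ℂ} (h : IsUnit (denom δ Ω).det) :
    act (γ * δ) Ω = act γ (act δ Ω) := by
  rw [act_eq, numer_mul' γ δ h, denom_mul γ δ h, Matrix.mul_inv_rev, act_eq γ,
    Matrix.mul_assoc, Matrix.mul_nonsing_inv_cancel_left _ _ h]

/-- The left side pairs `(X, 1)` with `(Ω, 1)` through `γᵀ J γ`. The matrix `X` is left free because
two values are needed: `X = Ωᴴ` governs the imaginary part of `γ⟨Ω⟩`, and `X = Ωᵀ` its symmetry. -/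
theorem IsSimilitude.numer_denom {μ : ℚ} {γ : Mat4} (h : IsSimilitude μ γ)
    (X Ω : Matrix (Fin 2) (Fin 2) ℂ) :
    (X * (γ.toBlocks₁₁.map (fun x : ℚ => (x : ℂ)))ᵀ +
        (γ.toBlocks₁₂.map (fun x : ℚ => (x : ℂ)))ᵀ) * denom γ Ω -
      (X * (γ.toBlocks₂₁.map (fun x : ℚ => (x : ℂ)))ᵀ +
        (γ.toBlocks₂₂.map (fun x : ℚ => (x : ℂ)))ᵀ) * numer γ Ω = (μ : ℂ) • (X - Ω) := by
  have hf := h.form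
  rw [← fromBlocks_toBlocks γ, form_fromBlocks_iff] at hf
  obtain ⟨h1, h2, h3⟩ := hf
  set A := γ.toBlocks₁₁
  set B := γ.toBlocks₁₂
  set C := γ.toBlocks₂₁
  set D := γ.toBlocks₂₂
  have h4 : Dᵀ * A - Bᵀ * C = μ • 1 := by
    have := congrArg transpose h3
    simpa only [transpose_sub, transpose_mul, transpose_transpose, transpose_smul,
      transpose_one] using this
  have hone : (μ • (1 : Matrix (Fin 2) (Fin 2) ℚ)).map (fun x : ℚ => (x : ℂ)) = (μ : ℂ) • 1 := by
    ext i j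
    fin_cases i <;> fin_cases j <;> simp
  replace h1 := congrArg (fun M : Matrix (Fin 2) (Fin 2) ℚ => M.map (fun x : ℚ => (x : ℂ))) h1
  replace h2 := congrArg (fun M : Matrix (Fin 2) (Fin 2) ℚ => M.map (fun x : ℚ => (x : ℂ))) h2
  replace h3 := congrArg (fun M : Matrix (Fin 2) (Fin 2) ℚ => M.map (fun x : ℚ => (x : ℂ))) h3
  replace h4 := congrArg (fun M : Matrix (Fin 2) (Fin 2) ℚ => M.map (fun x : ℚ => (x : ℂ))) h4
  simp only [map_ratCast_mul, map_ratCast_sub, transpose_map, hone] at h1 h2 h3 h4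
  simp only [numer, denom]
  set a := A.map (fun x : ℚ => (x : ℂ))
  set b := B.map (fun x : ℚ => (x : ℂ))
  set c := C.map (fun x : ℚ => (x : ℂ))
  set d := D.map (fun x : ℚ => (x : ℂ))
  calc _ = X * (aᵀ * c - cᵀ * a) * Ω + X * (aᵀ * d - cᵀ * b) - (dᵀ * a - bᵀ * c) * Ω
        + (bᵀ * d - dᵀ * b) := by noncomm_ring
    _ = _ := by
      have h1' : aᵀ * c = cᵀ * a := h1
      have h2' : bᵀ * d = dᵀ * b := h2
      have h3' : aᵀ * d - cᵀ * b = (μ : ℂ) • 1 := h3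
      have h4' : dᵀ * a - bᵀ * c = (μ : ℂ) • 1 := h4
      rw [h1', h2', h3', h4', sub_self, sub_self]
      simp [smul_sub]

theorem re_quadForm {Y : Matrix (Fin 2) (Fin 2) ℝ} (hY : Y.PosDef) {w : Fin 2 → ℂ} (hw : w ≠ 0) :
    0 < (star w ⬝ᵥ (Y.map (fun x : ℝ => (x : ℂ)) *ᵥ w)).re := by
  have h01 := (posDef_fin_two_iff.1 hY).1
  have key : (star w ⬝ᵥ (Y.map (fun x : ℝ => (x : ℂ)) *ᵥ w)).re =
      star (fun i => (w i).re) ⬝ᵥ (Y *ᵥ fun i => (w i).re) +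
      star (fun i => (w i).im) ⬝ᵥ (Y *ᵥ fun i => (w i).im) := by
    simp [dotProduct, Matrix.mulVec, Fin.sum_univ_two]
    ring
  rw [key]
  by_cases h : (fun i => (w i).re) = 0
  · have h' : (fun i => (w i).im) ≠ 0 := by
      intro h'
      apply hw
      ext i
      exact Complex.ext (congrFun h i) (congrFun h' i)
    rw [h]
    simpa using hY.dotProduct_mulVec_pos h'
  · have h1 := hY.dotProduct_mulVec_pos h
    have h2 := hY.posSemidef.dotProduct_mulVec_nonneg (fun i => (w i).im)
    linarith

theorem conjTranspose_sub_self {Ω : Matrix (Fin 2) (Fin 2) ℂ} (h : Ω 0 1 = Ω 1 0) :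
    Ωᴴ - Ω = (-2 * Complex.I) • (Ω.map Complex.im).map (fun x : ℝ => (x : ℂ)) := by
  ext i j
  fin_cases i <;> fin_cases j <;> simp [Complex.ext_iff, h] <;> ring

theorem conjTranspose_map_ratCast (M : Matrix (Fin 2) (Fin 2) ℚ) :
    (M.map (fun x : ℚ => (x : ℂ)))ᴴ = (M.map (fun x : ℚ => (x : ℂ)))ᵀ := by
  ext i j; simp

theorem IsSimilitude.conjTranspose_numer_denom {μ : ℚ} {γ : Mat4} (h : IsSimilitude μ γ)
    (Ω : Matrix (Fin 2) (Fin 2) ℂ) :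
    (numer γ Ω)ᴴ * denom γ Ω - (denom γ Ω)ᴴ * numer γ Ω = (μ : ℂ) • (Ωᴴ - Ω) := by
  rw [← h.numer_denom, numer, denom, conjTranspose_add, conjTranspose_mul, conjTranspose_add,
    conjTranspose_mul]
  simp only [conjTranspose_map_ratCast]

theorem IsSimilitude.transpose_numer_denom {μ : ℚ} {γ : Mat4} (h : IsSimilitude μ γ)
    {Ω : Matrix (Fin 2) (Fin 2) ℂ} (hΩ : Ωᵀ = Ω) :
    (numer γ Ω)ᵀ * denom γ Ω = (denom γ Ω)ᵀ * numer γ Ω := by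
  rw [← sub_eq_zero]
  have := h.numer_denom Ωᵀ Ω
  rw [hΩ, sub_self, smul_zero] at this
  rw [← this]
  simp only [numer, denom, transpose_add, transpose_mul, hΩ]

/-- A kernel vector `v` of `CΩ + D`, inserted in the hermitian identity, would give `v* (Im Ω) v =
0`, against positive definiteness. -/
theorem IsSimilitude.isUnit_det_denom {μ : ℚ} {γ : Mat4} (h : IsSimilitude μ γ)
    {Ω : Matrix (Fin 2) (Fin 2) ℂ} (hΩ : Ω ∈ siegelSet) : IsUnit (denom γ Ω).det := by
  rw [isUnit_iff_ne_zero]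
  intro h0
  obtain ⟨v, hv, hv0⟩ := Matrix.exists_mulVec_eq_zero_iff.2 h0
  have h1 := h.conjTranspose_numer_denom Ω
  rw [conjTranspose_sub_self (mem_siegelSet_iff.1 hΩ).1] at h1
  have h2 := congrArg (fun M => star v ⬝ᵥ (M *ᵥ v)) h1
  simp only [sub_mulVec, smul_mulVec, dotProduct_smul, dotProduct_sub, ← mulVec_mulVec, hv0,
    mulVec_zero, dotProduct_zero] at h2
  have h3 : star v ⬝ᵥ ((denom γ Ω)ᴴ *ᵥ (numer γ Ω *ᵥ v)) = 0 := by
    rw [dotProduct_mulVec, ← star_mulVec, hv0]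
    simp
  rw [h3, sub_zero] at h2
  have h4 := re_quadForm hΩ.2 hv
  have hμ : (μ : ℂ) ≠ 0 := by exact_mod_cast h.pos.ne'
  have h5 := h2.symm
  simp only [smul_eq_mul, mul_eq_zero, hμ, false_or, neg_eq_zero, OfNat.ofNat_ne_zero,
    Complex.I_ne_zero] at h5
  rw [h5] at h4
  simp at h4

theorem IsSimilitude.transpose_act {μ : ℚ} {γ : Mat4} (h : IsSimilitude μ γ)
    {Ω : Matrix (Fin 2) (Fin 2) ℂ} (hΩ : Ω ∈ siegelSet) : (act γ Ω)ᵀ = act γ Ω := by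
  have hu := h.isUnit_det_denom hΩ
  have hut : IsUnit ((denom γ Ω)ᵀ).det := by rwa [det_transpose]
  rw [act_eq, transpose_mul, transpose_nonsing_inv]
  have h1 := h.transpose_numer_denom hΩ.1
  calc ((denom γ Ω)ᵀ)⁻¹ * (numer γ Ω)ᵀ
      = ((denom γ Ω)ᵀ)⁻¹ * ((numer γ Ω)ᵀ * denom γ Ω) * (denom γ Ω)⁻¹ := by
        rw [Matrix.mul_assoc, Matrix.mul_nonsing_inv_cancel_right _ _ hu]
    _ = numer γ Ω * (denom γ Ω)⁻¹ := by
        rw [h1, Matrix.nonsing_inv_mul_cancel_left _ _ hut]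

/-- `(CΩ+D)ᴴ Im(γ⟨Ω⟩) (CΩ+D) = μ Im Ω`. -/
theorem IsSimilitude.im_act {μ : ℚ} {γ : Mat4} (h : IsSimilitude μ γ)
    {Ω : Matrix (Fin 2) (Fin 2) ℂ} (hΩ : Ω ∈ siegelSet) :
    (denom γ Ω)ᴴ * ((act γ Ω).map Complex.im).map (fun x : ℝ => (x : ℂ)) * denom γ Ω =
      (μ : ℂ) • (Ω.map Complex.im).map (fun x : ℝ => (x : ℂ)) := by
  have hu := h.isUnit_det_denom hΩ
  have hsym := h.transpose_act hΩ
  have h1 := h.conjTranspose_numer_denom Ω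
  have h01 : act γ Ω 0 1 = act γ Ω 1 0 := congrFun (congrFun hsym 1) 0
  have hnum : numer γ Ω = act γ Ω * denom γ Ω := by
    rw [act_eq, Matrix.nonsing_inv_mul_cancel_right _ _ hu]
  rw [conjTranspose_sub_self (mem_siegelSet_iff.1 hΩ).1, hnum, conjTranspose_mul] at h1
  have h2 : (denom γ Ω)ᴴ * ((act γ Ω)ᴴ - act γ Ω) * denom γ Ω =
      (μ : ℂ) • (-2 * Complex.I) • (Ω.map Complex.im).map (fun x : ℝ => (x : ℂ)) := by
    rw [← h1]; noncomm_ring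
  rw [conjTranspose_sub_self h01, Matrix.mul_smul, Matrix.smul_mul, smul_comm (μ : ℂ)] at h2
  have h3 : (-2 * Complex.I) ≠ 0 := by simp
  exact (smul_right_injective _ h3) h2

theorem IsSimilitude.det_im_act {μ : ℚ} {γ : Mat4} (h : IsSimilitude μ γ)
    {Ω : Matrix (Fin 2) (Fin 2) ℂ} (hΩ : Ω ∈ siegelSet) :
    ((act γ Ω).map Complex.im).det * ‖(denom γ Ω).det‖ ^ 2 =
      (μ : ℝ) ^ 2 * (Ω.map Complex.im).det := by
  have h1 := congrArg Matrix.det (h.im_act hΩ)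
  have hd : ∀ M : Matrix (Fin 2) (Fin 2) ℝ, (M.map (fun x : ℝ => (x : ℂ))).det = (M.det : ℂ) := by
    intro M; simp [Matrix.det_fin_two]
  rw [det_mul, det_mul, det_smul, det_conjTranspose, hd, hd] at h1
  have h2 : star (denom γ Ω).det * (denom γ Ω).det = ((‖(denom γ Ω).det‖ ^ 2 : ℝ) : ℂ) := by
    rw [mul_comm, Complex.star_def, Complex.mul_conj, Complex.normSq_eq_norm_sq]
  have h3 : (((act γ Ω).map Complex.im).det : ℂ) * ((‖(denom γ Ω).det‖ ^ 2 : ℝ) : ℂ) =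
      (μ : ℂ) ^ 2 * (Ω.map Complex.im).det := by
    rw [← h2]
    simp only [Fintype.card_fin] at h1
    rw [← h1]; ring
  exact_mod_cast h3

theorem IsSimilitude.act_mem {μ : ℚ} {γ : Mat4} (h : IsSimilitude μ γ)
    {Ω : Matrix (Fin 2) (Fin 2) ℂ} (hΩ : Ω ∈ siegelSet) : act γ Ω ∈ siegelSet := by
  have hu := h.isUnit_det_denom hΩ
  have hsym := h.transpose_act hΩ
  have hμ : (0 : ℝ) < μ := by exact_mod_cast h.pos
  refine ⟨hsym, posDef_fin_two_iff.2 ⟨?_, ?_, ?_⟩⟩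
  · simp only [Matrix.map_apply]
    rw [show act γ Ω 0 1 = act γ Ω 1 0 from congrFun (congrFun hsym 1) 0]
  -- Testing `im_act` on `(CΩ + D)⁻¹ e₀` isolates the upper left entry of `Im γ⟨Ω⟩`. The determinant
  -- is then enough for positivity.
  · have hw : (denom γ Ω)⁻¹ *ᵥ ![1, 0] ≠ 0 := by
      intro h0
      have := congrArg (fun v => denom γ Ω *ᵥ v) h0
      simp only [mulVec_mulVec, Matrix.mul_nonsing_inv _ hu, one_mulVec, mulVec_zero] at this
      simpa using congrFun this 0
    have h1 := re_quadForm hΩ.2 hw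
    have h2 := congrArg (fun M => ((star ((denom γ Ω)⁻¹ *ᵥ ![1, 0])) ⬝ᵥ
      (M *ᵥ ((denom γ Ω)⁻¹ *ᵥ ![1, 0]))).re) (h.im_act hΩ)
    simp only [smul_mulVec, dotProduct_smul] at h2
    rw [← mulVec_mulVec, ← mulVec_mulVec, mulVec_mulVec _ (denom γ Ω), Matrix.mul_nonsing_inv _ hu,
      one_mulVec, dotProduct_mulVec, ← star_mulVec, mulVec_mulVec, Matrix.mul_nonsing_inv _ hu,
      one_mulVec, smul_eq_mul] at h2
    have h3 : (((μ : ℚ) : ℂ)) = ((μ : ℝ) : ℂ) := by simp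
    rw [h3, Complex.re_ofReal_mul] at h2
    have h4 := mul_pos hμ h1
    rw [← h2] at h4
    simpa [dotProduct, Matrix.mulVec, Fin.sum_univ_two] using h4
  · have h1 := h.det_im_act hΩ
    have h2 : 0 < (Ω.map Complex.im).det := hΩ.2.det_pos
    have h3 : 0 < ((act γ Ω).map Complex.im).det := by
      have h4 : 0 < ((act γ Ω).map Complex.im).det * ‖(denom γ Ω).det‖ ^ 2 := by
        rw [h1]; positivity
      have h5 : 0 < ‖(denom γ Ω).det‖ ^ 2 := by
        have := norm_pos_iff.2 hu.ne_zero
        positivity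
      exact (mul_pos_iff_of_pos_right h5).1 h4
    rw [det_fin_two] at h3
    have h4 : act γ Ω 0 1 = act γ Ω 1 0 := congrFun (congrFun hsym 1) 0
    simp only [Matrix.map_apply] at h3 ⊢
    rw [← h4] at h3
    nlinarith

theorem IsSimilitude.slash_apply {μ : ℚ} {γ : Mat4} (h : IsSimilitude μ γ) (k : ℕ)
    (f : siegelSet → ℂ) (Ω : siegelSet) :
    slash k γ f Ω = (μ : ℂ) ^ (2 * (k : ℤ) - 3) * (denom γ Ω).det ^ (-(k : ℤ)) *
      f ⟨act γ Ω, h.act_mem Ω.2⟩ := by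
  rw [slash, h.similitude_eq, extend_of_mem f (h.act_mem Ω.2)]
  simp

theorem slash_mul {μ ν : ℚ} {γ δ : Mat4} (h : IsSimilitude μ γ) (h' : IsSimilitude ν δ) (k : ℕ)
    (f : siegelSet → ℂ) : slash k (γ * δ) f = slash k δ (slash k γ f) := by
  funext Ω
  have hu := h'.isUnit_det_denom Ω.2
  rw [(h.mul h').slash_apply, h'.slash_apply, h.slash_apply]
  have h1 : (⟨act (γ * δ) Ω, (h.mul h').act_mem Ω.2⟩ : siegelSet) =
      ⟨act γ (act δ Ω), h.act_mem (h'.act_mem Ω.2)⟩ := Subtype.ext (act_mul γ δ hu)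
  rw [h1, denom_mul γ δ hu, det_mul, mul_zpow]
  push_cast
  rw [mul_zpow]
  ring

/-- The normalising factor `μ ^ (2k - 3)` is not multiplicative in the weight, so slashing commutes
with powers only when it is trivial, as for `μ = 1`. -/
theorem slash_pow {μ : ℚ} {γ : Mat4} (h : IsSimilitude μ γ) (hμ : μ = 1) (k q : ℕ)
    (f : siegelSet → ℂ) : slash (q * k) γ (f ^ q) = (slash k γ f) ^ q := by
  subst hμ
  funext Ω
  rw [Pi.pow_apply, h.slash_apply, h.slash_apply]
  simp only [Rat.cast_one, _root_.one_zpow, one_mul, Pi.pow_apply, mul_pow, _root_.zpow_neg, zpow_natCast,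
    inv_pow, ← pow_mul, mul_comm q k]

end

section

open Matrix

/-! ### The paramodular group and its Hecke cosets -/

/-- Matrices with the denominators and divisibilities of the paramodular group. -/
def IsPattern (N : ℕ) (M : Mat4) : Prop := ∀ i j, ∃ m : ℤ, M i j = paramodularPattern N i j * m

/-- This makes the pattern closed under matrix products: every summand of an entry of the product is
an integral multiple of the prescribed entry, the extra factor being `1`, `N` or `N²`. -/
theorem paramodularPattern_mul {N : ℕ} (hN : 0 < N) (i l j : Fin 2 ⊕ Fin 2) :
    ∃ m : ℤ, paramodularPattern N i l * paramodularPattern N l j =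
      paramodularPattern N i j * m := by
  have hN' : (N : ℚ) ≠ 0 := by exact_mod_cast hN.ne'
  have h : ∃ m : ℕ, m ∈ ({1, N, N ^ 2} : Finset ℕ) ∧
      paramodularPattern N i l * paramodularPattern N l j = paramodularPattern N i j * m := by
    simp only [Finset.mem_insert, Finset.mem_singleton, exists_eq_or_imp, exists_eq_left]
    rcases i with i | i <;> rcases l with l | l <;> rcases j with j | j <;>
      fin_cases i <;> fin_cases l <;> fin_cases j <;>
      simp [paramodularPattern, hN', pow_two]
  obtain ⟨m, -, hm⟩ := h
  exact ⟨m, by exact_mod_cast hm⟩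

theorem IsPattern.mul {N : ℕ} (hN : 0 < N) {M M' : Mat4} (h : IsPattern N M)
    (h' : IsPattern N M') : IsPattern N (M * M') := by
  intro i j
  choose a ha using h
  choose b hb using h'
  choose c hc using fun l => paramodularPattern_mul hN i l j
  refine ⟨∑ l, c l * a i l * b l j, ?_⟩
  rw [Matrix.mul_apply]
  push_cast
  rw [Finset.mul_sum]
  refine Finset.sum_congr rfl fun l _ => ?_
  rw [ha, hb]
  linear_combination (a i l : ℚ) * b l j * hc l

/-- The symplectic adjoint `-J Mᵀ J`. -/
def sympAdj (M : Mat4) : Mat4 :=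
  fromBlocks M.toBlocks₂₂ᵀ (-M.toBlocks₁₂ᵀ) (-M.toBlocks₂₁ᵀ) M.toBlocks₁₁ᵀ

theorem sympAdj_eq (M : Mat4) : sympAdj M = -J (Fin 2) ℚ * Mᵀ * J (Fin 2) ℚ := by
  conv_rhs => rw [← fromBlocks_toBlocks M]
  simp [sympAdj, J, fromBlocks_transpose, fromBlocks_multiply, fromBlocks_neg]

theorem IsPattern.sympAdj {N : ℕ} {M : Mat4} (h : IsPattern N M) : IsPattern N (sympAdj M) := by
  choose a ha using h
  -- The adjoint moves entries, up to sign, only between positions with equal pattern entries, so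
  -- the same integers serve as witnesses.
  have key : ∀ i j i' j', paramodularPattern N i j = paramodularPattern N j' i' → ∀ m : ℤ,
      (Paramodular.sympAdj M i j = M j' i' ∨ Paramodular.sympAdj M i j = -M j' i') →
      ∃ m : ℤ, Paramodular.sympAdj M i j = paramodularPattern N i j * m := by
    intro i j i' j' hp m h
    rcases h with h | h
    · exact ⟨a j' i', by rw [h, ha, hp]⟩
    · exact ⟨-a j' i', by rw [h, ha, hp]; push_cast; ring⟩
  intro i j
  rcases i with i | i <;> rcases j with j | j
  · refine key _ _ (.inr i) (.inr j) ?_ 0 (.inl rfl)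
    fin_cases i <;> fin_cases j <;> simp [paramodularPattern]
  · refine key _ _ (.inr i) (.inl j) ?_ 0 (.inr rfl)
    fin_cases i <;> fin_cases j <;> simp [paramodularPattern]
  · refine key _ _ (.inl i) (.inr j) ?_ 0 (.inr rfl)
    fin_cases i <;> fin_cases j <;> simp [paramodularPattern]
  · refine key _ _ (.inl i) (.inl j) ?_ 0 (.inl rfl)
    fin_cases i <;> fin_cases j <;> simp [paramodularPattern]

theorem IsSimilitude.sympAdj_mul {μ : ℚ} {γ : Mat4} (h : IsSimilitude μ γ) :
    sympAdj γ * γ = μ • 1 := by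
  have : sympAdj γ * γ = -J (Fin 2) ℚ * (γᵀ * J (Fin 2) ℚ * γ) := by
    rw [sympAdj_eq]; simp only [Matrix.mul_assoc]
  rw [this, h.form, Matrix.mul_smul, Matrix.neg_mul, J_squared, neg_neg]

theorem IsSimilitude.mul_sympAdj {μ : ℚ} {γ : Mat4} (h : IsSimilitude μ γ) :
    γ * sympAdj γ = μ • 1 := by
  have h1 : (μ⁻¹ • sympAdj γ) * γ = 1 := by
    rw [Matrix.smul_mul, h.sympAdj_mul, smul_smul, inv_mul_cancel₀ h.pos.ne', one_smul]
  have h2 := mul_eq_one_comm.1 h1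
  rw [Matrix.mul_smul] at h2
  rw [← h2, smul_smul, mul_inv_cancel₀ h.pos.ne', one_smul]

theorem paramodularGroup_mul_mem {N : ℕ} (hN : 0 < N) {γ δ : Mat4} (h : γ ∈ paramodularGroup N)
    (h' : δ ∈ paramodularGroup N) : γ * δ ∈ paramodularGroup N :=
  ⟨mul_mem h.1 h'.1, IsPattern.mul hN h.2 h'.2⟩

theorem IsSimilitude.of_mem_paramodularGroup {N : ℕ} {γ : Mat4} (h : γ ∈ paramodularGroup N) :
    IsSimilitude 1 γ := .of_mem h.1

theorem sympAdj_mem {N : ℕ} {γ : Mat4} (h : γ ∈ paramodularGroup N) :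
    sympAdj γ ∈ paramodularGroup N := by
  refine ⟨?_, IsPattern.sympAdj h.2⟩
  rw [sympAdj_eq]
  exact mul_mem (mul_mem (SymplecticGroup.neg_mem (SymplecticGroup.J_mem _ _))
    (SymplecticGroup.transpose_mem h.1)) (SymplecticGroup.J_mem _ _)

theorem sympAdj_mul_self {N : ℕ} {γ : Mat4} (h : γ ∈ paramodularGroup N) :
    sympAdj γ * γ = 1 := by
  rw [(IsSimilitude.of_mem_paramodularGroup h).sympAdj_mul, one_smul]

theorem mul_sympAdj_self {N : ℕ} {γ : Mat4} (h : γ ∈ paramodularGroup N) :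
    γ * sympAdj γ = 1 := by
  rw [(IsSimilitude.of_mem_paramodularGroup h).mul_sympAdj, one_smul]

theorem one_mem_paramodularGroup {N : ℕ} (hN : 0 < N) : (1 : Mat4) ∈ paramodularGroup N := by
  refine ⟨one_mem _, fun i j => ?_⟩
  have hN' : (N : ℚ) ≠ 0 := by exact_mod_cast hN.ne'
  rcases eq_or_ne i j with rfl | h
  · refine ⟨1, ?_⟩
    rcases i with i | i <;> fin_cases i <;> simp [paramodularPattern]
  · exact ⟨0, by simp [h]⟩

/-- The matrix `diag(1, 1, q, q)`. -/
abbrev heckeDiag (q : ℕ) : Mat4 :=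
  fromBlocks 1 0 0 ((q : ℚ) • (1 : Matrix (Fin 2) (Fin 2) ℚ))

theorem isSimilitude_heckeDiag {q : ℕ} (hq : 0 < q) : IsSimilitude q (heckeDiag q) := by
  refine ⟨by exact_mod_cast hq, ?_, ?_⟩
  · rw [form_fromBlocks_iff]
    simp
  · rw [det_fromBlocks_zero₂₁]
    simp

theorem isPattern_heckeDiag {N q : ℕ} : IsPattern N (heckeDiag q) := by
  intro i j
  by_cases h : i = j
  · subst h
    rcases i with i | i
    · refine ⟨1, ?_⟩
      fin_cases i <;> simp [paramodularPattern]
    · refine ⟨q, ?_⟩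
      fin_cases i <;> simp [paramodularPattern]
  · refine ⟨0, ?_⟩
    rcases i with i | i <;> rcases j with j | j <;> simp at h ⊢ <;> simp [h]

theorem IsSimilitude.of_mem_heckeDoubleCoset {N q : ℕ} (hq : 0 < q) {g : Mat4}
    (h : g ∈ heckeDoubleCoset N q) : IsSimilitude q g := by
  obtain ⟨γ₁, h1, γ₂, h2, rfl⟩ := h
  simpa using ((of_mem_paramodularGroup h1).mul (isSimilitude_heckeDiag hq)).mul
    (of_mem_paramodularGroup h2)

theorem IsPattern.of_mem_heckeDoubleCoset {N q : ℕ} (hN : 0 < N) {g : Mat4}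
    (h : g ∈ heckeDoubleCoset N q) : IsPattern N g := by
  obtain ⟨γ₁, h1, γ₂, h2, rfl⟩ := h
  exact (IsPattern.mul hN h1.2 isPattern_heckeDiag).mul hN h2.2

theorem mul_mem_heckeDoubleCoset {N q : ℕ} (hN : 0 < N) {g δ : Mat4}
    (h : g ∈ heckeDoubleCoset N q) (hδ : δ ∈ paramodularGroup N) :
    g * δ ∈ heckeDoubleCoset N q := by
  obtain ⟨γ₁, h1, γ₂, h2, rfl⟩ := h
  exact ⟨γ₁, h1, γ₂ * δ, paramodularGroup_mul_mem hN h2 hδ, by simp only [Matrix.mul_assoc]⟩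

/-- The multiplier of `γ = h g⁻¹` is `μ / μ = 1`, so symplecticity is automatic and only the shape
of `γ` has to be known. -/
theorem mem_paramodularGroup_of_mul_eq {N : ℕ} {μ : ℚ} {γ g h : Mat4} (hγ : IsPattern N γ)
    (hg : IsSimilitude μ g) (hh : IsSimilitude μ h) (e : γ * g = h) : γ ∈ paramodularGroup N := by
  refine ⟨?_, hγ⟩
  rw [SymplecticGroup.mem_iff']
  have hu : g * (μ⁻¹ • sympAdj g) = 1 := by
    rw [Matrix.mul_smul, hg.mul_sympAdj, smul_smul, inv_mul_cancel₀ hg.pos.ne', one_smul]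
  have h1 : gᵀ * (γᵀ * J (Fin 2) ℚ * γ) * g = gᵀ * J (Fin 2) ℚ * g := by
    calc gᵀ * (γᵀ * J (Fin 2) ℚ * γ) * g = (γ * g)ᵀ * J (Fin 2) ℚ * (γ * g) := by
          simp only [Matrix.transpose_mul, Matrix.mul_assoc]
      _ = _ := by rw [e, hh.form, hg.form]
  have h2 := congrArg (fun M => (μ⁻¹ • sympAdj g)ᵀ * M * (μ⁻¹ • sympAdj g)) h1
  have h3 : ∀ M : Mat4, (μ⁻¹ • sympAdj g)ᵀ * (gᵀ * M * g) * (μ⁻¹ • sympAdj g) = M := by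
    intro M
    calc _ = (g * (μ⁻¹ • sympAdj g))ᵀ * M * (g * (μ⁻¹ • sympAdj g)) := by
          simp only [Matrix.transpose_mul, Matrix.mul_assoc]
      _ = M := by rw [hu]; simp
  simpa only [h3] using h2

/-! ### Equivalence of Hecke cosets and independence of representatives -/

/-- Left equivalence under the paramodular group. -/
def heckeRel (N q : ℕ) (g h : heckeDoubleCoset N q) : Prop :=
  ∃ γ ∈ paramodularGroup N, γ * g.1 = h.1

theorem heckeRel_equivalence {N : ℕ} (hN : 0 < N) (q : ℕ) : Equivalence (heckeRel N q) where
  refl g := ⟨1, one_mem_paramodularGroup hN, Matrix.one_mul _⟩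
  symm := by
    rintro g h ⟨γ, hγ, e⟩
    refine ⟨sympAdj γ, sympAdj_mem hγ, ?_⟩
    rw [← e, ← Matrix.mul_assoc, sympAdj_mul_self hγ, Matrix.one_mul]
  trans := by
    rintro g h l ⟨γ, hγ, e⟩ ⟨δ, hδ, e'⟩
    exact ⟨δ * γ, paramodularGroup_mul_mem hN hδ hγ, by rw [Matrix.mul_assoc, e, e']⟩

/-- The coset of an element of the double coset. -/
def heckeMk (N q : ℕ) (g : heckeDoubleCoset N q) : HeckeCosets N q := Quot.mk _ g

theorem heckeMk_eq_iff {N : ℕ} (hN : 0 < N) {q : ℕ} {g h : heckeDoubleCoset N q} :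
    heckeMk N q g = heckeMk N q h ↔ heckeRel N q g h := by
  constructor
  · intro e
    exact (heckeRel_equivalence hN q).eqvGen_iff.1 (Quot.eqvGen_exact e)
  · intro e
    exact Quot.sound e

theorem heckeMk_out {N q : ℕ} (c : HeckeCosets N q) :
    heckeMk N q (Quot.out c) = c := Quot.out_eq c

/-- As `g⁻¹ = q⁻¹ • sympAdj g`, equivalence of `g` and `h` amounts to divisibility by `q` of `h *
sympAdj g`. With the converse below, sorting cosets becomes a computation modulo `q`. -/
theorem heckeRel_of_smul {N q : ℕ} (hq : 0 < q) {g h : heckeDoubleCoset N q} {M : Mat4}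
    (hM : IsPattern N M) (e : h.1 * sympAdj g.1 = (q : ℚ) • M) : heckeRel N q g h := by
  have hg := IsSimilitude.of_mem_heckeDoubleCoset hq g.2
  have hh := IsSimilitude.of_mem_heckeDoubleCoset hq h.2
  have hq' : (q : ℚ) ≠ 0 := by exact_mod_cast hq.ne'
  have e' : M * g.1 = h.1 := by
    have h1 : (q : ℚ) • (M * g.1) = (q : ℚ) • h.1 := by
      rw [← Matrix.smul_mul, ← e, Matrix.mul_assoc, hg.sympAdj_mul, Matrix.mul_smul,
        Matrix.mul_one]
    exact smul_right_injective _ hq' h1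
  exact ⟨M, mem_paramodularGroup_of_mul_eq hM hg hh e', e'⟩

theorem exists_smul_of_heckeRel {N q : ℕ} (hq : 0 < q) {g h : heckeDoubleCoset N q}
    (e : heckeRel N q g h) : ∃ M, IsPattern N M ∧ h.1 * sympAdj g.1 = (q : ℚ) • M := by
  have hg := IsSimilitude.of_mem_heckeDoubleCoset hq g.2
  obtain ⟨γ, hγ, e⟩ := e
  exact ⟨γ, hγ.2, by rw [← e, Matrix.mul_assoc, hg.mul_sympAdj, Matrix.mul_smul, Matrix.mul_one]⟩

theorem slash_eq_of_heckeRel {N q k : ℕ} (hq : 0 < q) {f : siegelSet → ℂ}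
    (hf : ∀ γ ∈ paramodularGroup N, slash k γ f = f) {g h : heckeDoubleCoset N q}
    (e : heckeRel N q g h) : slash k g.1 f = slash k h.1 f := by
  obtain ⟨γ, hγ, e⟩ := e
  rw [← e, slash_mul (.of_mem hγ.1) (.of_mem_heckeDoubleCoset hq g.2), hf γ hγ]

/-- `heckeT` evaluates at the arbitrary representatives `Quot.out`. Invariance of `f` allows any
explicit system instead. -/
theorem heckeT_eq_sum {N q k : ℕ} (hN : 0 < N) (hq : 0 < q) {f : siegelSet → ℂ}
    (hf : ∀ γ ∈ paramodularGroup N, slash k γ f = f) {ι : Type*} [Fintype ι]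
    (rep : ι → heckeDoubleCoset N q)
    (hrep : Function.Bijective fun i => heckeMk N q (rep i)) (Ω : siegelSet) :
    heckeT k N q f Ω = ∑ i, slash k (rep i).1 f Ω := by
  rw [heckeT, ← finsum_eq_sum_of_fintype]
  refine (finsum_eq_of_bijective _ hrep fun i => ?_).symm
  have h : heckeRel N q (rep i) (Quot.out (heckeMk N q (rep i))) :=
    (heckeMk_eq_iff hN).1 (heckeMk_out _).symm
  exact congrFun (slash_eq_of_heckeRel hq hf h) Ω

/-- Right translation of Hecke cosets by an element of the paramodular group. -/
def heckeTranslate {N : ℕ} (hN : 0 < N) (q : ℕ) {δ : Mat4} (hδ : δ ∈ paramodularGroup N) :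
    HeckeCosets N q → HeckeCosets N q :=
  Quot.map (fun g => ⟨g.1 * δ, mul_mem_heckeDoubleCoset hN g.2 hδ⟩) (by
    rintro g h ⟨γ, hγ, e⟩
    exact ⟨γ, hγ, by simp only [← e, Matrix.mul_assoc]⟩)

theorem heckeTranslate_bijective {N : ℕ} (hN : 0 < N) (q : ℕ) {δ : Mat4}
    (hδ : δ ∈ paramodularGroup N) : Function.Bijective (heckeTranslate hN q hδ) := by
  refine Function.bijective_iff_has_inverse.2
    ⟨heckeTranslate hN q (sympAdj_mem hδ), fun c => ?_, fun c => ?_⟩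
  · induction c using Quot.ind with | _ g => ?_
    refine congrArg (Quot.mk _) (Subtype.ext ?_)
    change g.1 * δ * sympAdj δ = g.1
    rw [Matrix.mul_assoc, mul_sympAdj_self hδ, Matrix.mul_one]
  · induction c using Quot.ind with | _ g => ?_
    refine congrArg (Quot.mk _) (Subtype.ext ?_)
    change g.1 * sympAdj δ * δ = g.1
    rw [Matrix.mul_assoc, sympAdj_mul_self hδ, Matrix.mul_one]

/-- Right multiplication by `δ` permutes the cosets, hence only reorders the sum. No explicit
representatives enter. -/
theorem heckeT_invariant {N q k : ℕ} (hN : 0 < N) (hq : 0 < q) {f : siegelSet → ℂ}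
    (hf : ∀ γ ∈ paramodularGroup N, slash k γ f = f) {δ : Mat4} (hδ : δ ∈ paramodularGroup N) :
    slash k δ (heckeT k N q f) = heckeT k N q f := by
  funext Ω
  have hδ' := IsSimilitude.of_mem_paramodularGroup hδ
  rw [hδ'.slash_apply, heckeT, heckeT, ← smul_eq_mul, smul_finsum]
  refine finsum_eq_of_bijective _ (heckeTranslate_bijective hN q hδ) fun c => ?_
  rw [smul_eq_mul, ← hδ'.slash_apply k (slash k (Quot.out c).1 f),
    ← slash_mul (.of_mem_heckeDoubleCoset hq (Quot.out c).2) hδ']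
  have h : heckeRel N q ⟨(Quot.out c).1 * δ, mul_mem_heckeDoubleCoset hN (Quot.out c).2 hδ⟩
      (Quot.out (heckeTranslate hN q hδ c)) := by
    refine (heckeMk_eq_iff hN).1 ?_
    rw [heckeMk_out]
    conv_rhs => rw [← Quot.out_eq c]
    rfl
  exact congrFun (slash_eq_of_heckeRel hq hf h) Ω

end

section

open Matrix

/-! ### Explicit representatives of the Hecke cosets -/

/-- Four families of upper triangular representatives, with elementary divisors
`(1, 1)`, `(1, q)`, `(q, 1)`, `(q, q)` in the upper left block. -/
abbrev HeckeIndex (q : ℕ) : Type :=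
  (Fin q × Fin q × Fin q) ⊕ Fin q ⊕ (Fin q × Fin q) ⊕ Unit

/-- The representative `(1, B; 0, q)`. -/
def repA (q : ℕ) (b₀ b₁ b₂ : ℚ) : Mat4 :=
  fromBlocks 1 !![b₀, b₁; b₁, b₂] 0 ((q : ℚ) • 1)

/-- The representative with blocks `diag(1, q)`, `diag(b, 0)`, `diag(q, 1)`. -/
def repB (q : ℕ) (b : ℚ) : Mat4 :=
  fromBlocks !![1, 0; 0, (q : ℚ)] !![b, 0; 0, 0] 0 !![(q : ℚ), 0; 0, 1]

/-- The representative with blocks `(q, 0; -Nj, 1)`, `diag(0, b)`, `(1, Nj; 0, q)`. -/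
def repC (N q : ℕ) (j b : ℚ) : Mat4 :=
  fromBlocks !![(q : ℚ), 0; -(N * j), 1] !![0, 0; 0, b] 0 !![1, N * j; 0, (q : ℚ)]

/-- The representative `diag(q, q, 1, 1)`. -/
def repD (q : ℕ) : Mat4 := fromBlocks ((q : ℚ) • 1) 0 0 1

theorem mem_paramodularGroup_of {N : ℕ} {A B C D : Matrix (Fin 2) (Fin 2) ℚ}
    (hAC : Aᵀ * C = Cᵀ * A) (hBD : Bᵀ * D = Dᵀ * B) (hAD : Aᵀ * D - Cᵀ * B = 1)
    (m : Matrix (Fin 2 ⊕ Fin 2) (Fin 2 ⊕ Fin 2) ℤ)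
    (h : ∀ i j, fromBlocks A B C D i j = paramodularPattern N i j * m i j) :
    fromBlocks A B C D ∈ paramodularGroup N :=
  ⟨SymplecticGroup.fromBlocks_mem_iff.2 ⟨hAC, hBD, hAD⟩, fun i j => ⟨m i j, h i j⟩⟩

theorem translation_mem {N : ℕ} (hN : 0 < N) (b₀ b₁ b₂ : ℤ) :
    fromBlocks 1 !![(b₀ : ℚ), (b₁ : ℚ); (b₁ : ℚ), (b₂ : ℚ)] 0 1 ∈ paramodularGroup N := by
  have hN' : (N : ℚ) ≠ 0 := by exact_mod_cast hN.ne'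
  refine mem_paramodularGroup_of (by simp) ?_ (by simp)
    (fromBlocks 1 !![N * b₀, b₁; b₁, b₂] 0 1) ?_
  · ext i j
    fin_cases i <;> fin_cases j <;> simp
  · rintro (i | i) (j | j) <;> fin_cases i <;> fin_cases j <;> simp [paramodularPattern]
    field_simp

/-- This and the next two elements are Weyl reflections in the second, the first and both
coordinates. Conjugating `diag(1, 1, q, q)` by them gives the diagonal parts of `repB`, `repC` and
`repD`, up to further right factors in the group. In the first coordinate the reflection needs the
entries `1/N` and `-N`. -/
theorem swap_one_mem {N : ℕ} :
    fromBlocks !![1, 0; 0, 0] !![0, 0; 0, 1] !![0, 0; 0, -1] !![1, 0; 0, 0] ∈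
      paramodularGroup N := by
  refine mem_paramodularGroup_of ?_ ?_ ?_
    (fromBlocks !![1, 0; 0, 0] !![0, 0; 0, 1] !![0, 0; 0, -1] !![1, 0; 0, 0]) ?_
  · ext i j
    fin_cases i <;> fin_cases j <;> simp [Matrix.mul_apply]
  · ext i j
    fin_cases i <;> fin_cases j <;> simp [Matrix.mul_apply]
  · ext i j
    fin_cases i <;> fin_cases j <;> simp [Matrix.mul_apply]
  · rintro (i | i) (j | j) <;> fin_cases i <;> fin_cases j <;> simp [paramodularPattern]

theorem swap_zero_mem {N : ℕ} (hN : 0 < N) :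
    fromBlocks !![0, 0; 0, 1] !![1 / (N : ℚ), 0; 0, 0] !![-(N : ℚ), 0; 0, 0] !![0, 0; 0, 1] ∈
      paramodularGroup N := by
  have hN' : (N : ℚ) ≠ 0 := by exact_mod_cast hN.ne'
  refine mem_paramodularGroup_of ?_ ?_ ?_
    (fromBlocks !![0, 0; 0, 1] !![1, 0; 0, 0] !![-1, 0; 0, 0] !![0, 0; 0, 1]) ?_
  · ext i j
    fin_cases i <;> fin_cases j <;> simp [Matrix.mul_apply]
  · ext i j
    fin_cases i <;> fin_cases j <;> simp [Matrix.mul_apply]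
  · ext i j
    fin_cases i <;> fin_cases j <;> simp [Matrix.mul_apply, hN']
  · rintro (i | i) (j | j) <;> fin_cases i <;> fin_cases j <;> simp [paramodularPattern]

theorem swap_both_mem {N : ℕ} (hN : 0 < N) :
    fromBlocks 0 !![1 / (N : ℚ), 0; 0, 1] !![-(N : ℚ), 0; 0, -1] 0 ∈ paramodularGroup N := by
  have hN' : (N : ℚ) ≠ 0 := by exact_mod_cast hN.ne'
  refine mem_paramodularGroup_of (by simp) (by simp) ?_
    (fromBlocks 0 1 (-1) 0) ?_
  · ext i j
    fin_cases i <;> fin_cases j <;> simp [Matrix.mul_apply, hN']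
  · rintro (i | i) (j | j) <;> fin_cases i <;> fin_cases j <;> simp [paramodularPattern]

theorem levi_mem {N : ℕ} (j : ℤ) :
    fromBlocks !![1, 0; -(N * (j : ℚ)), 1] 0 0 !![1, N * (j : ℚ); 0, 1] ∈ paramodularGroup N := by
  refine mem_paramodularGroup_of (by simp) (by simp) ?_
    (fromBlocks !![1, 0; -j, 1] 0 0 !![1, j; 0, 1]) ?_
  · ext i j
    fin_cases i <;> fin_cases j <;> simp [Matrix.mul_apply]
  · rintro (i | i) (j | j) <;> fin_cases i <;> fin_cases j <;> simp [paramodularPattern]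

theorem repA_mem {N : ℕ} (hN : 0 < N) (q : ℕ) (b₀ b₁ b₂ : ℤ) :
    repA q b₀ b₁ b₂ ∈ heckeDoubleCoset N q := by
  refine ⟨1, one_mem_paramodularGroup hN, _, translation_mem hN b₀ b₁ b₂, ?_⟩
  rw [repA, Matrix.one_mul, fromBlocks_multiply]
  simp

theorem repB_mem {N : ℕ} (hN : 0 < N) (q : ℕ) (b : ℤ) :
    repB q b ∈ heckeDoubleCoset N q := by
  refine ⟨_, sympAdj_mem (swap_one_mem), _,
    paramodularGroup_mul_mem hN (swap_one_mem) (translation_mem hN b 0 0), ?_⟩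
  rw [repB, sympAdj]
  simp only [toBlocks_fromBlocks₁₁, toBlocks_fromBlocks₁₂, toBlocks_fromBlocks₂₁,
    toBlocks_fromBlocks₂₂, fromBlocks_multiply]
  congr 1 <;> (ext i j; fin_cases i <;> fin_cases j <;>
    simp [Matrix.mul_apply, Fin.sum_univ_two])

theorem repC_mem {N : ℕ} (hN : 0 < N) (q : ℕ) (j b : ℤ) :
    repC N q j b ∈ heckeDoubleCoset N q := by
  have hN' : (N : ℚ) ≠ 0 := by exact_mod_cast hN.ne'
  refine ⟨_, sympAdj_mem (swap_zero_mem hN), _,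
    paramodularGroup_mul_mem hN (swap_zero_mem hN)
      (paramodularGroup_mul_mem hN (translation_mem hN 0 0 b) (levi_mem j)), ?_⟩
  rw [repC, sympAdj]
  simp only [toBlocks_fromBlocks₁₁, toBlocks_fromBlocks₁₂, toBlocks_fromBlocks₂₁,
    toBlocks_fromBlocks₂₂, fromBlocks_multiply]
  congr 1 <;> (ext i j; fin_cases i <;> fin_cases j <;>
    simp [Matrix.mul_apply, Fin.sum_univ_two, hN'])

theorem repD_mem {N : ℕ} (hN : 0 < N) (q : ℕ) : repD q ∈ heckeDoubleCoset N q := by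
  have hN' : (N : ℚ) ≠ 0 := by exact_mod_cast hN.ne'
  refine ⟨_, sympAdj_mem (swap_both_mem hN), _, swap_both_mem hN, ?_⟩
  rw [repD, sympAdj]
  simp only [toBlocks_fromBlocks₁₁, toBlocks_fromBlocks₁₂, toBlocks_fromBlocks₂₁,
    toBlocks_fromBlocks₂₂, fromBlocks_multiply]
  congr 1 <;> (ext i j; fin_cases i <;> fin_cases j <;>
    simp [Matrix.mul_apply, Fin.sum_univ_two, hN'])

/-! ### Inequivalence and completeness of the representatives, by reduction modulo `q` -/

/-- The representatives of the Hecke cosets. -/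
def heckeRep {N : ℕ} (hN : 0 < N) (q : ℕ) : HeckeIndex q → heckeDoubleCoset N q
  | .inl (b₀, b₁, b₂) => ⟨repA q (b₀ : ℕ) (b₁ : ℕ) (b₂ : ℕ), by
      simpa using repA_mem hN q (b₀ : ℕ) (b₁ : ℕ) (b₂ : ℕ)⟩
  | .inr (.inl b) => ⟨repB q (b : ℕ), by simpa using repB_mem hN q (b : ℕ)⟩
  | .inr (.inr (.inl (j, b))) => ⟨repC N q (j : ℕ) (b : ℕ), by
      simpa using repC_mem hN q (j : ℕ) (b : ℕ)⟩
  | .inr (.inr (.inr _)) => ⟨repD q, repD_mem hN q⟩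

/-- Multiplying by `N` clears denominators at the cost of powers of `N`, which are prime to `q`. So
divisibility by `q` inside the pattern can be tested on the integers `N * M i j`. -/
theorem natCast_mul_paramodularPattern {N : ℕ} (hN : 0 < N) (i j : Fin 2 ⊕ Fin 2) :
    ∃ e : ℕ, (N : ℚ) * paramodularPattern N i j = (N : ℚ) ^ e := by
  have hN' : (N : ℚ) ≠ 0 := by exact_mod_cast hN.ne'
  have h : ∃ e ∈ ({0, 1, 2} : Finset ℕ), (N : ℚ) * paramodularPattern N i j = (N : ℚ) ^ e := by
    simp only [Finset.mem_insert, Finset.mem_singleton, exists_eq_or_imp, exists_eq_left]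
    rcases i with i | i <;> rcases j with j | j <;> fin_cases i <;> fin_cases j <;>
      simp [paramodularPattern, hN', pow_two]
  obtain ⟨e, -, h⟩ := h
  exact ⟨e, h⟩

theorem IsPattern.exists_int {N : ℕ} (hN : 0 < N) {M : Mat4} (h : IsPattern N M)
    (i j : Fin 2 ⊕ Fin 2) : ∃ t : ℤ, (N : ℚ) * M i j = t := by
  obtain ⟨m, hm⟩ := h i j
  obtain ⟨e, he⟩ := natCast_mul_paramodularPattern hN i j
  exact ⟨N ^ e * m, by rw [hm, ← mul_assoc, he]; push_cast; ring⟩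

theorem IsPattern.exists_smul {N q : ℕ} (hN : 0 < N) (hq : q.Prime) (hqN : ¬ q ∣ N) {M : Mat4}
    (h : IsPattern N M) (hM : ∀ i j, ∃ t : ℤ, (N : ℚ) * M i j = q * t) :
    ∃ M', IsPattern N M' ∧ M = (q : ℚ) • M' := by
  have hq' : (q : ℚ) ≠ 0 := by exact_mod_cast hq.ne_zero
  refine ⟨(q : ℚ)⁻¹ • M, fun i j => ?_, ?_⟩
  · obtain ⟨m, hm⟩ := h i j
    obtain ⟨t, ht⟩ := hM i j
    obtain ⟨e, he⟩ := natCast_mul_paramodularPattern hN i j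
    have h1 : (N : ℤ) ^ e * m = q * t := by
      rw [hm, ← mul_assoc, he] at ht
      exact_mod_cast ht
    have hcop : IsCoprime (q : ℤ) ((N : ℤ) ^ e) :=
      (Nat.isCoprime_iff_coprime.2 ((Nat.Prime.coprime_iff_not_dvd hq).2 hqN)).pow_right
    obtain ⟨s, hs⟩ := hcop.dvd_of_dvd_mul_left (Dvd.intro t h1.symm)
    refine ⟨s, ?_⟩
    rw [Matrix.smul_apply, hm, hs, smul_eq_mul]
    push_cast
    field_simp
  · rw [smul_smul, mul_inv_cancel₀ hq', one_smul]

theorem dvd_of_heckeRel {N q : ℕ} (hN : 0 < N) (hq : q.Prime) {g h : heckeDoubleCoset N q}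
    (e : heckeRel N q g h) (i j : Fin 2 ⊕ Fin 2) (x : ℤ)
    (hx : (h.1 * sympAdj g.1) i j = x) : (q : ℤ) ∣ N * x := by
  obtain ⟨M, hM, e⟩ := exists_smul_of_heckeRel hq.pos e
  obtain ⟨t, ht⟩ := hM.exists_int hN i j
  refine ⟨t, ?_⟩
  rw [e, Matrix.smul_apply, smul_eq_mul] at hx
  have : (N : ℚ) * x = q * t := by rw [← ht, ← hx]; ring
  exact_mod_cast this

theorem dvd_of_dvd_natCast_mul {N q : ℕ} (hq : q.Prime) (hqN : ¬ q ∣ N) {x : ℤ}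
    (h : (q : ℤ) ∣ N * x) : (q : ℤ) ∣ x :=
  (Nat.isCoprime_iff_coprime.2 ((Nat.Prime.coprime_iff_not_dvd hq).2 hqN)).dvd_of_dvd_mul_left h

theorem fin_eq_of_dvd {q : ℕ} {a b : Fin q} (h : (q : ℤ) ∣ (a : ℕ) - (b : ℕ)) : a = b := by
  have h1 := a.2
  have h2 := b.2
  have h3 : (a : ℤ) - b = 0 := Int.eq_zero_of_abs_lt_dvd h (by rw [abs_lt]; omega)
  exact Fin.ext (by omega)

/-- For equivalent representatives every integral entry of `h * sympAdj g` is divisible by `q`. For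
two different families, in a suitable order, a diagonal entry equals `1`. Within one family some
entries are differences of parameters, with an extra factor `N` for the parameter `j` of `repC`. -/
theorem heckeRep_injective {N q : ℕ} (hN : 0 < N) (hq : q.Prime) (hqN : ¬ q ∣ N)
    {i i' : HeckeIndex q} (e : heckeRel N q (heckeRep hN q i) (heckeRep hN q i')) : i = i' := by
  have hsymm : ∀ {g h : heckeDoubleCoset N q}, heckeRel N q g h → heckeRel N q h g :=
    (heckeRel_equivalence hN q).symm
  have key : ∀ {g h : heckeDoubleCoset N q}, heckeRel N q g h → ∀ (s t : Fin 2 ⊕ Fin 2) (x : ℤ),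
      (h.1 * sympAdj g.1) s t = x → (q : ℤ) ∣ x := fun e s t x hx =>
    dvd_of_dvd_natCast_mul hq hqN (dvd_of_heckeRel hN hq e s t x hx)
  have hone : ¬ (q : ℤ) ∣ 1 := by
    intro h
    exact hq.one_lt.ne' (Nat.dvd_one.1 (by exact_mod_cast h))
  rcases i with ⟨a₀, a₁, a₂⟩ | a | ⟨l, a⟩ | u <;> rcases i' with ⟨b₀, b₁, b₂⟩ | b | ⟨j, b⟩ | u'
  · have h0 := key e (.inl 0) (.inr 0) ((b₀ : ℕ) - (a₀ : ℕ)) (by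
      simp [heckeRep, repA, sympAdj, fromBlocks_multiply]; ring)
    have h1 := key e (.inl 0) (.inr 1) ((b₁ : ℕ) - (a₁ : ℕ)) (by
      simp [heckeRep, repA, sympAdj, fromBlocks_multiply]; ring)
    have h2 := key e (.inl 1) (.inr 1) ((b₂ : ℕ) - (a₂ : ℕ)) (by
      simp [heckeRep, repA, sympAdj, fromBlocks_multiply]; ring)
    rw [fin_eq_of_dvd h0, fin_eq_of_dvd h1, fin_eq_of_dvd h2]
  · exact absurd (key (hsymm e) (.inl 1) (.inl 1) 1 (by
      simp [heckeRep, repA, repB, sympAdj, fromBlocks_multiply])) hone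
  · exact absurd (key (hsymm e) (.inl 0) (.inl 0) 1 (by
      simp [heckeRep, repA, repC, sympAdj, fromBlocks_multiply])) hone
  · exact absurd (key (hsymm e) (.inl 0) (.inl 0) 1 (by
      simp [heckeRep, repA, repD, sympAdj, fromBlocks_multiply])) hone
  · exact absurd (key e (.inl 1) (.inl 1) 1 (by
      simp [heckeRep, repA, repB, sympAdj, fromBlocks_multiply])) hone
  · have h0 := key e (.inl 0) (.inr 0) ((b : ℕ) - (a : ℕ)) (by
      simp [heckeRep, repB, sympAdj, fromBlocks_multiply, Matrix.vecMul, dotProduct]; ring)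
    rw [fin_eq_of_dvd h0]
  · exact absurd (key (hsymm e) (.inl 0) (.inl 0) 1 (by
      simp [heckeRep, repB, repC, sympAdj, fromBlocks_multiply, Matrix.vecMul, dotProduct])) hone
  · exact absurd (key (hsymm e) (.inl 0) (.inl 0) 1 (by
      simp [heckeRep, repB, repD, sympAdj, fromBlocks_multiply])) hone
  · exact absurd (key e (.inl 0) (.inl 0) 1 (by
      simp [heckeRep, repA, repC, sympAdj, fromBlocks_multiply])) hone
  · exact absurd (key e (.inl 0) (.inl 0) 1 (by
      simp [heckeRep, repB, repC, sympAdj, fromBlocks_multiply, Matrix.vecMul, dotProduct])) hone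
  · have h0 := key e (.inl 1) (.inl 0) (N * ((l : ℕ) - (j : ℕ))) (by
      simp [heckeRep, repC, sympAdj, fromBlocks_multiply, Matrix.vecMul, dotProduct]; ring)
    have h1 := key e (.inl 1) (.inr 1) ((b : ℕ) - (a : ℕ)) (by
      simp [heckeRep, repC, sympAdj, fromBlocks_multiply, Matrix.vecMul, dotProduct]; ring)
    rw [fin_eq_of_dvd h1, fin_eq_of_dvd (dvd_of_dvd_natCast_mul hq hqN h0)]
  · exact absurd (key (hsymm e) (.inl 1) (.inl 1) 1 (by
      simp [heckeRep, repC, repD, sympAdj, fromBlocks_multiply])) hone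
  · exact absurd (key e (.inl 0) (.inl 0) 1 (by
      simp [heckeRep, repA, repD, sympAdj, fromBlocks_multiply])) hone
  · exact absurd (key e (.inl 0) (.inl 0) 1 (by
      simp [heckeRep, repB, repD, sympAdj, fromBlocks_multiply])) hone
  · exact absurd (key e (.inl 1) (.inl 1) 1 (by
      simp [heckeRep, repC, repD, sympAdj, fromBlocks_multiply])) hone
  · rfl

/-- A family of pairwise orthogonal vectors `(x₀, x₁, y₀, y₁)` of a symplectic space of dimension
four lies in one of the standard Lagrangian subspaces. -/
theorem exists_lagrangian {F ι : Type*} [Field F] (x₀ x₁ y₀ y₁ : ι → F)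
    (h : ∀ i j, x₀ i * y₀ j - y₀ i * x₀ j + (x₁ i * y₁ j - y₁ i * x₁ j) = 0) :
    (∃ b₀ b₁ b₂, ∀ i, x₀ i + b₀ * y₀ i + b₁ * y₁ i = 0 ∧ x₁ i + b₁ * y₀ i + b₂ * y₁ i = 0) ∨
    (∃ b, ∀ i, x₀ i + b * y₀ i = 0 ∧ y₁ i = 0) ∨
    (∃ c b, ∀ i, y₀ i + c * y₁ i = 0 ∧ x₁ i - c * x₀ i + b * y₁ i = 0) ∨
    (∀ i, y₀ i = 0 ∧ y₁ i = 0) := by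
  -- The cases follow the span of the vectors `(y₀, y₁)`: the whole plane, a line with `y₁ ≠ 0`, the
  -- line `y₁ = 0`, or zero.
  by_cases hind : ∃ i j, y₀ i * y₁ j - y₁ i * y₀ j ≠ 0
  · left
    obtain ⟨i, j, hd⟩ := hind
    set d := y₀ i * y₁ j - y₁ i * y₀ j with hd_def
    have hij := h i j
    -- Cramer's rule expresses `(x₀, x₁)` through `(y₀, y₁)`. Orthogonality of the vectors `i` and
    -- `j` says that the resulting matrix is symmetric, so one `b₁` serves both rows.
    refine ⟨-(x₀ i * y₁ j - y₁ i * x₀ j) / d, -(y₀ i * x₀ j - x₀ i * y₀ j) / d,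
      -(y₀ i * x₁ j - x₁ i * y₀ j) / d, fun l => ?_⟩
    have hi := h l i
    have hj := h l j
    constructor
    · field_simp
      rw [hd_def]
      linear_combination y₁ j * hi - y₁ i * hj + y₁ l * hij
    · field_simp
      rw [hd_def]
      linear_combination -y₀ j * hi + y₀ i * hj
  · right
    push Not at hind
    by_cases h1 : ∃ j, y₁ j ≠ 0
    · right; left
      obtain ⟨j, hj⟩ := h1
      refine ⟨-y₀ j / y₁ j, -(x₁ j + y₀ j / y₁ j * x₀ j) / y₁ j, fun l => ?_⟩
      have h2 := hind l j
      have h3 := h l j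
      constructor
      · field_simp
        linear_combination h2
      · field_simp
        linear_combination y₁ j * h3 + x₀ j * h2
    · push Not at h1
      by_cases h0 : ∃ j, y₀ j ≠ 0
      · left
        obtain ⟨j, hj⟩ := h0
        refine ⟨-x₀ j / y₀ j, fun l => ⟨?_, h1 l⟩⟩
        have h3 := h l j
        rw [h1 l, h1 j] at h3
        field_simp
        linear_combination h3
      · push Not at h0
        right; right
        exact fun i => ⟨h0 i, h1 i⟩

theorem IsSimilitude.form_sympAdj {μ : ℚ} {γ : Mat4} (h : IsSimilitude μ γ) :
    (sympAdj γ)ᵀ * J (Fin 2) ℚ * sympAdj γ = μ • J (Fin 2) ℚ := by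
  have h1 : J (Fin 2) ℚ * sympAdj γ = γᵀ * J (Fin 2) ℚ := by
    rw [sympAdj_eq, ← Matrix.mul_assoc, ← Matrix.mul_assoc, Matrix.mul_neg, J_squared, neg_neg,
      Matrix.one_mul]
  rw [Matrix.mul_assoc, h1, ← Matrix.mul_assoc, ← Matrix.transpose_mul, h.mul_sympAdj]
  simp

/-- Since `sympAdj g` has multiplier `q`, the columns of `N • sympAdj g` are pairwise orthogonal
modulo `q`. They therefore satisfy the equations of one of the four standard types of Lagrangian,
and these equations say that the matching representative times `sympAdj g` vanishes modulo `q`. -/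
theorem heckeRep_surjective {N q : ℕ} (hN : 0 < N) (hq : q.Prime) (hqN : ¬ q ∣ N)
    (g : heckeDoubleCoset N q) : ∃ i, heckeRel N q g (heckeRep hN q i) := by
  have : Fact q.Prime := ⟨hq⟩
  have hg := IsSimilitude.of_mem_heckeDoubleCoset hq.pos g.2
  have hH := (IsPattern.of_mem_heckeDoubleCoset hN g.2).sympAdj
  choose V hV using hH.exists_int hN
  suffices hs : ∃ i : HeckeIndex q, ∀ s t, ∃ x : ℤ,
      (N : ℚ) * ((heckeRep hN q i).1 * sympAdj g.1) s t = q * x by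
    obtain ⟨i, hi⟩ := hs
    obtain ⟨M, hM, e⟩ := IsPattern.exists_smul hN hq hqN
      ((IsPattern.of_mem_heckeDoubleCoset hN (heckeRep hN q i).2).mul hN hH) hi
    exact ⟨i, heckeRel_of_smul hq.pos hM e⟩
  have hiso : ∀ i j, ((V (.inl 0) i : ZMod q) * V (.inr 0) j - V (.inr 0) i * V (.inl 0) j +
      (V (.inl 1) i * V (.inr 1) j - V (.inr 1) i * V (.inl 1) j)) = 0 := by
    intro i j
    have h1 := congrFun (congrFun hg.form_sympAdj i) j
    have h2 : (V (.inl 0) i : ℚ) * V (.inr 0) j - V (.inr 0) i * V (.inl 0) j +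
      (V (.inl 1) i * V (.inr 1) j - V (.inr 1) i * V (.inl 1) j) =
        q * ((-(N : ℤ) ^ 2 * J (Fin 2) ℤ i j : ℤ) : ℚ) := by
      have h3 : ((J (Fin 2) ℤ i j : ℤ) : ℚ) = J (Fin 2) ℚ i j := by
        rcases i with i | i <;> rcases j with j | j <;> simp [J, Matrix.one_apply]
      push_cast
      rw [h3]
      simp only [← hV]
      simp only [Matrix.mul_apply, Matrix.transpose_apply, J, Fintype.sum_sum_type,
        Fin.sum_univ_two, fromBlocks_apply₁₁, fromBlocks_apply₁₂, fromBlocks_apply₂₁,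
        fromBlocks_apply₂₂, Matrix.zero_apply, Matrix.neg_apply, Matrix.one_apply,
        Matrix.smul_apply, smul_eq_mul] at h1
      simp only [mul_zero, zero_add, add_zero, Fin.isValue, if_true, mul_neg, mul_one,
        one_ne_zero, zero_ne_one, if_false, neg_zero] at h1
      simp only [J]
      linear_combination -(N : ℚ) ^ 2 * h1
    have h3 : V (.inl 0) i * V (.inr 0) j - V (.inr 0) i * V (.inl 0) j +
      (V (.inl 1) i * V (.inr 1) j - V (.inr 1) i * V (.inl 1) j) =
        q * (-(N : ℤ) ^ 2 * J (Fin 2) ℤ i j) := by exact_mod_cast h2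
    have h4 := congrArg (fun x : ℤ => (x : ZMod q)) h3
    push_cast at h4
    rw [h4]
    simp
  have hval : ∀ a : ZMod q, ∃ b : Fin q, (((b : ℕ) : ℤ) : ZMod q) = a := fun a =>
    ⟨⟨a.val, a.val_lt⟩, by simp⟩
  have hdvd : ∀ x : ℤ, (x : ZMod q) = 0 → ∃ t : ℤ, x = q * t := fun x hx =>
    (ZMod.intCast_zmod_eq_zero_iff_dvd x q).1 hx
  have hNz : (N : ZMod q) ≠ 0 := by
    rwa [Ne, ZMod.natCast_eq_zero_iff]
  rcases exists_lagrangian (fun i => (V (.inl 0) i : ZMod q)) (fun i => (V (.inl 1) i : ZMod q))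
    (fun i => (V (.inr 0) i : ZMod q)) (fun i => (V (.inr 1) i : ZMod q)) hiso with
    ⟨b₀, b₁, b₂, h⟩ | ⟨b, h⟩ | ⟨c, b, h⟩ | h
  · obtain ⟨b₀, rfl⟩ := hval b₀
    obtain ⟨b₁, rfl⟩ := hval b₁
    obtain ⟨b₂, rfl⟩ := hval b₂
    refine ⟨.inl (b₀, b₁, b₂), ?_⟩
    intro s t
    obtain ⟨t0, ht0⟩ := hdvd (V (.inl 0) t + (b₀ : ℕ) * V (.inr 0) t + (b₁ : ℕ) * V (.inr 1) t) (by
      have := (h t).1; push_cast at this ⊢; exact this)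
    obtain ⟨t1, ht1⟩ := hdvd (V (.inl 1) t + (b₁ : ℕ) * V (.inr 0) t + (b₂ : ℕ) * V (.inr 1) t) (by
      have := (h t).2; push_cast at this ⊢; exact this)
    have ht0' := congrArg (fun x : ℤ => (x : ℚ)) ht0
    have ht1' := congrArg (fun x : ℤ => (x : ℚ)) ht1
    push_cast [← hV] at ht0' ht1'
    rcases s with s | s <;> fin_cases s
    · refine ⟨t0, ?_⟩
      rw [← ht0']
      simp [heckeRep, repA, Matrix.mul_apply, Fin.sum_univ_two]; ring
    · refine ⟨t1, ?_⟩
      rw [← ht1']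
      simp [heckeRep, repA, Matrix.mul_apply, Fin.sum_univ_two]; ring
    · refine ⟨V (.inr 0) t, ?_⟩
      rw [← hV]
      simp [heckeRep, repA, Matrix.mul_apply, Fin.sum_univ_two]; ring
    · refine ⟨V (.inr 1) t, ?_⟩
      rw [← hV]
      simp [heckeRep, repA, Matrix.mul_apply, Fin.sum_univ_two]; ring
  · obtain ⟨b, rfl⟩ := hval b
    refine ⟨.inr (.inl b), ?_⟩
    intro s t
    obtain ⟨t0, ht0⟩ := hdvd (V (.inl 0) t + (b : ℕ) * V (.inr 0) t) (by
      have := (h t).1; push_cast at this ⊢; exact this)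
    obtain ⟨t1, ht1⟩ := hdvd (V (.inr 1) t) (h t).2
    have ht0' := congrArg (fun x : ℤ => (x : ℚ)) ht0
    have ht1' := congrArg (fun x : ℤ => (x : ℚ)) ht1
    push_cast [← hV] at ht0' ht1'
    rcases s with s | s <;> fin_cases s
    · refine ⟨t0, ?_⟩
      rw [← ht0']
      simp [heckeRep, repB, Matrix.mul_apply, Fin.sum_univ_two]; ring
    · refine ⟨V (.inl 1) t, ?_⟩
      rw [← hV]
      simp [heckeRep, repB, Matrix.mul_apply, Fin.sum_univ_two]; ring
    · refine ⟨V (.inr 0) t, ?_⟩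
      rw [← hV]
      simp [heckeRep, repB, Matrix.mul_apply, Fin.sum_univ_two]; ring
    · refine ⟨t1, ?_⟩
      rw [← ht1']
      simp [heckeRep, repB, Matrix.mul_apply, Fin.sum_univ_two]
  -- The slope in `repC` has the form `N j`, as the pattern demands. Division by `N` is possible
  -- because `q ∤ N`.
  · obtain ⟨j, hj⟩ := hval (c / N)
    obtain ⟨b, rfl⟩ := hval b
    have hc : c = N * (((j : ℕ) : ℤ) : ZMod q) := by rw [hj]; field_simp
    subst hc
    refine ⟨.inr (.inr (.inl (j, b))), ?_⟩
    intro s t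
    obtain ⟨t0, ht0⟩ := hdvd (V (.inr 0) t + N * (j : ℕ) * V (.inr 1) t) (by
      have := (h t).1; push_cast at this ⊢; exact this)
    obtain ⟨t1, ht1⟩ := hdvd (V (.inl 1) t - N * (j : ℕ) * V (.inl 0) t +
        (b : ℕ) * V (.inr 1) t) (by
      have := (h t).2; push_cast at this ⊢; exact this)
    have ht0' := congrArg (fun x : ℤ => (x : ℚ)) ht0
    have ht1' := congrArg (fun x : ℤ => (x : ℚ)) ht1
    push_cast [← hV] at ht0' ht1'
    rcases s with s | s <;> fin_cases s
    · refine ⟨V (.inl 0) t, ?_⟩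
      rw [← hV]
      simp [heckeRep, repC, Matrix.mul_apply, Fin.sum_univ_two]; ring
    · refine ⟨t1, ?_⟩
      rw [← ht1']
      simp [heckeRep, repC, Matrix.mul_apply, Fin.sum_univ_two]; ring
    · refine ⟨t0, ?_⟩
      rw [← ht0']
      simp [heckeRep, repC, Matrix.mul_apply, Fin.sum_univ_two]; ring
    · refine ⟨V (.inr 1) t, ?_⟩
      rw [← hV]
      simp [heckeRep, repC, Matrix.mul_apply, Fin.sum_univ_two]; ring
  · refine ⟨.inr (.inr (.inr ())), ?_⟩
    intro s t
    obtain ⟨t0, ht0⟩ := hdvd (V (.inr 0) t) (h t).1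
    obtain ⟨t1, ht1⟩ := hdvd (V (.inr 1) t) (h t).2
    have ht0' := congrArg (fun x : ℤ => (x : ℚ)) ht0
    have ht1' := congrArg (fun x : ℤ => (x : ℚ)) ht1
    push_cast [← hV] at ht0' ht1'
    rcases s with s | s <;> fin_cases s
    · refine ⟨V (.inl 0) t, ?_⟩
      rw [← hV]
      simp [heckeRep, repD, Matrix.mul_apply, Fin.sum_univ_two]; ring
    · refine ⟨V (.inl 1) t, ?_⟩
      rw [← hV]
      simp [heckeRep, repD, Matrix.mul_apply, Fin.sum_univ_two]; ring
    · refine ⟨t0, ?_⟩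
      rw [← ht0']
      simp [heckeRep, repD, Matrix.mul_apply, Fin.sum_univ_two]
    · refine ⟨t1, ?_⟩
      rw [← ht1']
      simp [heckeRep, repD, Matrix.mul_apply, Fin.sum_univ_two]

theorem heckeRep_bijective {N q : ℕ} (hN : 0 < N) (hq : q.Prime) (hqN : ¬ q ∣ N) :
    Function.Bijective fun i => heckeMk N q (heckeRep hN q i) := by
  constructor
  · intro i i' e
    exact heckeRep_injective hN hq hqN ((heckeMk_eq_iff hN).1 e)
  · intro c
    obtain ⟨i, hi⟩ := heckeRep_surjective hN hq hqN (Quot.out c)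
    refine ⟨i, ?_⟩
    rw [← heckeMk_out c]
    exact ((heckeMk_eq_iff hN).2 hi).symm

end

section

open Matrix

/-! ### Exponentials and Fourier terms -/

theorem e_zero : e 0 = 1 := by simp [e]

theorem e_add (z w : ℂ) : e (z + w) = e z * e w := by
  rw [e, e, e, ← Complex.exp_add]; ring_nf

theorem e_ne_zero (z : ℂ) : e z ≠ 0 := Complex.exp_ne_zero _

theorem e_sum {ι : Type*} (s : Finset ι) (z : ι → ℂ) : e (∑ i ∈ s, z i) = ∏ i ∈ s, e (z i) := by
  simp only [e, Finset.mul_sum, Complex.exp_sum]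

theorem e_nat_mul (n : ℕ) (z : ℂ) : e (n * z) = e z ^ n := by
  rw [e, e, ← Complex.exp_nat_mul]; ring_nf

theorem e_intCast (n : ℤ) : e n = 1 := by
  rw [e, Complex.exp_eq_one_iff]
  exact ⟨n, by ring⟩

theorem norm_e (z : ℂ) : ‖e z‖ = Real.exp (-(2 * Real.pi * z.im)) := by
  rw [e, Complex.norm_exp]
  simp

theorem e_eq_one_iff (z : ℂ) : e z = 1 ↔ ∃ n : ℤ, z = n := by
  rw [e, Complex.exp_eq_one_iff]
  have h : (2 * Real.pi * Complex.I : ℂ) ≠ 0 := Complex.two_pi_I_ne_zero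
  constructor
  · rintro ⟨n, hn⟩
    exact ⟨n, mul_left_cancel₀ h (by rw [hn]; ring)⟩
  · rintro ⟨n, rfl⟩
    exact ⟨n, by ring⟩

theorem sum_e_div {q : ℕ} (hq : 0 < q) (x : ℤ) :
    ∑ b : Fin q, e (x * ((b : ℕ) : ℂ) / q) = if (q : ℤ) ∣ x then (q : ℂ) else 0 := by
  have hq' : (q : ℂ) ≠ 0 := by exact_mod_cast hq.ne'
  split_ifs with h
  · obtain ⟨y, rfl⟩ := h
    have : ∀ b : Fin q, e (((q * y : ℤ) : ℂ) * ((b : ℕ) : ℂ) / q) = 1 := by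
      intro b
      rw [e_eq_one_iff]
      refine ⟨y * (b : ℕ), ?_⟩
      push_cast
      field_simp
    rw [Finset.sum_congr rfl fun b _ => this b]
    simp
  · set ζ := e ((x : ℂ) / q) with hζ
    have h1 : ζ ≠ 1 := by
      intro h1
      obtain ⟨n, hn⟩ := (e_eq_one_iff _).1 h1
      apply h
      refine ⟨n, ?_⟩
      have : (x : ℂ) = q * n := by rw [← hn]; field_simp
      exact_mod_cast this
    have h2 : ζ ^ q = 1 := by
      rw [hζ, ← e_nat_mul, show (q : ℂ) * (x / q) = ((x : ℤ) : ℂ) by field_simp, e_intCast]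
    have h3 : ∀ b : Fin q, e ((x : ℂ) * ((b : ℕ) : ℂ) / q) = ζ ^ (b : ℕ) := by
      intro b
      rw [hζ, ← e_nat_mul]
      congr 1; ring
    simp only [h3]
    rw [Fin.sum_univ_eq_sum_range (fun b => ζ ^ b) q, geom_sum_eq h1, h2]
    simp

theorem indexMatrix_posDef_iff {N : ℕ} (hN : 0 < N) {p : ℤ × ℤ × ℤ} :
    (indexMatrix N p).PosDef ↔ 0 < p.1 ∧ p.2.1 ^ 2 < 4 * N * p.1 * p.2.2 := by
  rw [posDef_fin_two_iff]
  have hN' : (0 : ℝ) < N := by exact_mod_cast hN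
  simp only [indexMatrix, Matrix.of_apply, Matrix.cons_val', Matrix.cons_val_zero,
    Matrix.cons_val_one, Matrix.cons_val_fin_one, true_and]
  refine and_congr ?_ ?_
  · rw [mul_pos_iff_of_pos_right hN']
    exact Int.cast_pos
  · rw [show ((p.2.1 : ℝ) / 2) ^ 2 < (p.1 : ℝ) * N * p.2.2 ↔
      (p.2.1 : ℝ) ^ 2 < 4 * N * p.1 * p.2.2 by constructor <;> intro h <;> nlinarith]
    constructor <;> intro h <;> exact_mod_cast h

theorem index_last_pos {N : ℕ} {m r n : ℤ} (hm : 0 < m) (h : r ^ 2 < 4 * N * m * n) :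
    0 < n := by
  by_contra hn
  push Not at hn
  have h2 : 4 * (N : ℤ) * m * n ≤ 0 :=
    mul_nonpos_of_nonneg_of_nonpos (by positivity) hn
  nlinarith [sq_nonneg r]

theorem index_first_pos {N : ℕ} {m r n : ℤ} (hn : 0 < n) (h : r ^ 2 < 4 * N * m * n) :
    0 < m := by
  by_contra hm
  push Not at hm
  have h2 : 4 * (N : ℤ) * m * n ≤ 0 := by
    have : (N : ℤ) * n * m ≤ 0 := mul_nonpos_of_nonneg_of_nonpos (by positivity) hm
    linarith [show 4 * (N : ℤ) * m * n = 4 * ((N : ℤ) * n * m) by ring]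
  nlinarith [sq_nonneg r]

theorem fourierTerm_eq {N : ℕ} (T : FourierIndex N) (Ω : siegelSet) :
    fourierTerm N T Ω = e (T.1.1 * N * Ω.1 0 0 + T.1.2.1 * Ω.1 0 1 + T.1.2.2 * Ω.1 1 1) := by
  have h := (mem_siegelSet_iff.1 Ω.2).1
  rw [fourierTerm]
  congr 1
  simp [indexMatrix, Matrix.trace_fin_two, Matrix.mul_apply, Fin.sum_univ_two, ← h]
  ring

theorem fourierTerm_ne_zero {N : ℕ} (T : FourierIndex N) (Ω : siegelSet) :
    fourierTerm N T Ω ≠ 0 := e_ne_zero _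

/-- If the sum of the values of `e(⟨T, ·⟩)` at the points `W i` is a multiple of one Fourier term
or zero, the sum of the values of `f` has an integral expansion. -/
theorem hasSum_sum_of_reindex {N : ℕ} {ι σ : Type*} [Fintype ι] {α β : σ → FourierIndex N}
    (hα : Function.Injective α) (hβ : Function.Injective β) {f : siegelSet → ℂ}
    {a : FourierIndex N → ℤ} (hf : HasIntegralFourierExpansion N f a) (W : ι → siegelSet)
    (Ω : siegelSet) (C : ℂ)
    (h₁ : ∀ s, ∑ i, fourierTerm N (α s) (W i) = C * fourierTerm N (β s) Ω)
    (h₀ : ∀ T, T ∉ Set.range α → ∑ i, fourierTerm N T (W i) = 0) :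
    HasSum (fun T => C * ((Function.extend β (a ∘ α) 0 T : ℤ) : ℂ) * fourierTerm N T Ω)
      (∑ i, f (W i)) := by
  -- Summing over the points first leaves only the indices in the range of `α`. Transport along `β`
  -- then extends the coefficients by zero.
  have h2 : HasSum (fun T => (a T : ℂ) * ∑ i, fourierTerm N T (W i)) (∑ i, f (W i)) := by
    simp only [Finset.mul_sum]
    exact hasSum_sum fun i _ => hf (W i)
  rw [← hα.hasSum_iff] at h2
  · rw [← hβ.hasSum_iff]
    · refine h2.congr_fun fun s => ?_
      simp only [Function.comp_apply, hβ.extend_apply, h₁]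
      ring
    · intro T hT
      rw [Function.extend_apply']
      · simp
      · rintro ⟨s, hs⟩
        exact hT ⟨s, hs⟩
  · intro T hT
    rw [h₀ T hT, mul_zero]

/-! ### The action of the representatives -/

theorem act_eq_of_numer_eq {γ : Mat4} {Ω M : Matrix (Fin 2) (Fin 2) ℂ}
    (hu : IsUnit (denom γ Ω).det) (h : numer γ Ω = M * denom γ Ω) : act γ Ω = M := by
  rw [act_eq, h, Matrix.mul_nonsing_inv_cancel_right _ _ hu]

section Representatives

variable {q : ℕ} (hq : 0 < q) (Ω : siegelSet)

theorem det_denom_repA (b₀ b₁ b₂ : ℚ) : (denom (repA q b₀ b₁ b₂) Ω.1).det = (q : ℂ) ^ 2 := by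
  simp [denom, repA, Matrix.det_fin_two]
  ring

theorem det_denom_repB (b : ℚ) : (denom (repB q b) Ω.1).det = q := by
  simp [denom, repB, Matrix.det_fin_two]

theorem det_denom_repC (N : ℕ) (j b : ℚ) : (denom (repC N q j b) Ω.1).det = q := by
  simp [denom, repC, Matrix.det_fin_two]

theorem det_denom_repD : (denom (repD q) Ω.1).det = 1 := by
  simp [denom, repD]

theorem act_repD : act (repD q) Ω.1 =
    symMat (q * Ω.1 0 0) (q * Ω.1 0 1) (q * Ω.1 1 1) := by
  have h := (mem_siegelSet_iff.1 Ω.2).1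
  refine act_eq_of_numer_eq (by rw [det_denom_repD]; simp) ?_
  ext i j
  fin_cases i <;> fin_cases j <;>
    simp [numer, denom, repD, symMat, Matrix.mul_apply, ← h]

include hq

theorem act_repA (b₀ b₁ b₂ : ℚ) : act (repA q b₀ b₁ b₂) Ω.1 =
    symMat ((Ω.1 0 0 + b₀) / q) ((Ω.1 0 1 + b₁) / q) ((Ω.1 1 1 + b₂) / q) := by
  have hq' : (q : ℂ) ≠ 0 := by exact_mod_cast hq.ne'
  have h := (mem_siegelSet_iff.1 Ω.2).1
  refine act_eq_of_numer_eq (by rw [det_denom_repA]; simp [hq']) ?_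
  ext i j
  fin_cases i <;> fin_cases j <;>
    simp [numer, denom, repA, symMat, Matrix.mul_apply, ← h, hq']

theorem act_repB (b : ℚ) : act (repB q b) Ω.1 =
    symMat ((Ω.1 0 0 + b) / q) (Ω.1 0 1) (q * Ω.1 1 1) := by
  have hq' : (q : ℂ) ≠ 0 := by exact_mod_cast hq.ne'
  have h := (mem_siegelSet_iff.1 Ω.2).1
  refine act_eq_of_numer_eq (by rw [det_denom_repB]; simp [hq']) ?_
  ext i j
  fin_cases i <;> fin_cases j <;>
    simp [numer, denom, repB, symMat, Matrix.mul_apply, ← h, hq']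
  ring

theorem act_repC (N : ℕ) (j b : ℚ) : act (repC N q j b) Ω.1 =
    symMat (q * Ω.1 0 0) (Ω.1 0 1 - N * j * Ω.1 0 0)
      ((N ^ 2 * j ^ 2 * Ω.1 0 0 - 2 * N * j * Ω.1 0 1 + Ω.1 1 1 + b) / q) := by
  have hq' : (q : ℂ) ≠ 0 := by exact_mod_cast hq.ne'
  have h := (mem_siegelSet_iff.1 Ω.2).1
  refine act_eq_of_numer_eq (by rw [det_denom_repC]; simp [hq']) ?_
  ext i j
  fin_cases i <;> fin_cases j <;>
    simp [numer, denom, repC, symMat, Matrix.mul_apply, ← h, hq'] <;> ring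

end Representatives

/-- The image of a point of the Siegel upper half space under a representative. -/
def heckePoint {N q : ℕ} (hN : 0 < N) (hq : 0 < q) (i : HeckeIndex q) (Ω : siegelSet) :
    siegelSet :=
  ⟨act (heckeRep hN q i).1 Ω.1,
    (IsSimilitude.of_mem_heckeDoubleCoset hq (heckeRep hN q i).2).act_mem Ω.2⟩

theorem slash_heckeRep {N q : ℕ} (hN : 0 < N) (hq : 0 < q) (K : ℕ) (f : siegelSet → ℂ)
    (i : HeckeIndex q) (Ω : siegelSet) :
    slash K (heckeRep hN q i).1 f Ω = (q : ℂ) ^ (2 * (K : ℤ) - 3) *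
      (denom (heckeRep hN q i).1 Ω.1).det ^ (-(K : ℤ)) * f (heckePoint hN hq i Ω) := by
  rw [(IsSimilitude.of_mem_heckeDoubleCoset hq (heckeRep hN q i).2).slash_apply]
  simp [heckePoint]

/-! ### The contribution of each family to the Fourier expansion of `T_q f` -/

/-- The index `qT`. -/
def scaleIndex {N : ℕ} (hN : 0 < N) {q : ℕ} (hq : 0 < q) (T : FourierIndex N) : FourierIndex N :=
  ⟨(q * T.1.1, q * T.1.2.1, q * T.1.2.2), by
    have h := (indexMatrix_posDef_iff hN).1 T.2
    rw [indexMatrix_posDef_iff hN]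
    have hq' : (0 : ℤ) < q := by exact_mod_cast hq
    refine ⟨mul_pos hq' h.1, ?_⟩
    have := mul_lt_mul_of_pos_left h.2 (pow_pos hq' 2)
    nlinarith⟩

theorem scaleIndex_injective {N : ℕ} (hN : 0 < N) {q : ℕ} (hq : 0 < q) :
    Function.Injective (scaleIndex hN hq) := by
  intro T T' h
  have hq' : (q : ℤ) ≠ 0 := by exact_mod_cast hq.ne'
  have h' := congrArg Subtype.val h
  simp only [scaleIndex, Prod.mk.injEq, mul_right_inj' hq'] at h'
  exact Subtype.ext (Prod.ext h'.1 (Prod.ext h'.2.1 h'.2.2))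

section HeckeExpansion

variable {N q : ℕ} (hN : 0 < N) (hq : q.Prime) (hqN : ¬ q ∣ N) {f : siegelSet → ℂ}
  {a : FourierIndex N → ℤ} (hf : HasIntegralFourierExpansion N f a)

include hqN hf

/-- The three sums over shifts are character sums detecting `q ∣ mN`, `q ∣ r` and `q ∣ n`. As `q ∤
N`, exactly the indices `qT` survive, each with weight `q ^ 3`. -/
theorem hasSum_heckePoint_A (Ω : siegelSet) :
    HasSum (fun T => (q : ℂ) ^ 3 * (a (scaleIndex hN hq.pos T) : ℂ) * fourierTerm N T Ω)
      (∑ i : Fin q × Fin q × Fin q, f (heckePoint hN hq.pos (.inl i) Ω)) := by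
  have hq' : (q : ℂ) ≠ 0 := by exact_mod_cast hq.ne_zero
  have hterm : ∀ (T : FourierIndex N) (i : Fin q × Fin q × Fin q),
      fourierTerm N T (heckePoint hN hq.pos (.inl i) Ω) =
      e ((T.1.1 * N * Ω.1 0 0 + T.1.2.1 * Ω.1 0 1 + T.1.2.2 * Ω.1 1 1) / q) *
      (e (((T.1.1 * N : ℤ) : ℂ) * ((i.1 : ℕ) : ℂ) / q) *
      (e ((T.1.2.1 : ℂ) * ((i.2.1 : ℕ) : ℂ) / q) * e ((T.1.2.2 : ℂ) * ((i.2.2 : ℕ) : ℂ) / q))) := by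
    intro T i
    rw [fourierTerm_eq, ← e_add, ← e_add, ← e_add]
    simp only [heckePoint, heckeRep, act_repA hq.pos, symMat]
    congr 1
    simp
    field_simp
    ring
  have hsum : ∀ T : FourierIndex N,
      ∑ i : Fin q × Fin q × Fin q, fourierTerm N T (heckePoint hN hq.pos (.inl i) Ω) =
      e ((T.1.1 * N * Ω.1 0 0 + T.1.2.1 * Ω.1 0 1 + T.1.2.2 * Ω.1 1 1) / q) *
      ((if (q : ℤ) ∣ T.1.1 * N then (q : ℂ) else 0) *
      ((if (q : ℤ) ∣ T.1.2.1 then (q : ℂ) else 0) *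
      (if (q : ℤ) ∣ T.1.2.2 then (q : ℂ) else 0))) := by
    intro T
    simp only [hterm, ← Finset.mul_sum, Fintype.sum_prod_type, sum_e_div hq.pos, ← Finset.sum_mul]
  have key := hasSum_sum_of_reindex (scaleIndex_injective hN hq.pos)
    (Function.injective_id (α := FourierIndex N)) hf
    (fun i => heckePoint hN hq.pos (.inl i) Ω) Ω ((q : ℂ) ^ 3) ?_ ?_
  · refine key.congr_fun fun T => ?_
    have := Function.injective_id.extend_apply (a ∘ scaleIndex hN hq.pos) 0 T
    simp only [id] at this
    simp only [this, Function.comp_apply]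
  · intro T
    rw [hsum, if_pos, if_pos, if_pos, fourierTerm_eq]
    · simp only [scaleIndex, id]
      rw [mul_comm]
      congr 1
      · ring
      · congr 1
        push_cast
        field_simp
    · exact Dvd.intro _ rfl
    · exact Dvd.intro _ rfl
    · exact ⟨T.1.1 * N, by simp only [scaleIndex]; ring⟩
  · intro T hT
    rw [hsum]
    by_contra hne
    simp only [mul_ne_zero_iff, ne_eq, ite_eq_right_iff, Classical.not_imp] at hne
    obtain ⟨-, ⟨h0, -⟩, ⟨⟨r, hr⟩, -⟩, ⟨n, hn⟩, -⟩ := hne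
    rw [mul_comm] at h0
    obtain ⟨m, hm⟩ := dvd_of_dvd_natCast_mul hq hqN h0
    apply hT
    have hp := (indexMatrix_posDef_iff hN).1 T.2
    rw [hm, hr, hn] at hp
    have hq0 : (0 : ℤ) < q := by exact_mod_cast hq.pos
    refine ⟨⟨(m, r, n), (indexMatrix_posDef_iff hN).2
      ⟨(mul_pos_iff_of_pos_left hq0).1 hp.1, ?_⟩⟩, ?_⟩
    · refine lt_of_mul_lt_mul_left (a := (q : ℤ) ^ 2) ?_ (by positivity)
      simp only
      linarith [hp.2, show 4 * (N : ℤ) * (q * m) * (q * n) = q ^ 2 * (4 * N * m * n) by ring]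
    · refine Subtype.ext (Prod.ext hm.symm (Prod.ext hr.symm hn.symm))

/-- Summing over the shift forces `q ∣ m`. The surviving index `(qm, r, n)` becomes `(m, r, qn)`,
with the same discriminant. -/
theorem exists_hasSum_heckePoint_B : ∃ b : FourierIndex N → ℤ, ∀ Ω : siegelSet,
    HasSum (fun T => (q : ℂ) * (b T : ℂ) * fourierTerm N T Ω)
      (∑ i : Fin q, f (heckePoint hN hq.pos (.inr (.inl i)) Ω)) := by
  have hq' : (q : ℂ) ≠ 0 := by exact_mod_cast hq.ne_zero
  have hq0 : (0 : ℤ) < q := by exact_mod_cast hq.pos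
  have hterm : ∀ (Ω : siegelSet) (T : FourierIndex N) (i : Fin q),
      fourierTerm N T (heckePoint hN hq.pos (.inr (.inl i)) Ω) =
      e (T.1.1 * N * Ω.1 0 0 / q + T.1.2.1 * Ω.1 0 1 + T.1.2.2 * q * Ω.1 1 1) *
      e (((T.1.1 * N : ℤ) : ℂ) * ((i : ℕ) : ℂ) / q) := by
    intro Ω T i
    rw [fourierTerm_eq, ← e_add]
    simp only [heckePoint, heckeRep, act_repB hq.pos, symMat]
    congr 1
    simp
    field_simp
    ring
  let σ := {p : ℤ × ℤ × ℤ // (indexMatrix N (q * p.1, p.2.1, p.2.2)).PosDef}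
  let α : σ → FourierIndex N := fun s => ⟨_, s.2⟩
  let β : σ → FourierIndex N := fun s => ⟨(s.1.1, s.1.2.1, q * s.1.2.2), by
    have h := (indexMatrix_posDef_iff hN).1 s.2
    refine (indexMatrix_posDef_iff hN).2 ⟨(mul_pos_iff_of_pos_left hq0).1 h.1, ?_⟩
    refine h.2.trans_le (le_of_eq ?_)
    ring⟩
  have hα : Function.Injective α := by
    intro s s' h
    have h' := congrArg Subtype.val h
    simp only [α, Prod.mk.injEq, mul_right_inj' hq0.ne'] at h'
    exact Subtype.ext (Prod.ext h'.1 (Prod.ext h'.2.1 h'.2.2))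
  have hβ : Function.Injective β := by
    intro s s' h
    have h' := congrArg Subtype.val h
    simp only [β, Prod.mk.injEq, mul_right_inj' hq0.ne'] at h'
    exact Subtype.ext (Prod.ext h'.1 (Prod.ext h'.2.1 h'.2.2))
  refine ⟨Function.extend β (a ∘ α) 0, fun Ω => hasSum_sum_of_reindex hα hβ hf
    (fun i => heckePoint hN hq.pos (.inr (.inl i)) Ω) Ω (q : ℂ) ?_ ?_⟩
  · intro s
    simp only [hterm, ← Finset.mul_sum, sum_e_div hq.pos]
    rw [if_pos ⟨s.1.1 * N, by simp only [α]; ring⟩, mul_comm, fourierTerm_eq]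
    simp only [α, β]
    congr 2
    push_cast
    field_simp
  · intro T hT
    simp only [hterm, ← Finset.mul_sum, sum_e_div hq.pos]
    rw [if_neg, mul_zero]
    intro h0
    rw [mul_comm] at h0
    obtain ⟨m, hm⟩ := dvd_of_dvd_natCast_mul hq hqN h0
    exact hT ⟨⟨(m, T.1.2.1, T.1.2.2), by simpa only [← hm] using T.2⟩,
      Subtype.ext (Prod.ext hm.symm rfl)⟩

omit hqN in
theorem exists_hasSum_heckePoint_C (j : Fin q) : ∃ b : FourierIndex N → ℤ, ∀ Ω : siegelSet,
    HasSum (fun T => (q : ℂ) * (b T : ℂ) * fourierTerm N T Ω)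
      (∑ i : Fin q, f (heckePoint hN hq.pos (.inr (.inr (.inl (j, i)))) Ω)) := by
  have hq' : (q : ℂ) ≠ 0 := by exact_mod_cast hq.ne_zero
  have hq0 : (0 : ℤ) < q := by exact_mod_cast hq.pos
  have hterm : ∀ (Ω : siegelSet) (T : FourierIndex N) (i : Fin q),
      fourierTerm N T (heckePoint hN hq.pos (.inr (.inr (.inl (j, i)))) Ω) =
      e (T.1.1 * N * q * Ω.1 0 0 + T.1.2.1 * (Ω.1 0 1 - N * (j : ℕ) * Ω.1 0 0) +
        T.1.2.2 * (N ^ 2 * (j : ℕ) ^ 2 * Ω.1 0 0 - 2 * N * (j : ℕ) * Ω.1 0 1 + Ω.1 1 1) / q) *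
      e ((T.1.2.2 : ℂ) * ((i : ℕ) : ℂ) / q) := by
    intro Ω T i
    rw [fourierTerm_eq, ← e_add]
    simp only [heckePoint, heckeRep, act_repC hq.pos, symMat]
    congr 1
    simp
    field_simp
    ring
  let σ := {p : ℤ × ℤ × ℤ // (indexMatrix N (p.1, p.2.1, q * p.2.2)).PosDef}
  let α : σ → FourierIndex N := fun s => ⟨_, s.2⟩
  -- These are the coefficients of the entries of `Ω` in the exponent, once the index is `(m, r,
  -- qn)`. The discriminant `4N · qmn - r²` is unchanged.
  let β : σ → FourierIndex N := fun s =>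
    ⟨(q * s.1.1 - (j : ℕ) * s.1.2.1 + N * (j : ℕ) ^ 2 * s.1.2.2,
      s.1.2.1 - 2 * N * (j : ℕ) * s.1.2.2, s.1.2.2), by
    have h := (indexMatrix_posDef_iff hN).1 s.2
    have hn : 0 < s.1.2.2 := (mul_pos_iff_of_pos_left hq0).1 (index_last_pos h.1 h.2)
    have h2 : (s.1.2.1 - 2 * N * ((j : ℕ) : ℤ) * s.1.2.2) ^ 2 < 4 * N *
        (q * s.1.1 - (j : ℕ) * s.1.2.1 + N * (j : ℕ) ^ 2 * s.1.2.2) * s.1.2.2 := by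
      have := h.2
      simp only at this
      linarith
    exact (indexMatrix_posDef_iff hN).2 ⟨index_first_pos hn h2, h2⟩⟩
  have hα : Function.Injective α := by
    intro s s' h
    have h' := congrArg Subtype.val h
    simp only [α, Prod.mk.injEq, mul_right_inj' hq0.ne'] at h'
    exact Subtype.ext (Prod.ext h'.1 (Prod.ext h'.2.1 h'.2.2))
  have hβ : Function.Injective β := by
    intro s s' h
    have h' := congrArg Subtype.val h
    simp only [β, Prod.mk.injEq] at h'
    obtain ⟨h1, h2, h3⟩ := h'
    rw [h3, sub_left_inj] at h2
    rw [h2, h3, add_left_inj, sub_left_inj, mul_right_inj' hq0.ne'] at h1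
    exact Subtype.ext (Prod.ext h1 (Prod.ext h2 h3))
  refine ⟨Function.extend β (a ∘ α) 0, fun Ω => hasSum_sum_of_reindex hα hβ hf
    (fun i => heckePoint hN hq.pos (.inr (.inr (.inl (j, i)))) Ω) Ω (q : ℂ) ?_ ?_⟩
  · intro s
    simp only [hterm, ← Finset.mul_sum, sum_e_div hq.pos]
    rw [if_pos (Dvd.intro _ rfl), mul_comm, fourierTerm_eq]
    simp only [α, β]
    congr 2
    push_cast
    field_simp
    ring
  · intro T hT
    simp only [hterm, ← Finset.mul_sum, sum_e_div hq.pos]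
    rw [if_neg, mul_zero]
    rintro ⟨n, hn⟩
    exact hT ⟨⟨(T.1.1, T.1.2.1, n), by simpa only [← hn] using T.2⟩,
      Subtype.ext (Prod.ext rfl (Prod.ext rfl hn.symm))⟩

omit hqN in
theorem exists_hasSum_heckePoint_D : ∃ b : FourierIndex N → ℤ, ∀ Ω : siegelSet,
    HasSum (fun T => (b T : ℂ) * fourierTerm N T Ω)
      (f (heckePoint hN hq.pos (.inr (.inr (.inr ()))) Ω)) := by
  have hid := Function.injective_id (α := FourierIndex N)
  refine ⟨Function.extend (scaleIndex hN hq.pos) (a ∘ id) 0, fun Ω => ?_⟩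
  have := hasSum_sum_of_reindex hid (scaleIndex_injective hN hq.pos) hf
    (fun i : Unit => heckePoint hN hq.pos (.inr (.inr (.inr i))) Ω) Ω 1 ?_ ?_
  · simpa using this
  · intro T
    simp only [Finset.univ_unique, Finset.sum_singleton, one_mul, id]
    rw [fourierTerm_eq, fourierTerm_eq]
    simp only [heckePoint, heckeRep, act_repD, symMat, scaleIndex]
    congr 1
    simp
    ring
  · intro T hT
    exact absurd ⟨T, rfl⟩ hT

/-- The Fourier expansion of `T_q f`, whose coefficient at `T` is congruent to that of `f` at
`qT`. -/
theorem exists_heckeT_expansion {K : ℕ} (hK : 3 ≤ K)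
    (hinv : ∀ γ ∈ paramodularGroup N, slash K γ f = f) :
    ∃ b, HasIntegralFourierExpansion N (heckeT K N q f) b ∧
      ∀ T, b T ≡ a (scaleIndex hN hq.pos T) [ZMOD q] := by
  have hq' : (q : ℂ) ≠ 0 := by exact_mod_cast hq.ne_zero
  obtain ⟨bB, hB⟩ := exists_hasSum_heckePoint_B hN hq hqN hf
  choose bC hC using exists_hasSum_heckePoint_C hN hq hf
  obtain ⟨bD, hD⟩ := exists_hasSum_heckePoint_D hN hq hf
  -- The powers of `q` combine the similitude factor `q ^ (2K - 3)`, the automorphy factor `q ^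
  -- (-2K)`, `q ^ (-K)` or `1`, and the character sums `q ^ 3`, `q` or `1`. The first family ends up
  -- with exponent `0`.
  refine ⟨fun T => a (scaleIndex hN hq.pos T) + q ^ (K - 2) * bB T +
    q ^ (K - 2) * ∑ j, bC j T + q ^ (2 * K - 3) * bD T, fun Ω => ?_, fun T => ?_⟩
  · rw [heckeT_eq_sum hN hq.pos hinv (heckeRep hN q) (heckeRep_bijective hN hq hqN)]
    simp only [slash_heckeRep hN hq.pos]
    rw [Fintype.sum_sum_type, Fintype.sum_sum_type, Fintype.sum_sum_type]
    have e1 : (q : ℂ) ^ (2 * (K : ℤ) - 3) = (q : ℂ) ^ (2 * K - 3) := by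
      rw [← zpow_natCast]
      congr 1
      omega
    have s1 : (q : ℂ) ^ (2 * (K : ℤ) - 3) * ((q : ℂ) ^ 2) ^ (-(K : ℤ)) * (q : ℂ) ^ 3 = 1 := by
      rw [← zpow_natCast, ← zpow_natCast, ← _root_.zpow_mul, ← zpow_add₀ hq', ← zpow_add₀ hq',
        show 2 * (K : ℤ) - 3 + ((2 : ℕ) : ℤ) * -(K : ℤ) + ((3 : ℕ) : ℤ) = 0 by push_cast; ring,
        zpow_zero]
    have s2 : (q : ℂ) ^ (2 * (K : ℤ) - 3) * (q : ℂ) ^ (-(K : ℤ)) * q = (q : ℂ) ^ (K - 2) := by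
      rw [← zpow_natCast, ← zpow_add₀ hq', ← zpow_add_one₀ hq']
      congr 1
      omega
    have hA := (hasSum_heckePoint_A hN hq hqN hf Ω).mul_left
      ((q : ℂ) ^ (2 * (K : ℤ) - 3) * ((q : ℂ) ^ 2) ^ (-(K : ℤ)))
    have hB' := (hB Ω).mul_left ((q : ℂ) ^ (2 * (K : ℤ) - 3) * (q : ℂ) ^ (-(K : ℤ)))
    have hsumC : HasSum (fun T => ∑ j, (q : ℂ) * (bC j T : ℂ) * fourierTerm N T Ω)
        (∑ i : Fin q × Fin q, f (heckePoint hN hq.pos (.inr (.inr (.inl i))) Ω)) := by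
      rw [Fintype.sum_prod_type]
      exact hasSum_sum fun j _ => hC j Ω
    have hC' := hsumC.mul_left
      ((q : ℂ) ^ (2 * (K : ℤ) - 3) * (q : ℂ) ^ (-(K : ℤ)))
    have hD' := (hD Ω).mul_left ((q : ℂ) ^ (2 * (K : ℤ) - 3) * (1 : ℂ) ^ (-(K : ℤ)))
    have hall := hA.add (hB'.add (hC'.add hD'))
    have hdA : ∀ i, (denom (heckeRep hN q (.inl i)).1 Ω.1).det = (q : ℂ) ^ 2 :=
      fun i => det_denom_repA Ω _ _ _
    have hdB : ∀ i, (denom (heckeRep hN q (.inr (.inl i))).1 Ω.1).det = (q : ℂ) :=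
      fun i => det_denom_repB Ω _
    have hdC : ∀ i, (denom (heckeRep hN q (.inr (.inr (.inl i)))).1 Ω.1).det = (q : ℂ) :=
      fun i => det_denom_repC Ω _ _ _
    have hdD : ∀ i, (denom (heckeRep hN q (.inr (.inr (.inr i)))).1 Ω.1).det = 1 :=
      fun i => det_denom_repD Ω
    simp only [hdA, hdB, hdC, hdD, ← Finset.mul_sum, Finset.univ_unique, Finset.sum_singleton]
    refine hall.congr_fun fun T => ?_
    rw [_root_.one_zpow, ← Finset.sum_mul, ← Finset.mul_sum]
    push_cast
    rw [← e1]
    linear_combination -((a (scaleIndex hN hq.pos T) : ℂ) * fourierTerm N T Ω) * s1 -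
      ((bB T : ℂ) * fourierTerm N T Ω + (∑ j, (bC j T : ℂ)) * fourierTerm N T Ω) * s2
  -- Here `K ≥ 3` makes `K - 2` and `2K - 3` positive.
  · have h1 : ∀ (n : ℕ), n ≠ 0 → ∀ x : ℤ, (q : ℤ) ^ n * x ≡ 0 [ZMOD q] := fun n hn x =>
      (Int.modEq_zero_iff_dvd).2 ((dvd_pow_self _ hn).mul_right _)
    have := ((((Int.ModEq.refl (a (scaleIndex hN hq.pos T))).add
      (h1 (K - 2) (by omega) (bB T))).add (h1 (K - 2) (by omega) (∑ j, bC j T))).add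
      (h1 (2 * K - 3) (by omega) (bD T)))
    simpa using this

end HeckeExpansion

end

section

open Matrix

/-! ### Fourier coefficients of a `q`-th power modulo `q` -/

theorem hasSum_pow_fin {ι : Type*} {F : ι → ℂ} {s : ℂ} (h : HasSum F s) (n : ℕ) :
    HasSum (fun t : Fin n → ι => ∏ i, F (t i)) (s ^ n) := by
  induction n with
  | zero =>
    simp only [Finset.univ_eq_empty, Finset.prod_empty, pow_zero]
    exact hasSum_unique (f := fun _ : Fin 0 → ι => (1 : ℂ))
  | succ n ih =>
    rw [← (Fin.consEquiv fun _ : Fin (n + 1) => ι).hasSum_iff, pow_succ']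
    have hs : Summable fun x : ι × (Fin n → ι) => F x.1 * ∏ i, F (x.2 i) :=
      summable_mul_of_summable_norm (f := F) (g := fun t : Fin n → ι => ∏ i, F (t i))
        (Summable.norm h.summable) (Summable.norm ih.summable)
    have hm : HasSum (fun x : ι × (Fin n → ι) => F x.1 * ∏ i, F (x.2 i)) (s * s ^ n) :=
      HasSum.mul (f := F) (g := fun t : Fin n → ι => ∏ i, F (t i)) h ih hs
    refine hm.congr_fun fun t => ?_
    simp [Fin.consEquiv, Fin.prod_univ_succ]

theorem hasSum_pow_fintype {ι κ : Type*} [Fintype κ] {F : ι → ℂ} {s : ℂ} (h : HasSum F s) :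
    HasSum (fun t : κ → ι => ∏ i, F (t i)) (s ^ Fintype.card κ) := by
  rw [← (Equiv.arrowCongr (Fintype.equivFin κ).symm (Equiv.refl ι)).hasSum_iff]
  refine (hasSum_pow_fin h _).congr_fun fun t => ?_
  exact (Fintype.equivFin κ).prod_comp (fun i => F (t i))

/-- Summable terms tend to zero along the cofinite filter, and an integer of absolute value below
`1` is zero. Convergence thus yields the finiteness needed for integral coefficients of a power,
without counting decompositions of an index. -/
theorem finite_support_of_summable_intCast {ι : Type*} {w : ι → ℤ} {c : ℂ} (hc : c ≠ 0)
    (h : Summable fun i => (w i : ℂ) * c) : (Function.support w).Finite := by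
  have h1 : Summable fun i => (w i : ℂ) := (summable_mul_right_iff hc).1 h
  have h2 := h1.tendsto_cofinite_zero
  have h3 : ∀ᶠ i in Filter.cofinite, ‖(w i : ℂ)‖ < 1 := by
    have := h2.norm
    rw [norm_zero] at this
    exact this.eventually (gt_mem_nhds one_pos)
  refine (Filter.eventually_cofinite.1 h3).subset fun i hi => ?_
  simp only [Function.mem_support] at hi
  simp only [Set.mem_ofPred_eq, not_lt, Complex.norm_intCast]
  exact_mod_cast Int.one_le_abs hi

/-- A finitely supported function invariant under a permutation of prime order `p` has sum
congruent to its value at the unique fixed point. -/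
theorem finsum_modEq_of_iterate {X : Type*} {p : ℕ} (hp : p.Prime) {ρ : X → X}
    (hρ : ρ^[p] = id) {w : X → ℤ} (hw : ∀ x, w (ρ x) = w x) (hfin : (Function.support w).Finite)
    {x₀ : X} (hx₀ : ∀ x, ρ x = x ↔ x = x₀) : ∑ᶠ x, w x ≡ w x₀ [ZMOD p] := by
  classical
  have : Fact p.Prime := ⟨hp⟩
  set s := hfin.toFinset with hs
  have hmem : ∀ x, x ∈ s ↔ w x ≠ 0 := by simp [hs]
  rw [finsum_eq_sum_of_support_subset w (s := s) (by simp [hs]),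
    -- The sum is grouped by the values of `w`. The value `w x₀` is inserted by hand because it is
    -- missing from the image when it is `0`.
    ← Finset.sum_fiberwise_of_maps_to (t := insert (w x₀) (s.image w))
      (fun x hx => Finset.mem_insert_of_mem (Finset.mem_image_of_mem w hx))]
  -- The level set of a nonzero value is finite and stable under `ρ`, so its size is congruent to
  -- its number of fixed points, which is `1` or `0` according to whether it contains `x₀`.
  have hcard : ∀ v : ℤ, v ≠ 0 →
      ((s.filter fun x => w x = v).card : ℤ) ≡ if v = w x₀ then 1 else 0 [ZMOD p] := by
    intro v hv
    set Y := s.filter fun x => w x = v with hY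
    have hYmem : ∀ x, x ∈ Y ↔ w x = v := by
      intro x
      simp only [hY, Finset.mem_filter, hmem]
      exact ⟨fun h => h.2, fun h => ⟨by rw [h]; exact hv, h⟩⟩
    let f : Function.End Y := fun y => ⟨ρ y.1, (hYmem _).2 (by rw [hw]; exact (hYmem _).1 y.2)⟩
    have hiter : ∀ (n : ℕ) (y : Y), ((f ^ n) y).1 = ρ^[n] y.1 := by
      intro n
      induction n with
      | zero => intro y; rfl
      | succ n ih =>
        intro y
        rw [pow_succ, Function.iterate_succ_apply]
        exact ih (f y)
    have hf : f ^ p ^ 1 = 1 := by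
      rw [pow_one]
      funext y
      apply Subtype.ext
      rw [hiter, hρ]
      rfl
    have h1 := Equiv.Perm.card_fixedPoints_modEq hf
    rw [Fintype.card_coe] at h1
    have h2 : Fintype.card (Function.fixedPoints f) = if v = w x₀ then 1 else 0 := by
      split_ifs with h
      · rw [Fintype.card_eq_one_iff]
        refine ⟨⟨⟨x₀, (hYmem _).2 h.symm⟩, Subtype.ext ((hx₀ _).2 rfl)⟩, ?_⟩
        rintro ⟨y, hy⟩
        exact Subtype.ext (Subtype.ext ((hx₀ _).1 (congrArg Subtype.val hy)))
      · rw [Fintype.card_eq_zero_iff]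
        refine ⟨?_⟩
        rintro ⟨y, hy⟩
        have h3 := (hx₀ _).1 (congrArg Subtype.val hy)
        exact h (by rw [← h3]; exact ((hYmem _).1 y.2).symm)
    rw [h2] at h1
    have h4 := (Int.natCast_modEq_iff).2 h1
    push_cast at h4
    exact h4
  have hterm : ∀ v ∈ insert (w x₀) (s.image w), ∑ x ∈ s.filter (fun x => w x = v), w x ≡
      (if v = w x₀ then v else 0) [ZMOD p] := by
    intro v _
    have h1 : ∑ x ∈ s.filter (fun x => w x = v), w x = (s.filter fun x => w x = v).card * v := by
      rw [Finset.sum_congr rfl fun x hx => (Finset.mem_filter.1 hx).2]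
      simp
    rw [h1]
    rcases eq_or_ne v 0 with rfl | hv
    · simp
    · have := (hcard v hv).mul_right v
      simpa using this
  refine (Int.ModEq.sum hterm).trans ?_
  rw [Finset.sum_ite_eq' _ _ _]
  simp

/-! ### Tuples of indices grouped by their sum, and the coefficients of `g ^ q` -/

/-- The sum of a nonempty family of indices. -/
def sumIndex {N : ℕ} {κ : Type*} [Fintype κ] [Nonempty κ] (t : κ → FourierIndex N) :
    FourierIndex N :=
  ⟨∑ i, (t i).1, by
    have h : indexMatrix N (∑ i, (t i).1) = ∑ i, indexMatrix N (t i).1 := by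
      ext i j
      fin_cases i <;> fin_cases j <;>
        simp [indexMatrix, Prod.fst_sum, Prod.snd_sum, Matrix.sum_apply, Finset.sum_mul,
          Finset.sum_div]
    rw [h]
    exact Matrix.posDef_sum Finset.univ_nonempty fun i _ => (t i).2⟩

theorem fourierTerm_sumIndex {N : ℕ} {κ : Type*} [Fintype κ] [Nonempty κ]
    (t : κ → FourierIndex N) (Ω : siegelSet) :
    fourierTerm N (sumIndex t) Ω = ∏ i, fourierTerm N (t i) Ω := by
  simp only [fourierTerm_eq, ← e_sum, sumIndex]
  congr 1
  simp only [Prod.fst_sum, Prod.snd_sum, Finset.sum_add_distrib, ← Finset.sum_mul]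
  push_cast
  rfl

theorem sumIndex_comp_equiv {N : ℕ} {κ : Type*} [Fintype κ] [Nonempty κ] (σ : κ ≃ κ)
    (t : κ → FourierIndex N) : sumIndex (fun i => t (σ i)) = sumIndex t :=
  Subtype.ext (σ.sum_comp fun i => (t i).1)

theorem sumIndex_const {N q : ℕ} (hN : 0 < N) (hq : 0 < q) {κ : Type*} [Fintype κ] [Nonempty κ]
    (hκ : Fintype.card κ = q) (T : FourierIndex N) :
    sumIndex (fun _ : κ => T) = scaleIndex hN hq T := by
  refine Subtype.ext ?_
  simp only [sumIndex, scaleIndex, Finset.sum_const, Finset.card_univ, hκ]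
  simp [Prod.ext_iff]

/-- Tuples are indexed by `ZMod q` so that rotation is translation by `1`. A fixed tuple is
constant, and its sum `qT` determines the constant. -/
theorem finsum_fiber_modEq {N q : ℕ} (hN : 0 < N) (hq : q.Prime) [NeZero q]
    (a : FourierIndex N → ℤ) (T : FourierIndex N)
    (hfin : (Function.support fun x : {t : ZMod q → FourierIndex N //
      sumIndex t = scaleIndex hN hq.pos T} => ∏ i, a (x.1 i)).Finite) :
    ∑ᶠ x : {t : ZMod q → FourierIndex N // sumIndex t = scaleIndex hN hq.pos T},
      ∏ i, a (x.1 i) ≡ a T [ZMOD q] := by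
  have : Fact q.Prime := ⟨hq⟩
  let ρ : {t : ZMod q → FourierIndex N // sumIndex t = scaleIndex hN hq.pos T} →
      {t : ZMod q → FourierIndex N // sumIndex t = scaleIndex hN hq.pos T} := fun x =>
    ⟨fun i => x.1 (Equiv.addRight (1 : ZMod q) i), by rw [sumIndex_comp_equiv, x.2]⟩
  have hρ : ∀ x i, (ρ x).1 i = x.1 (i + 1) := fun x i => rfl
  have hiter : ∀ (n : ℕ) x i, (ρ^[n] x).1 i = x.1 (i + n) := by
    intro n
    induction n with
    | zero => intro x i; simp
    | succ n ih =>
      intro x i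
      rw [Function.iterate_succ_apply, ih, hρ]
      push_cast
      rw [add_assoc]
  have key := finsum_modEq_of_iterate hq (ρ := ρ) (w := fun x => ∏ i, a (x.1 i))
    (x₀ := ⟨fun _ => T, sumIndex_const hN hq.pos (ZMod.card q) T⟩) ?_ ?_ hfin ?_
  · refine key.trans ?_
    simp only [Finset.prod_const, Finset.card_univ, ZMod.card]
    rw [← ZMod.intCast_eq_intCast_iff]
    push_cast
    -- Fermat: the fixed tuple contributes `a T ^ q ≡ a T`.
    exact ZMod.pow_card _
  · funext x
    refine Subtype.ext (funext fun i => ?_)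
    rw [hiter]
    simp
  · intro x
    exact Equiv.prod_comp (Equiv.addRight (1 : ZMod q)) fun i => a (x.1 i)
  · intro x
    constructor
    · intro hx
      have h1 : ∀ i, x.1 (i + 1) = x.1 i := fun i => by rw [← hρ, hx]
      have h2 : ∀ n : ℕ, x.1 (n : ZMod q) = x.1 0 := by
        intro n
        induction n with
        | zero => simp
        | succ n ih => push_cast; rw [h1, ih]
      have h3 : x.1 = fun _ => x.1 0 := by
        funext i
        rw [← ZMod.natCast_zmod_val i, h2]
      have h4 : scaleIndex hN hq.pos (x.1 0) = scaleIndex hN hq.pos T := by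
        rw [← sumIndex_const hN hq.pos (ZMod.card q) (x.1 0), ← h3, x.2]
      refine Subtype.ext ?_
      rw [h3, scaleIndex_injective hN hq.pos h4]
    · rintro rfl
      exact Subtype.ext (funext fun i => hρ _ i)

theorem hasSum_pow_fiber {N : ℕ} {κ : Type*} [Fintype κ] [Nonempty κ] {g : siegelSet → ℂ}
    {a : FourierIndex N → ℤ} (hg : HasIntegralFourierExpansion N g a) (Ω : siegelSet) :
    HasSum (fun p : Σ S, {t : κ → FourierIndex N // sumIndex t = S} =>
      ((∏ i, a (p.2.1 i) : ℤ) : ℂ) * fourierTerm N p.1 Ω) ((g ^ Fintype.card κ) Ω) := by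
  have h := hasSum_pow_fintype (κ := κ) (hg Ω)
  rw [← (Equiv.sigmaFiberEquiv (sumIndex (N := N) (κ := κ))).hasSum_iff] at h
  refine h.congr_fun ?_
  rintro ⟨S, t, rfl⟩
  rw [Function.comp_apply, fourierTerm_sumIndex, Finset.prod_mul_distrib, Int.cast_prod]
  rfl

theorem finite_support_fiber {N : ℕ} {κ : Type*} [Fintype κ] [Nonempty κ] {g : siegelSet → ℂ}
    {a : FourierIndex N → ℤ} (hg : HasIntegralFourierExpansion N g a) (S : FourierIndex N) :
    (Function.support fun x : {t : κ → FourierIndex N // sumIndex t = S} =>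
      ∏ i, a (x.1 i)).Finite := by
  have hΩ : (symMat Complex.I 0 Complex.I) ∈ siegelSet := by
    rw [symMat_mem_siegelSet_iff]; simp
  have h1 : Summable fun x : {t : κ → FourierIndex N // sumIndex t = S} =>
      ((∏ i, a (x.1 i) : ℤ) : ℂ) * fourierTerm N S ⟨_, hΩ⟩ :=
    (hasSum_pow_fiber hg ⟨_, hΩ⟩).summable.sigma_factor S
  exact finite_support_of_summable_intCast (fourierTerm_ne_zero S ⟨_, hΩ⟩) h1

theorem hasSum_fiber {N : ℕ} {κ : Type*} [Fintype κ] [Nonempty κ]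
    {g : siegelSet → ℂ} {a : FourierIndex N → ℤ} (hg : HasIntegralFourierExpansion N g a)
    (S : FourierIndex N) :
    HasSum (fun x : {t : κ → FourierIndex N // sumIndex t = S} => ((∏ i, a (x.1 i) : ℤ) : ℂ))
      ((∑ᶠ x : {t : κ → FourierIndex N // sumIndex t = S}, ∏ i, a (x.1 i) : ℤ) : ℂ) := by
  have hfin := finite_support_fiber (κ := κ) hg S
  rw [finsum_eq_sum _ hfin, Int.cast_sum]
  refine hasSum_sum_of_ne_finset_zero fun x hx => ?_
  rw [Set.Finite.mem_toFinset, Function.notMem_support] at hx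
  rw [hx, Int.cast_zero]

theorem hasIntegralFourierExpansion_pow {N : ℕ} {κ : Type*} [Fintype κ] [Nonempty κ]
    {g : siegelSet → ℂ} {a : FourierIndex N → ℤ} (hg : HasIntegralFourierExpansion N g a) :
    HasIntegralFourierExpansion N (g ^ Fintype.card κ)
      (fun S => ∑ᶠ x : {t : κ → FourierIndex N // sumIndex t = S}, ∏ i, a (x.1 i)) := by
  intro Ω
  exact HasSum.sigma (f := fun p : Σ S, {t : κ → FourierIndex N // sumIndex t = S} =>
      ((∏ i, a (p.2.1 i) : ℤ) : ℂ) * fourierTerm N p.1 Ω)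
    (hasSum_pow_fiber (κ := κ) hg Ω) fun S =>
      HasSum.mul_right (fourierTerm N S Ω) (hasSum_fiber (κ := κ) hg S)

theorem exists_pow_expansion {N q : ℕ} (hN : 0 < N) (hq : q.Prime) {g : siegelSet → ℂ}
    {a : FourierIndex N → ℤ} (hg : HasIntegralFourierExpansion N g a) :
    ∃ A, HasIntegralFourierExpansion N (g ^ q) A ∧
      ∀ T, A (scaleIndex hN hq.pos T) ≡ a T [ZMOD q] := by
  have : NeZero q := ⟨hq.ne_zero⟩
  refine ⟨fun S => ∑ᶠ x : {t : ZMod q → FourierIndex N // sumIndex t = S}, ∏ i, a (x.1 i), ?_,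
    fun T => finsum_fiber_modEq hN hq a T (finite_support_fiber hg _)⟩
  have h := hasIntegralFourierExpansion_pow (κ := ZMod q) hg
  rwa [ZMod.card] at h

end

section

open Matrix MeasureTheory

/-! ### The first Fourier-Jacobi coefficient -/

/-- The coefficients of the first Fourier-Jacobi coefficient. -/
def firstCoeff (N : ℕ) (a : FourierIndex N → ℤ) (n r : ℤ) : ℤ :=
  open Classical in
  if h : (indexMatrix N (1, r, n)).PosDef then a ⟨(1, r, n), h⟩ else 0

theorem firstCoeff_of_posDef {N : ℕ} (a : FourierIndex N → ℤ) {n r : ℤ}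
    (h : (indexMatrix N (1, r, n)).PosDef) : firstCoeff N a n r = a ⟨(1, r, n), h⟩ := by
  rw [firstCoeff, dif_pos h]

theorem firstCoeff_ne_zero {N : ℕ} (hN : 0 < N) {a : FourierIndex N → ℤ} {n r : ℤ}
    (h : firstCoeff N a n r ≠ 0) : 0 ≤ n ∧ 0 < 4 * (N : ℤ) * n - r ^ 2 := by
  by_cases hp : (indexMatrix N (1, r, n)).PosDef
  · have h1 := (indexMatrix_posDef_iff hN).1 hp
    have h2 := index_last_pos h1.1 h1.2
    simp only [mul_one] at h1 h2
    exact ⟨h2.le, by linarith [h1.2]⟩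
  · rw [firstCoeff, dif_neg hp] at h
    exact absurd rfl h

theorem integral_e_int (m : ℤ) : ∫ u in (0 : ℝ)..1, e (m * u) = if m = 0 then 1 else 0 := by
  split_ifs with h
  · simp [h, e_zero]
  · have hc : (2 * Real.pi * Complex.I * m : ℂ) ≠ 0 :=
      mul_ne_zero Complex.two_pi_I_ne_zero (by exact_mod_cast h)
    have h1 : ∀ u : ℝ, e (m * u) = Complex.exp (2 * Real.pi * Complex.I * m * u) := by
      intro u; rw [e]; ring_nf
    simp only [h1]
    rw [integral_exp_mul_complex hc]
    have h2 : Complex.exp (2 * Real.pi * Complex.I * m * (1 : ℝ)) = 1 := by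
      rw [Complex.exp_eq_one_iff]
      exact ⟨m, by push_cast; ring⟩
    rw [h2]
    simp

theorem continuous_e : Continuous e := by
  unfold e
  fun_prop

/-- The point with coordinates `ω + u`, `z`, `τ`, in this order. -/
theorem symMat_add_mem {ω z τ : ℂ} (h : symMat ω z τ ∈ siegelSet) (u : ℝ) :
    symMat (ω + u) z τ ∈ siegelSet := by
  rw [symMat_mem_siegelSet_iff] at h ⊢
  simpa using h

/-- Integrating over real translations of `ω` against `e(-Nu)` keeps only the terms with `m = 1`.
The point `ω` is arbitrary, which shows that the integral gives the same Jacobi form at every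
admissible height. -/
theorem hasSum_firstCoeff {N : ℕ} (hN : 0 < N) {f : siegelSet → ℂ} {a : FourierIndex N → ℤ}
    (hf : HasIntegralFourierExpansion N f a) {ω z τ : ℂ} (h : symMat ω z τ ∈ siegelSet) :
    HasSum (fun p : ℤ × ℤ => (firstCoeff N a p.1 p.2 : ℂ) * e (p.1 * τ + p.2 * z))
      (e (-(N * ω)) * ∫ u in (0 : ℝ)..1, extend f (symMat (ω + u) z τ) * e (-(N * u))) := by
  have hN' : (N : ℤ) ≠ 0 := by exact_mod_cast hN.ne'
  have hterm : ∀ (T : FourierIndex N) (u : ℝ),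
      fourierTerm N T ⟨_, symMat_add_mem h u⟩ * e (-(N * u)) =
      fourierTerm N T ⟨_, h⟩ * e (((T.1.1 - 1) * N : ℤ) * u) := by
    intro T u
    rw [fourierTerm_eq, fourierTerm_eq, ← e_add, ← e_add]
    congr 1
    simp [symMat]
    ring
  have hnorm : ∀ (m : ℤ) (u : ℝ), ‖e (m * u)‖ = 1 := by
    intro m u
    rw [norm_e]
    simp
  have hint : HasSum (fun T : FourierIndex N => ∫ u in (0 : ℝ)..1,
      (a T : ℂ) * (fourierTerm N T ⟨_, h⟩ * e (((T.1.1 - 1) * N : ℤ) * u)))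
      (∫ u in (0 : ℝ)..1, extend f (symMat (ω + u) z τ) * e (-(N * u))) := by
    -- A real translation changes each term by a factor of absolute value one, so the norms at `u =
    -- 0` dominate.
    refine intervalIntegral.hasSum_integral_of_dominated_convergence
      (fun T _ => ‖(a T : ℂ) * fourierTerm N T ⟨_, h⟩‖) ?_ ?_ ?_ ?_ ?_
    · intro T
      refine Continuous.aestronglyMeasurable ?_
      have := continuous_e
      fun_prop
    · intro T
      refine Filter.Eventually.of_forall fun u _ => ?_
      rw [← mul_assoc, norm_mul, hnorm, mul_one]
    · exact Filter.Eventually.of_forall fun u _ => (hf ⟨_, h⟩).summable.norm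
    · exact intervalIntegrable_const
    · refine Filter.Eventually.of_forall fun u _ => ?_
      rw [extend_of_mem f (symMat_add_mem h u)]
      have h1 := HasSum.mul_right (e (-(N * u))) (hf ⟨_, symMat_add_mem h u⟩)
      refine h1.congr_fun fun T => ?_
      rw [← hterm, mul_assoc]
  have hint2 : HasSum (fun T : FourierIndex N => if T.1.1 = 1 then
      (a T : ℂ) * fourierTerm N T ⟨_, h⟩ else 0)
      (∫ u in (0 : ℝ)..1, extend f (symMat (ω + u) z τ) * e (-(N * u))) := by
    refine hint.congr_fun fun T => ?_
    rw [intervalIntegral.integral_const_mul, intervalIntegral.integral_const_mul, integral_e_int]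
    have h1 : (T.1.1 - 1) * (N : ℤ) = 0 ↔ T.1.1 = 1 := by
      rw [mul_eq_zero, or_iff_left hN', sub_eq_zero]
    simp only [h1]
    split_ifs <;> simp
  let α : {p : ℤ × ℤ // (indexMatrix N (1, p.2, p.1)).PosDef} → FourierIndex N := fun p => ⟨_, p.2⟩
  have hα : Function.Injective α := by
    intro s s' h
    have h' := congrArg Subtype.val h
    simp only [α, Prod.mk.injEq, true_and] at h'
    exact Subtype.ext (Prod.ext h'.2 h'.1)
  rw [← hα.hasSum_iff] at hint2
  · have h3 := HasSum.mul_left (e (-(N * ω))) hint2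
    rw [← (Subtype.val_injective (p := fun p : ℤ × ℤ =>
      (indexMatrix N (1, p.2, p.1)).PosDef)).hasSum_iff]
    · refine h3.congr_fun fun p => ?_
      simp only [Function.comp_apply, α, if_true, firstCoeff_of_posDef a p.2, fourierTerm_eq]
      rw [mul_left_comm, ← e_add]
      congr 2
      simp [symMat]
      ring
    · intro p hp
      have hp' : ¬ (indexMatrix N (1, p.2, p.1)).PosDef := by simpa using hp
      rw [firstCoeff, dif_neg hp']
      simp
  · intro T hT
    rw [if_neg]
    intro h1
    refine hT ⟨⟨(T.1.2.2, T.1.2.1), ?_⟩, ?_⟩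
    · have := T.2
      rwa [show T.1 = (1, T.1.2.1, T.1.2.2) from Prod.ext h1 rfl] at this
    · exact Subtype.ext (Prod.ext h1.symm rfl)

theorem fourierJacobiCoeff_point_mem (τ : ℍ) (z : ℂ) :
    symMat (Complex.I * ((z.im ^ 2 / τ.im + 1 : ℝ) : ℂ)) z τ ∈ siegelSet := by
  have hτ := τ.im_pos
  rw [symMat_mem_siegelSet_iff]
  simp only [Complex.mul_im, Complex.I_re, Complex.I_im, Complex.ofReal_re, Complex.ofReal_im,
    zero_mul, one_mul, zero_add, UpperHalfPlane.coe_im]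
  refine ⟨by positivity, ?_⟩
  have : (z.im ^ 2 / τ.im + 1) * τ.im = z.im ^ 2 + τ.im := by field_simp
  linarith

theorem hasJacobiExpansion_fourierJacobiCoeff {N : ℕ} (hN : 0 < N) {f : siegelSet → ℂ}
    {a : FourierIndex N → ℤ} (hf : HasIntegralFourierExpansion N f a) :
    HasJacobiExpansion (fourierJacobiCoeff N 1 f) (fun n r => (firstCoeff N a n r : ℂ)) := by
  intro τ z
  have h := hasSum_firstCoeff hN hf (fourierJacobiCoeff_point_mem τ z)
  convert h using 1
  rw [fourierJacobiCoeff, ← intervalIntegral.integral_const_mul]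
  refine intervalIntegral.integral_congr fun u _ => ?_
  rw [mul_left_comm, ← e_add, add_comm (u : ℂ)]
  congr 2
  push_cast
  ring

/-- `φ₁(τ, z) e(Nω)` is a partial Fourier transform of `f`. -/
theorem jacobiToSiegel_fourierJacobiCoeff {N : ℕ} (hN : 0 < N) {f : siegelSet → ℂ}
    {a : FourierIndex N → ℤ} (hf : HasIntegralFourierExpansion N f a) (Ω : siegelSet) :
    jacobiToSiegel N (fourierJacobiCoeff N 1 f) Ω =
      ∫ u in (0 : ℝ)..1, extend f (symMat (Ω.1 1 1 + u) (Ω.1 0 1) (Ω.1 0 0)) * e (-(N * u)) := by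
  obtain ⟨-, h0, h1⟩ := mem_siegelSet_iff.1 Ω.2
  have hmem : symMat (Ω.1 1 1) (Ω.1 0 1) (Ω.1 0 0) ∈ siegelSet := by
    rw [symMat_mem_siegelSet_iff]
    refine ⟨?_, by linarith⟩
    have : 0 < (Ω.1 0 0).im * (Ω.1 1 1).im := (sq_nonneg _).trans_lt h1
    exact (mul_pos_iff_of_pos_left h0).1 this
  have h2 := hasSum_firstCoeff hN hf hmem
  have h3 := hasJacobiExpansion_fourierJacobiCoeff hN hf (UpperHalfPlane.ofComplex (Ω.1 0 0))
    (Ω.1 0 1)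
  rw [UpperHalfPlane.ofComplex_apply_of_im_pos h0] at h3
  -- The series does not involve the height, so the height in the definition and that of `Ω` give
  -- the same value.
  have h4 := h3.unique h2
  rw [jacobiToSiegel, UpperHalfPlane.ofComplex_apply_of_im_pos h0, h4, mul_right_comm, ← e_add]
  simp [e_zero]

/-! ### Exchanging the two coordinates -/

/-- The exchange of the two coordinates. -/
abbrev exch : Fin 2 ≃ Fin 2 := Equiv.swap 0 1

/-- The exchange of the two coordinates on symplectic matrices. -/
def exchMat (γ : Mat4) : Mat4 :=
  γ.submatrix (Equiv.sumCongr exch exch) (Equiv.sumCongr exch exch)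

theorem numer_exchMat (γ : Mat4) (Ω : Matrix (Fin 2) (Fin 2) ℂ) :
    numer (exchMat γ) (Ω.submatrix exch exch) = (numer γ Ω).submatrix exch exch := by
  rw [numer, numer, submatrix_add, Pi.add_apply, Pi.add_apply, ← submatrix_mul_equiv _ _ _ exch]
  rfl

theorem denom_exchMat (γ : Mat4) (Ω : Matrix (Fin 2) (Fin 2) ℂ) :
    denom (exchMat γ) (Ω.submatrix exch exch) = (denom γ Ω).submatrix exch exch := by
  rw [denom, denom, submatrix_add, Pi.add_apply, Pi.add_apply, ← submatrix_mul_equiv _ _ _ exch]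
  rfl

theorem act_exchMat (γ : Mat4) (Ω : Matrix (Fin 2) (Fin 2) ℂ) :
    act (exchMat γ) (Ω.submatrix exch exch) = (act γ Ω).submatrix exch exch := by
  rw [act_eq, act_eq, numer_exchMat, denom_exchMat, inv_submatrix_equiv, submatrix_mul_equiv]

/-- The Jacobi group singles out the second coordinate, `K(N)` the first. After the exchange the
five forced zeros fall exactly on the five positions where `K(N)` requires divisibility by `N`. The
position with denominator `N` accepts any integer. -/
theorem exchMat_mem {γ : Matrix (Fin 2 ⊕ Fin 2) (Fin 2 ⊕ Fin 2) ℤ} (h : γ ∈ jacobiGroup) {N : ℕ}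
    (hN : 0 < N) : exchMat (toRat γ) ∈ paramodularGroup N := by
  have hN' : (N : ℚ) ≠ 0 := by exact_mod_cast hN.ne'
  obtain ⟨hs, h1, h2, h3, h4, h5⟩ := h
  constructor
  · have h6 : toRat γ ∈ symplecticGroup (Fin 2) ℚ :=
      SymplecticGroup.map_mem (f := Int.castRingHom ℚ) hs
    rw [SymplecticGroup.mem_iff] at h6 ⊢
    have hJ : (J (Fin 2) ℚ).submatrix (Equiv.sumCongr exch exch) (Equiv.sumCongr exch exch) =
        J (Fin 2) ℚ := by
      ext i j
      rcases i with i | i <;> rcases j with j | j <;> simp [J, Matrix.one_apply]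
    conv_lhs => rw [← hJ]
    rw [exchMat, transpose_submatrix, submatrix_mul_equiv, submatrix_mul_equiv, h6, hJ]
  · have key : ∀ i j, (∃ m : ℤ, γ (Equiv.sumCongr exch exch i) (Equiv.sumCongr exch exch j) *
        (1 : ℚ) = paramodularPattern N i j * m) →
        ∃ m : ℤ, exchMat (toRat γ) i j = paramodularPattern N i j * m := by
      rintro i j ⟨m, hm⟩
      exact ⟨m, by rw [← hm, mul_one]; rfl⟩
    intro i j
    apply key
    rcases i with i | i <;> rcases j with j | j <;> fin_cases i <;> fin_cases j
    all_goals first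
      | (refine ⟨0, ?_⟩; simp [h1, h2, h3, h4, h5]; done)
      | (refine ⟨_, (mul_comm _ _).trans (congrArg₂ (· * ·) ?_ rfl)⟩
         simp [paramodularPattern]; done)
      | (refine ⟨N * γ (.inl 1) (.inr 1), ?_⟩; simp [paramodularPattern, hN'])

theorem submatrix_exch {Ω : Matrix (Fin 2) (Fin 2) ℂ} (h : Ω 0 1 = Ω 1 0) :
    Ω.submatrix exch exch = symMat (Ω 1 1) (Ω 0 1) (Ω 0 0) := by
  ext i j
  fin_cases i <;> fin_cases j <;> simp [symMat, h]

/-- The matrix with lower right entry `u` and zeros elsewhere. -/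
abbrev cornerMat (u : ℂ) : Matrix (Fin 2) (Fin 2) ℂ := !![0, 0; 0, u]

theorem denom_add_corner {γ : Matrix (Fin 2 ⊕ Fin 2) (Fin 2 ⊕ Fin 2) ℤ} (h : γ ∈ jacobiGroup)
    (Ω : Matrix (Fin 2) (Fin 2) ℂ) (u : ℂ) :
    denom (toRat γ) (Ω + cornerMat u) = denom (toRat γ) Ω := by
  obtain ⟨hs, h1, h2, h3, h4, h5⟩ := h
  have h0 : (toRat γ).toBlocks₂₁.map (fun x : ℚ => (x : ℂ)) * cornerMat u = 0 := by
    ext i j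
    fin_cases i <;> fin_cases j <;> simp [Matrix.mul_apply, toRat, toBlocks₂₁, h2, h4]
  rw [denom, denom, Matrix.mul_add, h0, add_zero]

/-- Elements of the Jacobi group commute with translations of the last coordinate. A translation by
`u` is scaled by `a / d`, where the integers `a`, `d` satisfy `a d = 1` and so are equal. -/
theorem act_add_corner {γ : Matrix (Fin 2 ⊕ Fin 2) (Fin 2 ⊕ Fin 2) ℤ} (h : γ ∈ jacobiGroup)
    {Ω : Matrix (Fin 2) (Fin 2) ℂ} (hΩ : IsUnit (denom (toRat γ) Ω).det) (u : ℂ) :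
    act (toRat γ) (Ω + cornerMat u) = act (toRat γ) Ω + cornerMat u := by
  refine act_eq_of_numer_eq (by rwa [denom_add_corner h]) ?_
  rw [denom_add_corner h, Matrix.add_mul, act_eq, Matrix.nonsing_inv_mul_cancel_right _ _ hΩ]
  obtain ⟨hs, h1, h2, h3, h4, h5⟩ := h
  have had : γ (.inl 1) (.inl 1) * γ (.inr 1) (.inr 1) = 1 := by
    have h6 := congrFun (congrFun (SymplecticGroup.mem_iff'.1 hs) (.inl 1)) (.inr 1)
    simp [J, Matrix.mul_apply, Fintype.sum_sum_type, Fin.sum_univ_two, Matrix.one_apply, h1, h2,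
      h4] at h6
    linarith
  have had' : γ (.inl 1) (.inl 1) = γ (.inr 1) (.inr 1) := by
    rcases Int.mul_eq_one_iff_eq_one_or_neg_one.1 had with h | h <;> rw [h.1, h.2]
  rw [numer, Matrix.mul_add, numer, add_right_comm]
  congr 1
  ext i j
  fin_cases i <;> fin_cases j <;>
    simp [Matrix.mul_apply, denom, toRat, toBlocks₂₁, toBlocks₁₁, toBlocks₂₂, h1, h3, h4, h5,
      had', mul_comm]

theorem jacobi_invariant {N K : ℕ} (hN : 0 < N) {f : siegelSet → ℂ}
    {a : FourierIndex N → ℤ} (hf : HasIntegralFourierExpansion N f a)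
    (hinv : ∀ γ ∈ paramodularGroup N, slash K γ f = f)
    {γ : Matrix (Fin 2 ⊕ Fin 2) (Fin 2 ⊕ Fin 2) ℤ} (hγ : γ ∈ jacobiGroup) :
    slash K (toRat γ) (jacobiToSiegel N (fourierJacobiCoeff N 1 f)) =
      jacobiToSiegel N (fourierJacobiCoeff N 1 f) := by
  have hsim : IsSimilitude 1 (toRat γ) :=
    .of_mem (SymplecticGroup.map_mem (f := Int.castRingHom ℚ) hγ.1)
  have hmem := exchMat_mem hγ hN
  have hsim' := IsSimilitude.of_mem_paramodularGroup hmem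
  funext Ω
  have hu := hsim.isUnit_det_denom Ω.2
  have h01 := (mem_siegelSet_iff.1 Ω.2).1
  rw [hsim.slash_apply, jacobiToSiegel_fourierJacobiCoeff hN hf,
    jacobiToSiegel_fourierJacobiCoeff hN hf, ← intervalIntegral.integral_const_mul]
  -- The translation `u` passes through `γ` and does not affect the automorphy factor, so
  -- paramodular invariance can be applied under the integral.
  refine intervalIntegral.integral_congr fun u _ => ?_
  simp only
  have hΩu : Ω.1 + cornerMat u ∈ siegelSet := by
    have := mem_siegelSet_iff.1 Ω.2
    rw [mem_siegelSet_iff]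
    simpa using this
  have hsw : ∀ {M : Matrix (Fin 2) (Fin 2) ℂ}, M ∈ siegelSet → M.submatrix exch exch =
      symMat (M 1 1) (M 0 1) (M 0 0) ∧ M.submatrix exch exch ∈ siegelSet := by
    intro M hM
    obtain ⟨h1, h2, h3⟩ := mem_siegelSet_iff.1 hM
    refine ⟨submatrix_exch h1, ?_⟩
    rw [submatrix_exch h1, symMat_mem_siegelSet_iff]
    refine ⟨?_, by linarith⟩
    have : 0 < (M 0 0).im * (M 1 1).im := (sq_nonneg _).trans_lt h3
    exact (mul_pos_iff_of_pos_left h2).1 this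
  have hact := hsim.act_mem hΩu
  have key := congrFun (hinv _ hmem) ⟨_, (hsw hΩu).2⟩
  rw [hsim'.slash_apply, ← extend_coe f ⟨_, (hsw hΩu).2⟩] at key
  rw [← extend_coe f ⟨act _ _, _⟩] at key
  simp only at key
  rw [act_exchMat, denom_exchMat, det_submatrix_equiv_self, denom_add_corner hγ, (hsw hact).1,
    (hsw hΩu).1, act_add_corner hγ hu] at key
  have e1 : ∀ M : Matrix (Fin 2) (Fin 2) ℂ,
      symMat ((M + cornerMat u) 1 1) ((M + cornerMat u) 0 1) ((M + cornerMat u) 0 0) =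
      symMat (M 1 1 + u) (M 0 1) (M 0 0) := by
    intro M; simp
  rw [e1, e1] at key
  rw [← key]
  ring

end

section

open Matrix MeasureTheory

/-! ### Fourier series of Jacobi type -/

/-- The absolute value of `e(nτ + rz)` for `Im τ = t`, `Im z = s`. -/
def jacobiNorm (t s : ℝ) (p : ℤ × ℤ) : ℝ := Real.exp (-(2 * Real.pi * (p.1 * t + p.2 * s)))

theorem norm_e_jacobi (p : ℤ × ℤ) (τ z : ℂ) :
    ‖e (p.1 * τ + p.2 * z)‖ = jacobiNorm τ.im z.im p := by
  rw [norm_e, jacobiNorm]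
  simp

theorem HasJacobiExpansion.summable {φ : ℍ → ℂ → ℂ} {c : ℤ → ℤ → ℂ} (h : HasJacobiExpansion φ c)
    {t : ℝ} (ht : 0 < t) (s : ℝ) : Summable fun p : ℤ × ℤ => ‖c p.1 p.2‖ * jacobiNorm t s p := by
  have h1 := (h ⟨Complex.I * t, by simpa using ht⟩ (Complex.I * s)).summable.norm
  refine h1.congr fun p => ?_
  rw [norm_mul]
  congr 1
  have := norm_e_jacobi p (Complex.I * t) (Complex.I * s)
  simp only [Complex.mul_im, Complex.I_re, Complex.I_im, Complex.ofReal_re, Complex.ofReal_im,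
    zero_mul, one_mul, zero_add] at this
  exact this

/-- The four corners of a square dominate its interior. -/
theorem jacobiNorm_mul_exp_le (t s η : ℝ) (p : ℤ × ℤ) :
    jacobiNorm t s p * Real.exp (2 * Real.pi * η * (|(p.1 : ℝ)| + |(p.2 : ℝ)|)) ≤
      jacobiNorm (t - η) (s - η) p + jacobiNorm (t - η) (s + η) p +
      jacobiNorm (t + η) (s - η) p + jacobiNorm (t + η) (s + η) p := by
  simp only [jacobiNorm, ← Real.exp_add]
  have h1 := Real.exp_nonneg (-(2 * Real.pi * (p.1 * (t - η) + p.2 * (s - η))))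
  have h2 := Real.exp_nonneg (-(2 * Real.pi * (p.1 * (t - η) + p.2 * (s + η))))
  have h3 := Real.exp_nonneg (-(2 * Real.pi * (p.1 * (t + η) + p.2 * (s - η))))
  have h4 := Real.exp_nonneg (-(2 * Real.pi * (p.1 * (t + η) + p.2 * (s + η))))
  rcases abs_cases (p.1 : ℝ) with ⟨ha, -⟩ | ⟨ha, -⟩ <;>
    rcases abs_cases (p.2 : ℝ) with ⟨hb, -⟩ | ⟨hb, -⟩ <;> rw [ha, hb]
  · rw [show -(2 * Real.pi * (p.1 * t + p.2 * s)) + 2 * Real.pi * η * (p.1 + p.2) =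
      -(2 * Real.pi * (p.1 * (t - η) + p.2 * (s - η))) by ring]
    linarith
  · rw [show -(2 * Real.pi * (p.1 * t + p.2 * s)) + 2 * Real.pi * η * (p.1 + -p.2) =
      -(2 * Real.pi * (p.1 * (t - η) + p.2 * (s + η))) by ring]
    linarith
  · rw [show -(2 * Real.pi * (p.1 * t + p.2 * s)) + 2 * Real.pi * η * (-p.1 + p.2) =
      -(2 * Real.pi * (p.1 * (t + η) + p.2 * (s - η))) by ring]
    linarith
  · rw [show -(2 * Real.pi * (p.1 * t + p.2 * s)) + 2 * Real.pi * η * (-p.1 + -p.2) =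
      -(2 * Real.pi * (p.1 * (t + η) + p.2 * (s + η))) by ring]
    linarith

theorem HasJacobiExpansion.summable_mul_exp {φ : ℍ → ℂ → ℂ} {c : ℤ → ℤ → ℂ}
    (h : HasJacobiExpansion φ c) {t η : ℝ} (hη : 0 < η) (hηt : η < t) (s : ℝ) :
    Summable fun p : ℤ × ℤ => ‖c p.1 p.2‖ *
      (jacobiNorm t s p * Real.exp (2 * Real.pi * η * (|(p.1 : ℝ)| + |(p.2 : ℝ)|))) := by
  have h1 := h.summable (sub_pos.2 hηt) (s - η)
  have h2 := h.summable (sub_pos.2 hηt) (s + η)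
  have h3 := h.summable (show 0 < t + η by linarith) (s - η)
  have h4 := h.summable (show 0 < t + η by linarith) (s + η)
  refine Summable.of_nonneg_of_le (fun p => ?_) (fun p => ?_) (((h1.add h2).add h3).add h4)
  · exact mul_nonneg (norm_nonneg _) (mul_nonneg (Real.exp_nonneg _) (Real.exp_nonneg _))
  · have := mul_le_mul_of_nonneg_left (jacobiNorm_mul_exp_le t s η p) (norm_nonneg (c p.1 p.2))
    linarith

theorem hasDerivAt_e (z : ℂ) : HasDerivAt e (2 * Real.pi * Complex.I * e z) z := by
  unfold e
  have h := ((hasDerivAt_id z).const_mul (2 * Real.pi * Complex.I : ℂ)).cexp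
  simpa [mul_comm] using h

/-- The linear form `(τ, z) ↦ nτ + rz`. -/
def jacobiForm (p : ℤ × ℤ) : ℂ × ℂ →L[ℂ] ℂ :=
  (p.1 : ℂ) • ContinuousLinearMap.fst ℂ ℂ ℂ + (p.2 : ℂ) • ContinuousLinearMap.snd ℂ ℂ ℂ

theorem jacobiForm_apply (p : ℤ × ℤ) (x : ℂ × ℂ) : jacobiForm p x = p.1 * x.1 + p.2 * x.2 := by
  simp [jacobiForm]

theorem norm_jacobiForm_le (p : ℤ × ℤ) : ‖jacobiForm p‖ ≤ |(p.1 : ℝ)| + |(p.2 : ℝ)| := by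
  refine (norm_add_le _ _).trans (add_le_add ?_ ?_)
  · rw [norm_smul, Complex.norm_intCast]
    exact mul_le_of_le_one_right (abs_nonneg _) (ContinuousLinearMap.norm_fst_le ℂ ℂ ℂ)
  · rw [norm_smul, Complex.norm_intCast]
    exact mul_le_of_le_one_right (abs_nonneg _) (ContinuousLinearMap.norm_snd_le ℂ ℂ ℂ)

theorem HasJacobiExpansion.differentiableOn {φ : ℍ → ℂ → ℂ} {c : ℤ → ℤ → ℂ}
    (h : HasJacobiExpansion φ c) :
    DifferentiableOn ℂ (fun p : ℂ × ℂ => φ (UpperHalfPlane.ofComplex p.1) p.2)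
      {p | 0 < p.1.im} := by
  intro x₀ hx₀
  simp only [Set.mem_ofPred_eq] at hx₀
  set t := x₀.1.im with ht
  set s := x₀.2.im with hs
  -- The majorant uses the margin `2δ = t / 2 < t`: one `δ` covers the variation of the exponential
  -- over the ball, the other absorbs the linear factor produced by differentiation.
  set δ := t / 4 with hδ
  have hδ0 : 0 < δ := by positivity
  have him : ∀ x ∈ Metric.ball x₀ δ, |x.1.im - t| < δ ∧ |x.2.im - s| < δ := by
    intro x hx
    rw [Metric.mem_ball, dist_eq_norm, Prod.norm_def, max_lt_iff] at hx
    exact ⟨(Complex.abs_im_le_norm (x.1 - x₀.1)).trans_lt hx.1,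
      (Complex.abs_im_le_norm (x.2 - x₀.2)).trans_lt hx.2⟩
  have hpos : ∀ x ∈ Metric.ball x₀ δ, 0 < x.1.im := by
    intro x hx
    have := (abs_lt.1 (him x hx).1).1
    linarith
  set F : ℤ × ℤ → ℂ × ℂ → ℂ := fun p x => c p.1 p.2 * e (jacobiForm p x) with hF
  have hsum : ∀ x, 0 < x.1.im → HasSum (fun p => F p x) (φ (UpperHalfPlane.ofComplex x.1) x.2) := by
    intro x hx
    have h1 := h (UpperHalfPlane.ofComplex x.1) x.2
    rw [UpperHalfPlane.ofComplex_apply_of_im_pos hx] at h1 ⊢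
    simpa only [hF, jacobiForm_apply] using h1
  set F' : ℤ × ℤ → ℂ × ℂ → (ℂ × ℂ →L[ℂ] ℂ) := fun p x =>
    c p.1 p.2 • (2 * Real.pi * Complex.I * e (jacobiForm p x)) • jacobiForm p with hF'
  have hderiv : ∀ p x, HasFDerivAt (F p) (F' p x) x := by
    intro p x
    exact ((hasDerivAt_e (jacobiForm p x)).comp_hasFDerivAt x (jacobiForm p).hasFDerivAt).const_mul
      (c p.1 p.2)
  have hu := ((h.summable_mul_exp (t := t) (η := 2 * δ) (by positivity)
    (by rw [hδ]; linarith) s).mul_left (2 * Real.pi / δ))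
  have hbound : ∀ p, ∀ x ∈ Metric.ball x₀ δ, ‖F' p x‖ ≤ 2 * Real.pi / δ * (‖c p.1 p.2‖ *
      (jacobiNorm t s p * Real.exp (2 * Real.pi * (2 * δ) * (|(p.1 : ℝ)| + |(p.2 : ℝ)|)))) := by
    intro p x hx
    obtain ⟨h1, h2⟩ := him x hx
    set X := |(p.1 : ℝ)| + |(p.2 : ℝ)| with hX
    have hX0 : 0 ≤ X := by positivity
    have e1 : ‖e (jacobiForm p x)‖ ≤ jacobiNorm t s p * Real.exp (2 * Real.pi * δ * X) := by
      rw [jacobiForm_apply, norm_e_jacobi, jacobiNorm, jacobiNorm, ← Real.exp_add,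
        Real.exp_le_exp]
      have e2 : -((p.1 : ℝ) * (x.1.im - t)) ≤ |(p.1 : ℝ)| * δ := by
        refine (neg_le_abs _).trans ?_
        rw [abs_mul]
        gcongr
      have e3 : -((p.2 : ℝ) * (x.2.im - s)) ≤ |(p.2 : ℝ)| * δ := by
        refine (neg_le_abs _).trans ?_
        rw [abs_mul]
        gcongr
      have e4 := mul_le_mul_of_nonneg_left (add_le_add e2 e3)
        (show 0 ≤ 2 * Real.pi by positivity)
      rw [hX]
      linarith
    have e5 : X ≤ 1 / δ * Real.exp (2 * Real.pi * δ * X) := by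
      have e6 : δ * X ≤ Real.exp (2 * Real.pi * δ * X) := by
        have e7 := Real.add_one_le_exp (2 * Real.pi * δ * X)
        have e8 : δ * X ≤ 2 * Real.pi * (δ * X) := by
          have := Real.pi_gt_three
          have : 0 ≤ δ * X := by positivity
          nlinarith
        linarith
      rw [div_mul_eq_mul_div, one_mul, le_div_iff₀ hδ0]
      linarith
    have e9 : ‖(2 * Real.pi * Complex.I : ℂ)‖ = 2 * Real.pi := by
      simp [abs_of_pos Real.pi_pos]
    rw [hF']
    simp only
    rw [norm_smul, norm_smul, norm_mul, e9]
    calc ‖c p.1 p.2‖ * (2 * Real.pi * ‖e (jacobiForm p x)‖ * ‖jacobiForm p‖)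
        ≤ ‖c p.1 p.2‖ * (2 * Real.pi * (jacobiNorm t s p * Real.exp (2 * Real.pi * δ * X)) *
          (1 / δ * Real.exp (2 * Real.pi * δ * X))) := by
          gcongr
          · exact mul_nonneg (by positivity) (mul_nonneg (Real.exp_nonneg _) (Real.exp_nonneg _))
          · exact (norm_jacobiForm_le p).trans e5
      _ = _ := by
          rw [show 2 * Real.pi * (2 * δ) * X = 2 * Real.pi * δ * X + 2 * Real.pi * δ * X by ring,
            Real.exp_add]
          ring
  have hx₀mem : x₀ ∈ Metric.ball x₀ δ := Metric.mem_ball_self hδ0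
  have key := hasFDerivAt_tsum_of_isPreconnected hu Metric.isOpen_ball
    (convex_ball x₀ δ).isPreconnected (fun p x _ => hderiv p x) hbound hx₀mem
    (hsum x₀ hx₀).summable hx₀mem
  refine (key.congr_of_eventuallyEq ?_).differentiableAt.differentiableWithinAt
  filter_upwards [Metric.isOpen_ball.mem_nhds hx₀mem] with x hx
  exact (hsum x (hpos x hx)).tsum_eq.symm

/-- Arbitrary heights `t` and `s` are allowed because the Hecke bound chooses them according to `n`
and `r`. `jacobiCoeff` is the case `t = 1`, `s = 0`. -/
theorem HasJacobiExpansion.integral_eq {φ : ℍ → ℂ → ℂ} {c : ℤ → ℤ → ℂ}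
    (h : HasJacobiExpansion φ c) {t : ℝ} (ht : 0 < t) (s : ℝ) (n r : ℤ) :
    ∫ u in (0 : ℝ)..1, ∫ x in (0 : ℝ)..1,
      φ (UpperHalfPlane.ofComplex ((u : ℂ) + Complex.I * t)) (x + Complex.I * s) *
        e (-(n * ((u : ℂ) + Complex.I * t) + r * (x + Complex.I * s))) = c n r := by
  have hnorm : ∀ (m : ℤ) (u : ℝ), ‖e (m * u)‖ = 1 := by
    intro m u
    rw [norm_e]
    simp
  have hcont := continuous_e
  set d : ℤ × ℤ → ℂ := fun p => c p.1 p.2 *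
    e ((p.1 - n) * (Complex.I * t) + (p.2 - r) * (Complex.I * s)) with hd
  have hterm : ∀ (p : ℤ × ℤ) (u x : ℝ),
      c p.1 p.2 * e (p.1 * ((u : ℂ) + Complex.I * t) + p.2 * (x + Complex.I * s)) *
        e (-(n * ((u : ℂ) + Complex.I * t) + r * (x + Complex.I * s))) =
      d p * (e ((p.1 - n : ℤ) * u) * e ((p.2 - r : ℤ) * x)) := by
    intro p u x
    rw [hd, mul_assoc, mul_assoc, ← e_add, ← e_add, ← e_add]
    congr 2
    push_cast
    ring
  have hsum : ∀ u x : ℝ, HasSum (fun p => d p * (e ((p.1 - n : ℤ) * u) * e ((p.2 - r : ℤ) * x)))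
      (φ (UpperHalfPlane.ofComplex ((u : ℂ) + Complex.I * t)) (x + Complex.I * s) *
        e (-(n * ((u : ℂ) + Complex.I * t) + r * (x + Complex.I * s)))) := by
    intro u x
    have hpos : 0 < ((u : ℂ) + Complex.I * t).im := by simpa using ht
    have h1 := h (UpperHalfPlane.ofComplex ((u : ℂ) + Complex.I * t)) (x + Complex.I * s)
    rw [UpperHalfPlane.ofComplex_apply_of_im_pos hpos] at h1 ⊢
    refine (HasSum.mul_right (e (-(n * ((u : ℂ) + Complex.I * t) + r * (x + Complex.I * s))))
      h1).congr_fun fun p => ?_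
    exact (hterm p u x).symm
  have hd_summable : Summable fun p => ‖d p‖ := by
    have h1 := (hsum 0 0).summable.norm
    refine h1.congr fun p => ?_
    simp [e_zero]
  have hinner : ∀ u : ℝ, HasSum (fun p : ℤ × ℤ => d p * e ((p.1 - n : ℤ) * u) *
      (if p.2 - r = 0 then 1 else 0)) (∫ x in (0 : ℝ)..1,
      φ (UpperHalfPlane.ofComplex ((u : ℂ) + Complex.I * t)) (x + Complex.I * s) *
        e (-(n * ((u : ℂ) + Complex.I * t) + r * (x + Complex.I * s)))) := by
    intro u
    have h1 := intervalIntegral.hasSum_integral_of_dominated_convergence (μ := volume) (a := 0)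
      (b := 1) (F := fun (p : ℤ × ℤ) (x : ℝ) =>
        d p * (e ((p.1 - n : ℤ) * u) * e ((p.2 - r : ℤ) * x)))
      (fun p _ => ‖d p‖) (fun p => ?_) (fun p => ?_) ?_ ?_
      (Filter.Eventually.of_forall fun x _ => hsum u x)
    · refine h1.congr_fun fun p => ?_
      rw [← integral_e_int, ← intervalIntegral.integral_const_mul]
      simp only [mul_assoc]
    · exact Continuous.aestronglyMeasurable (by fun_prop)
    · exact Filter.Eventually.of_forall fun x _ => by
        rw [norm_mul (d p), norm_mul (e _) (e _), hnorm, hnorm, mul_one, mul_one]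
    · exact Filter.Eventually.of_forall fun x _ => hd_summable
    · exact intervalIntegrable_const
  have houter := intervalIntegral.hasSum_integral_of_dominated_convergence (μ := volume) (a := 0)
      (b := 1) (F := fun (p : ℤ × ℤ) (u : ℝ) => d p * e ((p.1 - n : ℤ) * u) *
        (if p.2 - r = 0 then 1 else 0))
      (fun p _ => ‖d p‖) (fun p => ?_) (fun p => ?_) ?_ ?_
      (Filter.Eventually.of_forall fun u _ => hinner u)
  · have h2 : HasSum (fun p : ℤ × ℤ => if p = (n, r) then c n r else 0) (∫ u in (0 : ℝ)..1,
        ∫ x in (0 : ℝ)..1,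
        φ (UpperHalfPlane.ofComplex ((u : ℂ) + Complex.I * t)) (x + Complex.I * s) *
        e (-(n * ((u : ℂ) + Complex.I * t) + r * (x + Complex.I * s)))) := by
      refine houter.congr_fun fun p => ?_
      rw [intervalIntegral.integral_mul_const, intervalIntegral.integral_const_mul,
        integral_e_int]
      by_cases hp : p = (n, r)
      · subst hp
        simp [hd, e_zero]
      · rw [if_neg hp]
        have : ¬ (p.1 - n = 0 ∧ p.2 - r = 0) := by
          rintro ⟨h3, h4⟩
          exact hp (Prod.ext (sub_eq_zero.1 h3) (sub_eq_zero.1 h4))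
        by_cases h3 : p.1 - n = 0
        · have h4 : ¬ p.2 - r = 0 := fun h4 => this ⟨h3, h4⟩
          rw [if_neg h4, mul_zero]
        · rw [if_neg h3, mul_zero, zero_mul]
    exact h2.unique (hasSum_ite_eq (n, r) (c n r))
  · exact Continuous.aestronglyMeasurable (by fun_prop)
  · refine Filter.Eventually.of_forall fun x _ => ?_
    rw [norm_mul, norm_mul, hnorm, mul_one]
    split_ifs <;> simp
  · exact Filter.Eventually.of_forall fun x _ => hd_summable
  · exact intervalIntegrable_const

theorem HasJacobiExpansion.jacobiCoeff_eq {φ : ℍ → ℂ → ℂ} {c : ℤ → ℤ → ℂ}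
    (h : HasJacobiExpansion φ c) (n r : ℤ) : jacobiCoeff φ n r = c n r := by
  rw [← h.integral_eq one_pos 0 n r, jacobiCoeff]
  simp

/-- Coefficients are controlled by the values on a horizontal plane. -/
theorem HasJacobiExpansion.norm_le {φ : ℍ → ℂ → ℂ} {c : ℤ → ℤ → ℂ}
    (h : HasJacobiExpansion φ c) {t : ℝ} (ht : 0 < t) (s : ℝ) {B : ℝ}
    (hB : ∀ (τ : ℍ) (z : ℂ), τ.im = t → z.im = s → ‖φ τ z‖ ≤ B) (n r : ℤ) :
    ‖c n r‖ ≤ B * Real.exp (2 * Real.pi * (n * t + r * s)) := by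
  rw [← h.integral_eq ht s n r]
  have h1 : ∀ u x : ℝ,
      ‖φ (UpperHalfPlane.ofComplex ((u : ℂ) + Complex.I * t)) (x + Complex.I * s) *
        e (-(n * ((u : ℂ) + Complex.I * t) + r * (x + Complex.I * s)))‖ ≤
      B * Real.exp (2 * Real.pi * (n * t + r * s)) := by
    intro u x
    have hpos : 0 < ((u : ℂ) + Complex.I * t).im := by simpa using ht
    have h2 := hB (UpperHalfPlane.ofComplex ((u : ℂ) + Complex.I * t)) (x + Complex.I * s)
      (by rw [UpperHalfPlane.ofComplex_apply_of_im_pos hpos]; simp [UpperHalfPlane.im])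
      (by simp)
    rw [norm_mul, norm_e]
    have h3 : -(2 * Real.pi *
        (-((n : ℂ) * ((u : ℂ) + Complex.I * t) + r * (x + Complex.I * s))).im) =
        2 * Real.pi * (n * t + r * s) := by
      simp
      ring
    rw [h3]
    gcongr
  have h4 := intervalIntegral.norm_integral_le_of_norm_le_const (a := 0) (b := 1)
    (C := B * Real.exp (2 * Real.pi * (n * t + r * s)))
    (f := fun u : ℝ => ∫ x in (0 : ℝ)..1,
      φ (UpperHalfPlane.ofComplex ((u : ℂ) + Complex.I * t)) (x + Complex.I * s) *
        e (-(n * ((u : ℂ) + Complex.I * t) + r * (x + Complex.I * s)))) (fun u _ => by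
      have := intervalIntegral.norm_integral_le_of_norm_le_const (a := 0) (b := 1)
        (fun x _ => h1 u x)
      simpa using this)
  simpa using h4

end

section

open Matrix

/-! ### Growth of the coefficients of Jacobi cusp forms -/

theorem isSimilitude_of_mem_jacobiGroup {γ : Matrix (Fin 2 ⊕ Fin 2) (Fin 2 ⊕ Fin 2) ℤ}
    (h : γ ∈ jacobiGroup) : IsSimilitude 1 (toRat γ) :=
  .of_mem (SymplecticGroup.map_mem (f := Int.castRingHom ℚ) h.1)

/-- An invariant function has an invariant Petersson norm. -/
theorem petersson_invariant {k : ℕ} {F : siegelSet → ℂ} {γ : Mat4} (hγ : IsSimilitude 1 γ)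
    (hF : slash k γ F = F) (Ω : siegelSet) :
    ‖F Ω‖ ^ 2 * (Ω.1.map Complex.im).det ^ k =
      ‖F ⟨act γ Ω.1, hγ.act_mem Ω.2⟩‖ ^ 2 * ((act γ Ω.1).map Complex.im).det ^ k := by
  have h1 := hγ.det_im_act Ω.2
  have h2 := congrFun hF Ω
  rw [hγ.slash_apply] at h2
  have h3 : ‖(denom γ Ω.1).det‖ ≠ 0 := norm_ne_zero_iff.2 (hγ.isUnit_det_denom Ω.2).ne_zero
  simp only [Rat.cast_one, one_pow, one_mul] at h1
  simp only [Rat.cast_one, _root_.one_zpow, one_mul] at h2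
  rw [← h1, ← h2, norm_mul, norm_zpow, _root_.zpow_neg, zpow_natCast]
  field_simp
  ring

/-- The embedding of `SL₂`. -/
def slEmb (g : SpecialLinearGroup (Fin 2) ℤ) : Matrix (Fin 2 ⊕ Fin 2) (Fin 2 ⊕ Fin 2) ℤ :=
  fromBlocks !![g 0 0, 0; 0, 1] !![g 0 1, 0; 0, 0] !![g 1 0, 0; 0, 0] !![g 1 1, 0; 0, 1]

theorem slEmb_mem (g : SpecialLinearGroup (Fin 2) ℤ) : slEmb g ∈ jacobiGroup := by
  have hdet : g 0 0 * g 1 1 - g 0 1 * g 1 0 = 1 := by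
    rw [← det_fin_two]; exact g.2
  refine ⟨?_, by simp [slEmb], by simp [slEmb], by simp [slEmb], by simp [slEmb], by simp [slEmb]⟩
  rw [SymplecticGroup.mem_iff, slEmb, J, fromBlocks_transpose, fromBlocks_multiply,
    fromBlocks_multiply]
  congr 1 <;> ext i j <;> fin_cases i <;> fin_cases j <;>
    simp [vecMul, dotProduct, Fin.sum_univ_two] <;> linarith

/-- Translation by the multiple `l` of the period `τ`. -/
def heisenberg (l : ℤ) : Matrix (Fin 2 ⊕ Fin 2) (Fin 2 ⊕ Fin 2) ℤ :=
  fromBlocks !![1, 0; l, 1] 0 0 !![1, -l; 0, 1]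

theorem heisenberg_mem (l : ℤ) : heisenberg l ∈ jacobiGroup := by
  refine ⟨?_, by simp [heisenberg], by simp [heisenberg], by simp [heisenberg],
    by simp [heisenberg], by simp [heisenberg]⟩
  rw [SymplecticGroup.mem_iff, heisenberg, J, fromBlocks_transpose, fromBlocks_multiply,
    fromBlocks_multiply]
  congr 1 <;> ext i j <;> fin_cases i <;> fin_cases j <;>
    simp [vecMul, dotProduct, Fin.sum_univ_two]

theorem act_mul_denom {γ : Mat4} {Ω : Matrix (Fin 2) (Fin 2) ℂ} (h : IsUnit (denom γ Ω).det) :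
    act γ Ω * denom γ Ω = numer γ Ω := by
  rw [act_eq, nonsing_inv_mul_cancel_right _ _ h]

theorem denom_slEmb (g : SpecialLinearGroup (Fin 2) ℤ) (Ω : Matrix (Fin 2) (Fin 2) ℂ) :
    denom (toRat (slEmb g)) Ω = !![g 1 0 * Ω 0 0 + g 1 1, g 1 0 * Ω 0 1; 0, 1] := by
  ext i j
  fin_cases i <;> fin_cases j <;>
    simp [denom, toRat, slEmb, toBlocks₂₁, toBlocks₂₂, Matrix.mul_apply, Fin.sum_univ_two]

theorem numer_slEmb_zero (g : SpecialLinearGroup (Fin 2) ℤ) (Ω : Matrix (Fin 2) (Fin 2) ℂ) :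
    numer (toRat (slEmb g)) Ω 0 0 = g 0 0 * Ω 0 0 + g 0 1 := by
  simp [numer, toRat, slEmb, toBlocks₁₁, toBlocks₁₂, Matrix.mul_apply, Fin.sum_univ_two]

theorem act_slEmb {g : SpecialLinearGroup (Fin 2) ℤ} {Ω : Matrix (Fin 2) (Fin 2) ℂ}
    (h : Ω ∈ siegelSet) {τ : ℍ} (hτ : (τ : ℂ) = Ω 0 0) :
    act (toRat (slEmb g)) Ω 0 0 = (g • τ : ℍ) := by
  have hu := (isSimilitude_of_mem_jacobiGroup (slEmb_mem g)).isUnit_det_denom h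
  have h1 := congrFun (congrFun (act_mul_denom hu) 0) 0
  have h2 := hu.ne_zero
  rw [denom_slEmb, det_fin_two_of, mul_one, mul_zero, sub_zero] at h2
  rw [numer_slEmb_zero, denom_slEmb, Matrix.mul_apply, Fin.sum_univ_two] at h1
  simp at h1
  rw [UpperHalfPlane.coe_specialLinearGroup_apply, hτ]
  simp only [algebraMap_int_eq, eq_intCast, Complex.ofReal_intCast]
  rw [eq_div_iff h2, h1]

theorem act_heisenberg (l : ℤ) {Ω : Matrix (Fin 2) (Fin 2) ℂ} (h : Ω ∈ siegelSet) :
    act (toRat (heisenberg l)) Ω 0 0 = Ω 0 0 ∧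
    act (toRat (heisenberg l)) Ω 0 1 = Ω 0 1 + l * Ω 0 0 ∧
    (denom (toRat (heisenberg l)) Ω).det = 1 := by
  have hs := isSimilitude_of_mem_jacobiGroup (heisenberg_mem l)
  have hu := hs.isUnit_det_denom h
  have hd : denom (toRat (heisenberg l)) Ω = !![1, -(l : ℂ); 0, 1] := by
    ext i j
    fin_cases i <;> fin_cases j <;>
      simp [denom, toRat, heisenberg, toBlocks₂₁, toBlocks₂₂, Matrix.mul_apply]
  have h1 := act_mul_denom hu
  have h00 := congrFun (congrFun h1 0) 0
  have h01 := congrFun (congrFun h1 0) 1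
  rw [hd] at h00 h01
  rw [Matrix.mul_apply, Fin.sum_univ_two] at h00 h01
  have hn0 : numer (toRat (heisenberg l)) Ω 0 0 = Ω 0 0 := by
    simp [numer, toRat, heisenberg, toBlocks₁₁, toBlocks₁₂, Matrix.mul_apply]
  have hn1 : numer (toRat (heisenberg l)) Ω 0 1 = Ω 0 1 := by
    simp [numer, toRat, heisenberg, toBlocks₁₁, toBlocks₁₂, Matrix.mul_apply]
  rw [hn0] at h00
  rw [hn1] at h01
  simp only [of_apply, cons_val', cons_val_zero, cons_val_one, cons_val_fin_one, mul_one, mul_zero,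
    add_zero] at h00 h01
  refine ⟨h00, ?_, by rw [hd, det_fin_two_of]; ring⟩
  rw [h00] at h01
  linear_combination h01

theorem one_half_le_im_of_mem_fd {τ : ℍ} (h : τ ∈ ModularGroup.fd) : 1 / 2 ≤ τ.im := by
  have h1 := ModularGroup.three_le_four_mul_im_sq_of_mem_fd h
  nlinarith [τ.im_pos]

/-- Reduction to a Siegel domain of the Jacobi group. -/
theorem exists_petersson_eq {k : ℕ} {F : siegelSet → ℂ}
    (hF : ∀ γ ∈ jacobiGroup, slash k (toRat γ) F = F) (Ω : siegelSet)
    -- The free last coordinate is fixed by `Im ω = (Im z)² / Im τ + 1`. The Jacobi group preserves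
    -- this normalisation.
    (hΩ : (Ω.1.map Complex.im).det = (Ω.1 0 0).im) :
    ∃ Ω' : siegelSet, (Ω'.1.map Complex.im).det = (Ω'.1 0 0).im ∧ 1 / 2 ≤ (Ω'.1 0 0).im ∧
      0 ≤ (Ω'.1 0 1).im ∧ (Ω'.1 0 1).im ≤ (Ω'.1 0 0).im ∧
      ‖F Ω‖ ^ 2 * (Ω.1.map Complex.im).det ^ k =
        ‖F Ω'‖ ^ 2 * (Ω'.1.map Complex.im).det ^ k := by
  obtain ⟨-, hpos, -⟩ := mem_siegelSet_iff.1 Ω.2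
  set τ : ℍ := ⟨Ω.1 0 0, hpos⟩ with hτ
  obtain ⟨g, hg⟩ := ModularGroup.exists_smul_mem_fd τ
  have hs := isSimilitude_of_mem_jacobiGroup (slEmb_mem g)
  set Ω₁ : siegelSet := ⟨act (toRat (slEmb g)) Ω.1, hs.act_mem Ω.2⟩ with hΩ₁
  have h00 : Ω₁.1 0 0 = (g • τ : ℍ) := act_slEmb Ω.2 rfl
  have ht₁ : 1 / 2 ≤ (Ω₁.1 0 0).im := by
    rw [h00]; exact one_half_le_im_of_mem_fd hg
  have hdet₁ : (Ω₁.1.map Complex.im).det = (Ω₁.1 0 0).im := by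
    have h1 := hs.det_im_act Ω.2
    have h3 : ‖(denom (toRat (slEmb g)) Ω.1).det‖ ≠ 0 :=
      norm_ne_zero_iff.2 (hs.isUnit_det_denom Ω.2).ne_zero
    have h2 : ((g • τ : ℍ) : ℂ).im = τ.im / ‖(denom (toRat (slEmb g)) Ω.1).det‖ ^ 2 := by
      rw [UpperHalfPlane.coe_im, ModularGroup.im_smul_eq_div_normSq, Complex.normSq_eq_norm_sq,
        ModularGroup.denom_apply, denom_slEmb, det_fin_two_of, mul_one, mul_zero, sub_zero]
    rw [h00, h2, eq_div_iff (pow_ne_zero 2 h3), h1, hΩ]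
    simp only [Rat.cast_one, one_pow, one_mul]
    rfl
  set t := (Ω₁.1 0 0).im with ht
  have htpos : 0 < t := by linarith
  -- Once `τ` lies in the fundamental domain, translating `z` by `lτ` brings `Im z` into `[0, t]`
  -- without moving `τ`.
  set l : ℤ := -⌊(Ω₁.1 0 1).im / t⌋ with hl
  have hs₂ := isSimilitude_of_mem_jacobiGroup (heisenberg_mem l)
  obtain ⟨h00', h01', hdet'⟩ := act_heisenberg l Ω₁.2
  have him : (Ω₁.1 0 1 + l * Ω₁.1 0 0).im = (Ω₁.1 0 1).im - ⌊(Ω₁.1 0 1).im / t⌋ * t := by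
    rw [Complex.add_im, Complex.mul_im, Complex.intCast_re, Complex.intCast_im, zero_mul, add_zero,
      hl]
    push_cast
    ring
  refine ⟨⟨act (toRat (heisenberg l)) Ω₁.1, hs₂.act_mem Ω₁.2⟩, ?_, ?_, ?_, ?_, ?_⟩
  · have h1 := hs₂.det_im_act Ω₁.2
    rw [hdet'] at h1
    simp only [norm_one, Rat.cast_one, one_pow, one_mul, mul_one] at h1
    exact (h1.trans hdet₁).trans (congrArg Complex.im h00'.symm)
  · exact ht₁.trans_eq (congrArg Complex.im h00'.symm)
  · refine le_of_le_of_eq ?_ (congrArg Complex.im h01'.symm)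
    rw [him, sub_nonneg, ← le_div_iff₀ htpos]
    exact Int.floor_le _
  · refine le_of_eq_of_le (congrArg Complex.im h01')
      (le_of_le_of_eq ?_ (congrArg Complex.im h00'.symm))
    rw [him, sub_le_iff_le_add, ← one_add_mul, ← div_le_iff₀ htpos, add_comm]
    exact (Int.lt_floor_add_one _).le
  · rw [petersson_invariant hs (hF _ (slEmb_mem g)),
      petersson_invariant hs₂ (hF _ (heisenberg_mem l)) Ω₁]

theorem pow_mul_exp_neg_le {a t : ℝ} (ha : 0 < a) (ht : 0 ≤ t) (k : ℕ) :
    t ^ k * Real.exp (-(a * t)) ≤ k.factorial / a ^ k := by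
  have h1 := Real.pow_div_factorial_le_exp (a * t) (by positivity) k
  rw [Real.exp_neg, ← div_eq_mul_inv, div_le_div_iff₀ (Real.exp_pos _) (by positivity), ← mul_pow,
    mul_comm t]
  rwa [div_le_iff₀ (by positivity), mul_comm (Real.exp _)] at h1

/-- With `x = Im z / t`, each term has exponent `-2πtQ`, where `Q = n + rx + mx²` and `4mQ = (4mn -
r²) + (r + 2mx)² ≥ 1` by cuspidality. Part of this exponent gives decay in `t`, the rest a
convergent series independent of `τ` and `z`. -/
theorem norm_jacobi_le {φ : ℍ → ℂ → ℂ} {c : ℤ → ℤ → ℂ} (h : HasJacobiExpansion φ c) {m : ℕ}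
    (hm : 0 < m) (hc : ∀ n r, c n r ≠ 0 → 0 ≤ n ∧ 0 < 4 * (m : ℤ) * n - r ^ 2) (τ : ℍ) (z : ℂ)
    (hτ : 1 / 2 ≤ τ.im) (h0 : 0 ≤ z.im) (h1 : z.im ≤ τ.im) :
    ‖φ τ z‖ * Real.exp (-(2 * Real.pi * m * (z.im ^ 2 / τ.im))) ≤
      (∑' p : ℤ × ℤ, ‖c p.1 p.2‖ * (jacobiNorm (1 / 4) 0 p + jacobiNorm (1 / 4) (1 / 4) p)) *
        Real.exp (-(Real.pi / (4 * m) * τ.im)) := by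
  have hpi := Real.pi_pos
  have ht := τ.im_pos
  set t := τ.im with ht'
  obtain ⟨x, hx⟩ : ∃ x, x = z.im / t := ⟨_, rfl⟩
  have hz : z.im = x * t := by rw [hx]; field_simp
  have hx0 : 0 ≤ x := by rw [hx]; positivity
  have hx1 : x ≤ 1 := by rw [hx]; exact (div_le_one ht).2 h1
  have hm' : (0 : ℝ) < m := by exact_mod_cast hm
  have hS : Summable fun p : ℤ × ℤ =>
      ‖c p.1 p.2‖ * (jacobiNorm (1 / 4) 0 p + jacobiNorm (1 / 4) (1 / 4) p) := by
    simp only [mul_add]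
    exact (h.summable (by norm_num) _).add (h.summable (by norm_num) _)
  have hle : ‖φ τ z‖ ≤ ∑' p : ℤ × ℤ, ‖c p.1 p.2‖ * jacobiNorm t z.im p := by
    rw [← (h τ z).tsum_eq]
    refine (norm_tsum_le_tsum_norm (h τ z).summable.norm).trans_eq (tsum_congr fun p => ?_)
    rw [norm_mul, norm_e_jacobi]
    rfl
  refine (mul_le_mul_of_nonneg_right hle (Real.exp_nonneg _)).trans ?_
  rw [← tsum_mul_right, ← tsum_mul_right]
  refine Summable.tsum_le_tsum (fun p => ?_) ((h.summable ht _).mul_right _) (hS.mul_right _)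
  rw [mul_assoc ‖c p.1 p.2‖, mul_assoc ‖c p.1 p.2‖]
  by_cases hp : c p.1 p.2 = 0
  · rw [hp]; simp
  refine mul_le_mul_of_nonneg_left ?_ (norm_nonneg _)
  obtain ⟨-, hD⟩ := hc _ _ hp
  have hD' : (1 : ℝ) ≤ 4 * m * p.1 - p.2 ^ 2 := by exact_mod_cast hD
  set Q : ℝ := p.1 + p.2 * x + m * x ^ 2 with hQ
  have hQ1 : 1 / (4 * m) ≤ Q := by
    rw [div_le_iff₀ (by positivity), hQ]
    nlinarith [sq_nonneg (p.2 + 2 * m * x)]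
  have e1 : jacobiNorm t z.im p * Real.exp (-(2 * Real.pi * m * (z.im ^ 2 / t))) =
      Real.exp (-(2 * Real.pi * t * Q)) := by
    rw [jacobiNorm, ← Real.exp_add, hz, hQ]
    congr 1
    field_simp
    ring
  have e2 : Real.exp (-(2 * Real.pi * t * Q)) ≤
      Real.exp (-(Real.pi / 2 * (p.1 + p.2 * x))) * Real.exp (-(Real.pi / (4 * m) * t)) := by
    rw [← Real.exp_add, Real.exp_le_exp]
    -- Of `tQ` the part `Q / 4` is kept for convergence. As `t ≥ 1/2`, the remainder has factor `t -
    -- 1/4 ≥ t / 2`.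
    have e3 : t / 2 * (1 / (4 * m)) ≤ (t - 1 / 4) * Q := by
      apply mul_le_mul _ hQ1 (by positivity) (by linarith)
      linarith
    have e4 : (0 : ℝ) ≤ 1 / 4 * (m * x ^ 2) := by positivity
    have e5 := mul_le_mul_of_nonneg_left (add_le_add e3 e4) (show 0 ≤ 2 * Real.pi by positivity)
    have e6 : Real.pi / (4 * m) * t = 2 * Real.pi * (t / 2 * (1 / (4 * m))) := by
      field_simp
    rw [e6]
    have e7 : 2 * Real.pi * ((t - 1 / 4) * Q + 1 / 4 * (m * x ^ 2)) =
      2 * Real.pi * t * Q - Real.pi / 2 * (p.1 + p.2 * x) +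
        (Real.pi / 2 * (m * x ^ 2) - Real.pi / 2 * (m * x ^ 2)) := by
      rw [hQ]; ring
    nlinarith [e5, e7]
  -- For `0 ≤ x ≤ 1` the linear function `n + rx` is at least its smaller endpoint value, `n` or `n
  -- + r`.
  have e8 : Real.exp (-(Real.pi / 2 * (p.1 + p.2 * x))) ≤
      jacobiNorm (1 / 4) 0 p + jacobiNorm (1 / 4) (1 / 4) p := by
    simp only [jacobiNorm]
    rcases le_total 0 (p.2 : ℝ) with hr | hr
    · refine le_trans (Real.exp_le_exp.2 ?_) (le_add_of_nonneg_right (Real.exp_nonneg _))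
      have : 0 ≤ Real.pi / 2 * (p.2 * x) := by positivity
      linarith
    · refine le_trans (Real.exp_le_exp.2 ?_) (le_add_of_nonneg_left (Real.exp_nonneg _))
      have : 0 ≤ Real.pi / 2 * (-p.2 * (1 - x)) :=
        mul_nonneg (by positivity) (mul_nonneg (by linarith) (by linarith))
      linarith
  rw [e1]
  exact e2.trans (mul_le_mul_of_nonneg_right e8 (Real.exp_nonneg _))

theorem det_map_im {Ω : Matrix (Fin 2) (Fin 2) ℂ} (h : Ω ∈ siegelSet) :
    (Ω.map Complex.im).det = (Ω 0 0).im * (Ω 1 1).im - (Ω 0 1).im ^ 2 := by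
  rw [det_fin_two, map_apply, map_apply, map_apply, map_apply, ← (mem_siegelSet_iff.1 h).1]
  ring

theorem norm_jacobiToSiegel {m : ℕ} (φ : ℍ → ℂ → ℂ) (Ω : siegelSet) :
    ‖jacobiToSiegel m φ Ω‖ = ‖φ (UpperHalfPlane.ofComplex (Ω.1 0 0)) (Ω.1 0 1)‖ *
      Real.exp (-(2 * Real.pi * m * (Ω.1 1 1).im)) := by
  rw [jacobiToSiegel, norm_mul, norm_e]
  congr 2
  simp
  ring

theorem IsJacobiCuspForm.exists_petersson_le {k m : ℕ} (hm : 0 < m) {φ : ℍ → ℂ → ℂ}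
    (h : IsJacobiCuspForm k m φ) :
    ∃ C : ℝ, ∀ Ω : siegelSet, (Ω.1.map Complex.im).det = (Ω.1 0 0).im →
      ‖jacobiToSiegel m φ Ω‖ ^ 2 * (Ω.1 0 0).im ^ k ≤ C := by
  obtain ⟨c, hc, hsupp⟩ := h.expansion
  have hpi := Real.pi_pos
  have hm' : (0 : ℝ) < m := by exact_mod_cast hm
  set S := ∑' p : ℤ × ℤ, ‖c p.1 p.2‖ * (jacobiNorm (1 / 4) 0 p + jacobiNorm (1 / 4) (1 / 4) p)
    with hS
  refine ⟨S ^ 2 * (k.factorial / (Real.pi / (2 * m)) ^ k), fun Ω hΩ => ?_⟩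
  obtain ⟨Ω', hdet, h2, h3, h4, heq⟩ := exists_petersson_eq h.invariant Ω hΩ
  rw [← hΩ, heq, hdet]
  have hpos : 0 < (Ω'.1 0 0).im := by linarith
  set t := (Ω'.1 0 0).im with ht
  have hω : (Ω'.1 1 1).im = (Ω'.1 0 1).im ^ 2 / t + 1 := by
    rw [det_map_im Ω'.2] at hdet
    field_simp
    linarith
  have h5 := norm_jacobi_le hc hm hsupp (UpperHalfPlane.ofComplex (Ω'.1 0 0)) (Ω'.1 0 1)
  have h6 : (UpperHalfPlane.ofComplex (Ω'.1 0 0)).im = t := by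
    rw [UpperHalfPlane.ofComplex_apply_of_im_pos hpos]; rfl
  rw [h6] at h5
  have h7 : ‖jacobiToSiegel m φ Ω'‖ ≤ S * Real.exp (-(Real.pi / (4 * m) * t)) := by
    refine le_trans ?_ (h5 h2 h3 h4)
    rw [norm_jacobiToSiegel, hω]
    refine mul_le_mul_of_nonneg_left (Real.exp_le_exp.2 ?_) (norm_nonneg _)
    have : 0 ≤ 2 * Real.pi * m := by positivity
    linarith
  calc ‖jacobiToSiegel m φ Ω'‖ ^ 2 * t ^ k
      ≤ (S * Real.exp (-(Real.pi / (4 * m) * t))) ^ 2 * t ^ k := by gcongr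
    _ = S ^ 2 * (t ^ k * Real.exp (-(Real.pi / (2 * m) * t))) := by
        rw [mul_pow, ← Real.exp_nat_mul, show ((2 : ℕ) : ℝ) * -(Real.pi / (4 * m) * t) =
          -(Real.pi / (2 * m) * t) by push_cast; field_simp; ring]
        ring
    _ ≤ _ := by
        refine mul_le_mul_of_nonneg_left (pow_mul_exp_neg_le (by positivity) hpos.le k)
          (sq_nonneg _)

/-- The Hecke bound. -/
theorem IsJacobiCuspForm.exists_coeff_le {k m : ℕ} (hm : 0 < m) {φ : ℍ → ℂ → ℂ}
    (h : IsJacobiCuspForm k m φ) {c : ℤ → ℤ → ℂ} (hc : HasJacobiExpansion φ c) :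
    ∃ C : ℝ, ∀ n r : ℤ, 0 < 4 * (m : ℤ) * n - r ^ 2 →
      ‖c n r‖ ^ 2 ≤ C * (4 * m * n - r ^ 2 : ℝ) ^ k := by
  obtain ⟨C, hC⟩ := h.exists_petersson_le hm
  have hpi := Real.pi_pos
  have hm' : (0 : ℝ) < m := by exact_mod_cast hm
  refine ⟨C * Real.exp (4 * Real.pi * m + Real.pi / m), fun n r hD => ?_⟩
  have hD' : (0 : ℝ) < 4 * m * n - r ^ 2 := by exact_mod_cast hD
  set D : ℝ := 4 * m * n - r ^ 2 with hDdef
  -- At height `t = 1/D` this `s` minimises `nt + rs + ms²/t`, with minimum `1 / (4m)`. The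
  -- exponential factors thus stay bounded and only `D ^ k` remains.
  set s : ℝ := -(r / (2 * m * D)) with hs
  set X : ℝ := C * D ^ k * Real.exp (4 * Real.pi * m * (s ^ 2 * D + 1)) with hX
  have hbound : ∀ (τ : ℍ) (z : ℂ), τ.im = 1 / D → z.im = s → ‖φ τ z‖ ≤ √X := by
    intro τ z hτ hz
    have hmem : symMat τ z (Complex.I * ((s ^ 2 * D + 1 : ℝ) : ℂ)) ∈ siegelSet := by
      rw [symMat_mem_siegelSet_iff]
      simp only [Complex.mul_im, Complex.I_re, Complex.I_im, Complex.ofReal_re, Complex.ofReal_im,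
        zero_mul, one_mul, zero_add, UpperHalfPlane.coe_im]
      refine ⟨τ.im_pos, ?_⟩
      rw [hτ, hz]
      field_simp
      linarith
    have h1 := hC ⟨_, hmem⟩ (by
      rw [det_map_im hmem]
      simp only [symMat, of_apply, cons_val', cons_val_zero, cons_val_one, cons_val_fin_one,
        Complex.mul_im, Complex.I_re, Complex.I_im, Complex.ofReal_re, Complex.ofReal_im,
        zero_mul, one_mul, zero_add, UpperHalfPlane.coe_im]
      rw [hτ, hz]
      field_simp
      ring)
    rw [norm_jacobiToSiegel] at h1
    simp only [symMat, of_apply, cons_val', cons_val_zero, cons_val_one, cons_val_fin_one,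
        Complex.mul_im, Complex.I_re, Complex.I_im, Complex.ofReal_re, Complex.ofReal_im,
        zero_mul, one_mul, zero_add, UpperHalfPlane.coe_im, UpperHalfPlane.ofComplex_apply] at h1
    rw [hτ, one_div, inv_pow, ← div_eq_mul_inv, div_le_iff₀ (by positivity), mul_pow,
      ← Real.exp_nat_mul] at h1
    refine Real.le_sqrt_of_sq_le ?_
    rw [hX, ← div_le_iff₀ (Real.exp_pos _), div_eq_mul_inv, ← Real.exp_neg]
    refine le_trans (le_of_eq ?_) h1
    congr 2
    push_cast
    ring
  have h2 := hc.norm_le (show 0 < 1 / D by positivity) s hbound n r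
  have hX0 : 0 ≤ X := by
    have hC0 : 0 ≤ C := by
      have hmem : symMat Complex.I 0 Complex.I ∈ siegelSet := by
        rw [symMat_mem_siegelSet_iff]; simp
      refine le_trans ?_ (hC ⟨_, hmem⟩ ?_)
      · simp only [symMat, of_apply, cons_val', cons_val_zero, cons_val_fin_one, Complex.I_im]
        positivity
      · rw [det_map_im hmem]; simp [symMat]
    positivity
  calc ‖c n r‖ ^ 2 ≤ (√X * Real.exp (2 * Real.pi * (n * (1 / D) + r * s))) ^ 2 := by gcongr
    _ = C * D ^ k * (Real.exp (4 * Real.pi * m * (s ^ 2 * D + 1)) *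
        Real.exp ((2 : ℕ) * (2 * Real.pi * (n * (1 / D) + r * s)))) := by
        rw [mul_pow, Real.sq_sqrt hX0, ← Real.exp_nat_mul, hX]
        ring
    _ = _ := by
        rw [← Real.exp_add, mul_right_comm]
        congr 3
        rw [hs]
        push_cast
        field_simp
        rw [hDdef]
        ring

end

section

open Matrix

/-! ### The Gritsenko lift -/

/-- The Fourier coefficients of the Gritsenko lift in terms of those of the Jacobi form. -/
def liftCoeff (k : ℕ) (c : ℤ → ℤ → ℤ) (m r n : ℤ) : ℤ :=
  ∑ δ ∈ (Nat.gcd (Int.gcd n r) m.natAbs).divisors,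
    (δ : ℤ) ^ (k - 1) * c (m * n / (δ : ℤ) ^ 2) (r / (δ : ℤ))

theorem gritsenkoCoeff_eq (k : ℕ) {φ : ℍ → ℂ → ℂ} {c : ℤ → ℤ → ℤ}
    (h : HasJacobiExpansion φ (fun n r => (c n r : ℂ))) (m r n : ℤ) :
    gritsenkoCoeff k φ m r n = liftCoeff k c m r n := by
  rw [gritsenkoCoeff, liftCoeff]
  push_cast
  simp only [h.jacobiCoeff_eq]

/-- Fermat, with `qk - 1 = (k - 1) + (q - 1)k`. When `q ∣ x` both sides vanish because `k ≥ 2` makes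
the exponents positive. -/
theorem pow_modEq_pow_mul {q k : ℕ} (hq : q.Prime) (hk : 2 ≤ k) (x : ℤ) :
    x ^ (k - 1) ≡ x ^ (q * k - 1) [ZMOD q] := by
  have : Fact q.Prime := ⟨hq⟩
  rw [← ZMod.intCast_eq_intCast_iff]
  push_cast
  obtain ⟨k, rfl⟩ : ∃ j, k = j + 2 := ⟨k - 2, by omega⟩
  obtain ⟨q', rfl⟩ : ∃ j, q = j + 1 := ⟨q - 1, by have := hq.pos; omega⟩
  rw [show (q' + 1) * (k + 2) - 1 = (k + 2 - 1) + q' * (k + 2) by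
    have : (q' + 1) * (k + 2) = q' * (k + 2) + (k + 2) := by ring
    omega]
  by_cases hx : (x : ZMod (q' + 1)) = 0
  · rw [hx, zero_pow (by omega), zero_pow (by omega)]
  · have h1 := ZMod.pow_card_sub_one_eq_one hx
    rw [Nat.add_sub_cancel] at h1
    rw [pow_add, pow_mul, h1, one_pow, mul_one]

theorem sum_modEq {ι : Type*} (s : Finset ι) {f g : ι → ℤ} {q : ℤ}
    (h : ∀ i ∈ s, f i ≡ g i [ZMOD q]) : ∑ i ∈ s, f i ≡ ∑ i ∈ s, g i [ZMOD q] := by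
  rw [Int.modEq_iff_dvd, ← Finset.sum_sub_distrib]
  exact Finset.dvd_sum fun i hi => Int.modEq_iff_dvd.1 (h i hi)

theorem liftCoeff_modEq {q k : ℕ} (hq : q.Prime) (hk : 2 ≤ k) {c c' : ℤ → ℤ → ℤ}
    (h : ∀ n r, c n r ≡ c' n r [ZMOD q]) (m r n : ℤ) :
    liftCoeff k c m r n ≡ liftCoeff (q * k) c' m r n [ZMOD q] :=
  sum_modEq _ fun δ _ => (pow_modEq_pow_mul hq hk (δ : ℤ)).mul (h _ _)

/-! ### Polynomial growth of the lift and convergence of its Fourier series -/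

/-- The trace of the index matrix of `T`. -/
def indexTrace {N : ℕ} (T : FourierIndex N) : ℝ := T.1.1 * N + T.1.2.2

theorem abs_index_le {N : ℕ} (hN : 0 < N) (T : FourierIndex N) :
    |(T.1.1 : ℝ)| ≤ indexTrace T ∧ |(T.1.2.1 : ℝ)| ≤ indexTrace T ∧
      |(T.1.2.2 : ℝ)| ≤ indexTrace T ∧ 1 ≤ indexTrace T := by
  obtain ⟨hm, hr⟩ := (indexMatrix_posDef_iff hN).1 T.2
  have hn := index_last_pos hm hr
  have hm' : (1 : ℝ) ≤ T.1.1 := by exact_mod_cast hm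
  have hn' : (1 : ℝ) ≤ T.1.2.2 := by exact_mod_cast hn
  have hN' : (1 : ℝ) ≤ N := by exact_mod_cast hN
  have hr' : (T.1.2.1 : ℝ) ^ 2 < 4 * N * T.1.1 * T.1.2.2 := by exact_mod_cast hr
  have hmN : (T.1.1 : ℝ) ≤ T.1.1 * N := le_mul_of_one_le_right (by linarith) hN'
  rw [indexTrace]
  refine ⟨?_, ?_, ?_, by linarith⟩
  · rw [abs_of_pos (by linarith)]; linarith
  · refine abs_le_of_sq_le_sq ?_ (by linarith)
    nlinarith [sq_nonneg ((T.1.1 : ℝ) * N - T.1.2.2)]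
  · rw [abs_of_pos (by linarith)]; linarith

/-- With `X` the trace, `X ^ k` bounds the divisor power, `X ^ (2k)` the discriminant power, and one
further `X` the number of divisors. The bound on `‖c‖²` passes to `|c|` since `|c| ≤ |c|²` for
integers. -/
theorem abs_liftCoeff_le {N k : ℕ} (hN : 0 < N) {c : ℤ → ℤ → ℤ} {C : ℝ} (hC : 0 ≤ C)
    (h : ∀ n r : ℤ, 0 < 4 * (N : ℤ) * n - r ^ 2 →
      ‖(c n r : ℂ)‖ ^ 2 ≤ C * (4 * N * n - r ^ 2 : ℝ) ^ k) (T : FourierIndex N) :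
    |(liftCoeff k c T.1.1 T.1.2.1 T.1.2.2 : ℝ)| ≤ C * indexTrace T ^ (3 * k + 1) := by
  obtain ⟨-, -, -, hX1⟩ := abs_index_le hN T
  obtain ⟨h1, -, -, -⟩ := abs_index_le hN T
  obtain ⟨hm, hr⟩ := (indexMatrix_posDef_iff hN).1 T.2
  obtain ⟨⟨m, r, n⟩, hT⟩ := T
  simp only at hm hr h1 ⊢
  set X := indexTrace (⟨(m, r, n), hT⟩ : FourierIndex N) with hX
  have hn := index_last_pos hm hr
  have hXmn : 4 * (N : ℝ) * m * n ≤ X ^ 2 := by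
    rw [hX, indexTrace]
    nlinarith [sq_nonneg ((m : ℝ) * N - n)]
  have hterm : ∀ δ ∈ (Nat.gcd (Int.gcd n r) m.natAbs).divisors,
      |(((δ : ℤ) ^ (k - 1) * c (m * n / (δ : ℤ) ^ 2) (r / (δ : ℤ)) : ℤ) : ℝ)| ≤
        C * X ^ (3 * k) := by
    intro δ hδ
    have hδg := Nat.dvd_of_mem_divisors hδ
    have hδ0 : 0 < δ := Nat.pos_of_mem_divisors hδ
    have hδm : (δ : ℤ) ∣ m := Int.natCast_dvd.2 (hδg.trans (Nat.gcd_dvd_right _ _))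
    have hδn : (δ : ℤ) ∣ n := (Int.natCast_dvd_natCast.2 (hδg.trans (Nat.gcd_dvd_left _ _))).trans
      (Int.gcd_dvd_left _ _)
    have hδr : (δ : ℤ) ∣ r := (Int.natCast_dvd_natCast.2 (hδg.trans (Nat.gcd_dvd_left _ _))).trans
      (Int.gcd_dvd_right _ _)
    have hδle : (δ : ℝ) ≤ X := by
      refine le_trans ?_ ((le_abs_self _).trans h1)
      exact_mod_cast Int.le_of_dvd hm hδm
    have hδ0' : (0 : ℤ) < δ := by exact_mod_cast hδ0
    obtain ⟨m', rfl⟩ := hδm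
    obtain ⟨n', rfl⟩ := hδn
    obtain ⟨r', rfl⟩ := hδr
    have e1 : (δ : ℤ) * m' * (δ * n') / (δ : ℤ) ^ 2 = m' * n' := by
      rw [show (δ : ℤ) * m' * (δ * n') = δ ^ 2 * (m' * n') by ring,
        Int.mul_ediv_cancel_left _ (by positivity)]
    rw [e1, Int.mul_ediv_cancel_left _ hδ0'.ne']
    have hD : 0 < 4 * (N : ℤ) * (m' * n') - r' ^ 2 := by
      have : 0 < (δ : ℤ) ^ 2 * (4 * (N : ℤ) * (m' * n') - r' ^ 2) := by linarith
      exact (mul_pos_iff_of_pos_left (by positivity)).1 this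
    have hDX : (4 * N * ((m' * n' : ℤ) : ℝ) - (r' : ℝ) ^ 2) ≤ X ^ 2 := by
      have h5 : (1 : ℝ) ≤ (δ : ℝ) ^ 2 := one_le_pow₀ (by exact_mod_cast hδ0)
      have h6 : (0 : ℝ) < 4 * N * ((m' * n' : ℤ) : ℝ) - (r' : ℝ) ^ 2 := by exact_mod_cast hD
      push_cast at hXmn h6 ⊢
      nlinarith [sq_nonneg ((δ : ℝ) * r')]
    have hD0 : (0 : ℝ) ≤ 4 * N * ((m' * n' : ℤ) : ℝ) - (r' : ℝ) ^ 2 := by exact_mod_cast hD.le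
    have h7 := h _ _ hD
    rw [Complex.norm_intCast] at h7
    have h8 : |(c (m' * n') r' : ℝ)| ≤ |(c (m' * n') r' : ℝ)| ^ 2 := by
      rw [← Int.cast_abs]
      exact_mod_cast Int.le_self_sq _
    push_cast
    rw [abs_mul, abs_pow, Nat.abs_cast]
    calc (δ : ℝ) ^ (k - 1) * |(c (m' * n') r' : ℝ)| ≤ X ^ k * (C * (X ^ 2) ^ k) := by
          gcongr
          · calc (δ : ℝ) ^ (k - 1) ≤ X ^ (k - 1) := by gcongr
              _ ≤ X ^ k := pow_le_pow_right₀ hX1 (Nat.sub_le _ _)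
          · refine (h8.trans h7).trans ?_
            gcongr
      _ = C * X ^ (3 * k) := by ring
  rw [liftCoeff]
  push_cast
  refine (Finset.abs_sum_le_sum_abs _ _).trans ?_
  have hcard : (((Nat.gcd (Int.gcd n r) m.natAbs).divisors.card : ℕ) : ℝ) ≤ X := by
    refine le_trans ?_ h1
    have h9 : (Nat.gcd (Int.gcd n r) m.natAbs).divisors.card ≤ m.natAbs :=
      (Nat.card_divisors_le_self _).trans
        (Nat.le_of_dvd (Int.natAbs_pos.2 hm.ne') (Nat.gcd_dvd_right _ _))
    rw [← Int.cast_abs, Int.abs_eq_natAbs]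
    exact_mod_cast h9
  refine (Finset.sum_le_card_nsmul _ _ (C * X ^ (3 * k)) fun δ hδ => ?_).trans ?_
  · have := hterm δ hδ
    push_cast at this
    exact this
  · rw [nsmul_eq_mul]
    calc _ ≤ X * (C * X ^ (3 * k)) := by gcongr
      _ = _ := by ring

/-- If `Im Ω - ε` is positive semidefinite, its trace against the positive definite index is
nonnegative. The choice `ε = det / trace` works because `(u - ε)(w - ε) = v² + ε²`. -/
theorem exists_trace_le {N : ℕ} (hN : 0 < N) (Ω : siegelSet) :
    ∃ ε : ℝ, 0 < ε ∧ ∀ T : FourierIndex N,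
      ‖fourierTerm N T Ω‖ ≤ Real.exp (-(ε * indexTrace T)) := by
  obtain ⟨h01, h0, hdet⟩ := mem_siegelSet_iff.1 Ω.2
  set u := (Ω.1 0 0).im with hu
  set v := (Ω.1 0 1).im with hv
  set w := (Ω.1 1 1).im with hw
  have hw0 : 0 < w := by
    have : 0 < u * w := (sq_nonneg _).trans_lt hdet
    exact (mul_pos_iff_of_pos_left h0).1 this
  obtain ⟨ε, hε⟩ : ∃ ε, ε = (u * w - v ^ 2) / (u + w) := ⟨_, rfl⟩
  have hsum : 0 < u + w := by positivity
  have hε0 : 0 < ε := by rw [hε]; exact div_pos (by linarith) hsum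
  have hεeq : ε * (u + w) = u * w - v ^ 2 := by rw [hε]; field_simp
  have hu1 : 0 ≤ u - ε := by nlinarith [sq_nonneg u, sq_nonneg v]
  have hw1 : 0 ≤ w - ε := by nlinarith [sq_nonneg w, sq_nonneg v]
  refine ⟨2 * Real.pi * ε, by positivity, fun T => ?_⟩
  obtain ⟨hm, hr⟩ := (indexMatrix_posDef_iff hN).1 T.2
  have hn := index_last_pos hm hr
  rw [fourierTerm_eq, norm_e, Real.exp_le_exp, neg_le_neg_iff, mul_assoc (2 * Real.pi)]
  refine mul_le_mul_of_nonneg_left ?_ (by positivity)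
  have him : (T.1.1 * N * Ω.1 0 0 + T.1.2.1 * Ω.1 0 1 + T.1.2.2 * Ω.1 1 1 : ℂ).im =
      T.1.1 * N * u + T.1.2.1 * v + T.1.2.2 * w := by
    simp [Complex.mul_im, hu, hv, hw]
  rw [him, indexTrace]
  set a : ℝ := T.1.1 * N with ha
  set b : ℝ := (T.1.2.2 : ℝ) with hb
  have ha0 : 0 < a := by
    have : (0 : ℝ) < T.1.1 := by exact_mod_cast hm
    have : (0 : ℝ) < N := by exact_mod_cast hN
    positivity
  have hb0 : 0 < b := by rw [hb]; exact_mod_cast hn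
  have hr' : (T.1.2.1 : ℝ) ^ 2 ≤ 4 * (a * b) := by
    have : (T.1.2.1 : ℝ) ^ 2 < 4 * N * T.1.1 * T.1.2.2 := by exact_mod_cast hr
    rw [ha, hb]
    linarith
  have hvv : v ^ 2 ≤ (u - ε) * (w - ε) := by nlinarith
  have h1 : ((T.1.2.1 : ℝ) * v) ^ 2 ≤ (a * (u - ε) + b * (w - ε)) ^ 2 := by
    have h2 := mul_le_mul hr' hvv (sq_nonneg _) (by positivity)
    have h3 := sq_nonneg (a * (u - ε) - b * (w - ε))
    nlinarith
  have h4 := (abs_le.1 (abs_le_of_sq_le_sq h1 (by positivity))).1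
  linarith

theorem summable_exp_neg_mul_abs {b : ℝ} (hb : 0 < b) :
    Summable fun n : ℤ => Real.exp (-(b * |(n : ℝ)|)) := by
  have h1 : Summable fun n : ℕ => Real.exp (n * (-b)) :=
    Real.summable_exp_nat_mul_iff.2 (by linarith)
  refine Summable.of_nat_of_neg (h1.congr fun n => ?_) (h1.congr fun n => ?_) <;>
  · congr 1
    simp
    ring

theorem summable_indexTrace {N : ℕ} (hN : 0 < N) {ε : ℝ} (hε : 0 < ε) :
    Summable fun T : FourierIndex N => Real.exp (-(ε * indexTrace T)) := by
  have hb : 0 < ε / 3 := by positivity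
  have h1 := summable_exp_neg_mul_abs hb
  have h2 := h1.mul_of_nonneg (h1.mul_of_nonneg h1 (fun _ => Real.exp_nonneg _)
    (fun _ => Real.exp_nonneg _)) (fun _ => Real.exp_nonneg _)
    (fun _ => mul_nonneg (Real.exp_nonneg _) (Real.exp_nonneg _))
  refine Summable.of_nonneg_of_le (fun _ => Real.exp_nonneg _) (fun T => ?_)
    (h2.comp_injective (Subtype.val_injective (p := fun p => (indexMatrix N p).PosDef)))
  simp only [Function.comp_apply]
  rw [← Real.exp_add, ← Real.exp_add, Real.exp_le_exp]
  obtain ⟨h3, h4, h5, -⟩ := abs_index_le hN T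
  nlinarith

theorem hasIntegralFourierExpansion_gritsenkoLift {N k : ℕ} (hN : 0 < N) {φ : ℍ → ℂ → ℂ}
    (hφ : IsJacobiCuspForm k N φ) {c : ℤ → ℤ → ℤ}
    (h : HasJacobiExpansion φ (fun n r => (c n r : ℂ))) :
    HasIntegralFourierExpansion N (gritsenkoLift k N φ)
      (fun T => liftCoeff k c T.1.1 T.1.2.1 T.1.2.2) := by
  intro Ω
  obtain ⟨C₀, hC₀⟩ := hφ.exists_coeff_le hN h
  obtain ⟨ε, hε, hT⟩ := exists_trace_le hN Ω
  set C := max C₀ 0 with hCdef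
  have hC : 0 ≤ C := le_max_right _ _
  have hbound := abs_liftCoeff_le (k := k) hN hC fun n r hD => (hC₀ n r hD).trans (by
    have : (0 : ℝ) ≤ 4 * N * n - r ^ 2 := by exact_mod_cast hD.le
    gcongr
    exact le_max_left _ _)
  have hs : Summable fun T : FourierIndex N =>
      (liftCoeff k c T.1.1 T.1.2.1 T.1.2.2 : ℂ) * fourierTerm N T Ω := by
    refine Summable.of_norm_bounded ((summable_indexTrace hN (half_pos hε)).mul_left
      (C * ((3 * k + 1).factorial / (ε / 2) ^ (3 * k + 1)))) fun T => ?_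
    have hX : 0 ≤ indexTrace T := zero_le_one.trans (abs_index_le hN T).2.2.2
    rw [norm_mul, Complex.norm_intCast]
    -- Half of the exponential decay absorbs the polynomial growth, the other half is summable.
    calc _ ≤ C * indexTrace T ^ (3 * k + 1) * Real.exp (-(ε * indexTrace T)) :=
          mul_le_mul (hbound T) (hT T) (norm_nonneg _) (by positivity)
      _ = C * (indexTrace T ^ (3 * k + 1) * Real.exp (-(ε / 2 * indexTrace T))) *
          Real.exp (-(ε / 2 * indexTrace T)) := by
          rw [show -(ε * indexTrace T) = -(ε / 2 * indexTrace T) + -(ε / 2 * indexTrace T) by ring,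
            Real.exp_add]
          ring
      _ ≤ _ := by
          gcongr
          exact pow_mul_exp_neg_le (half_pos hε) hX _
  convert hs.hasSum using 1
  rw [gritsenkoLift]
  exact tsum_congr fun T => by rw [gritsenkoCoeff_eq k h]

/-! ### Conclusion -/

/-- An integral expansion over positive definite indices together with paramodular invariance is
enough, so the lemma applies to `T_q(g ^ q)` as well as to `g`, with no separate proof that the
former is a Siegel cusp form. -/
theorem isJacobiCuspForm_fourierJacobiCoeff {N K : ℕ} (hN : 0 < N) {f : siegelSet → ℂ}
    {a : FourierIndex N → ℤ} (hf : HasIntegralFourierExpansion N f a)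
    (hinv : ∀ γ ∈ paramodularGroup N, slash K γ f = f) :
    IsJacobiCuspForm K N (fourierJacobiCoeff N 1 f) where
  holomorphic := (hasJacobiExpansion_fourierJacobiCoeff hN hf).differentiableOn
  invariant := fun _ hγ => jacobi_invariant hN hf hinv hγ
  expansion := ⟨_, hasJacobiExpansion_fourierJacobiCoeff hN hf, fun _ _ h =>
    firstCoeff_ne_zero hN (a := a) (Int.cast_ne_zero.1 h)⟩

theorem firstCoeff_modEq {N : ℕ} {a b : FourierIndex N → ℤ} {q : ℤ}
    (h : ∀ T, a T ≡ b T [ZMOD q]) (n r : ℤ) :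
    firstCoeff N a n r ≡ firstCoeff N b n r [ZMOD q] := by
  rw [firstCoeff, firstCoeff]
  split_ifs
  · exact h _
  · rfl

end

end Paramodular

end

theorem theorem3p14 (N k q : ℕ) (hN : 0 < N) (hk : 2 ≤ k) (hq : q.Prime) (hqN : ¬ q ∣ N)
    (g : Paramodular.siegelSet → ℂ)
    (hg : Paramodular.IsIntegralParamodularCuspForm k N g) :
    -- the congruence for the Hecke operator of weight `q * k` applied to the power
    Paramodular.FourierCongr N q (Paramodular.heckeT (q * k) N q (g ^ q)) g ∧
    -- the first Fourier-Jacobi coefficients are Jacobi cusp forms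
    Paramodular.IsJacobiCuspForm (q * k) N
      (Paramodular.fourierJacobiCoeff N 1 (Paramodular.heckeT (q * k) N q (g ^ q))) ∧
    Paramodular.IsIntegralJacobiCuspForm k N (Paramodular.fourierJacobiCoeff N 1 g) ∧
    -- and their Gritsenko lifts are congruent
    Paramodular.FourierCongr N q
      (Paramodular.gritsenkoLift k N (Paramodular.fourierJacobiCoeff N 1 g))
      (Paramodular.gritsenkoLift (q * k) N
        (Paramodular.fourierJacobiCoeff N 1
          (Paramodular.heckeT (q * k) N q (g ^ q)))) := by
  obtain ⟨⟨-, hinv, -, -⟩, a, ha⟩ := hg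
  obtain ⟨A, hA, hAa⟩ := Paramodular.exists_pow_expansion hN hq ha
  have hinvq : ∀ γ ∈ Paramodular.paramodularGroup N,
      Paramodular.slash (q * k) γ (g ^ q) = g ^ q := fun γ hγ => by
    rw [Paramodular.slash_pow (.of_mem_paramodularGroup hγ) rfl, hinv γ hγ]
  have hK : 3 ≤ q * k := le_trans (by norm_num) (Nat.mul_le_mul hq.two_le hk)
  obtain ⟨b, hb, hbA⟩ := Paramodular.exists_heckeT_expansion hN hq hqN hA hK hinvq
  have hcongr : ∀ T, b T ≡ a T [ZMOD q] := fun T => (hbA T).trans (hAa T)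
  have hψ := Paramodular.isJacobiCuspForm_fourierJacobiCoeff hN ha hinv
  have hφ := Paramodular.isJacobiCuspForm_fourierJacobiCoeff hN hb fun γ hγ =>
    Paramodular.heckeT_invariant hN hq.pos hinvq hγ
  have hψ' := Paramodular.hasJacobiExpansion_fourierJacobiCoeff hN ha
  have hφ' := Paramodular.hasJacobiExpansion_fourierJacobiCoeff hN hb
  exact ⟨⟨b, a, hb, ha, hcongr⟩, hφ, ⟨hψ, _, hψ'⟩, _, _,
    Paramodular.hasIntegralFourierExpansion_gritsenkoLift hN hψ hψ',
    Paramodular.hasIntegralFourierExpansion_gritsenkoLift hN hφ hφ', fun T =>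
      Paramodular.liftCoeff_modEq hq hk
        (Paramodular.firstCoeff_modEq fun T => (hcongr T).symm) _ _ _⟩
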